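/- **Setting.** Let $\Phi$ be a nonempty (possibly non-reduced, crystallographic) root system in $V_{\mathbb R}^*$, where $V_{\mathbb R}$ is a finite-dimensional real vector space. Let $V_{\mathbb Z}\subset V_{\mathbb R}$ be the $\mathbb Z$-span of the coroots $\alpha^\vee$, let $r_\alpha$ be the reflection of $\alpha$, and write $(\alpha,\beta)$ for the set of roots $r\alpha+s\beta$ with $r,s\in\mathbb Z_{>0}$. Let $R$ be a nonzero totally ordered abelian group. A *root group datum* of type $\Phi$ in a group $G$ is a system $(T,(U_\alpha,M_\alpha)_{\alpha\in\Phi})$ such that: 1. $T$ and the $U_\alpha$ are subgroups of $G$ and $U_\alpha\ne 1$; 2. $[U_\alpha,U_\beta]\subset\langle U_\gamma,\ \gamma\in(\alpha,\beta)\rangle$ if $\beta\notin\mathbb R_{<0}\alpha$; 3. $U_{2\alpha}\subsetneq U_\alpha$ if $\alpha,2\alpha\in\Phi$; 4. $M_\alpha$ is a right coset $Tm$ of $T$, and $U_{-\alpha}\setminus\{1\}\subset U_\alpha M_\alpha U_\alpha$; 5. $mU_\beta m^{-1}=U_{r_\alpha(\beta)}$ for $m\in M_\alpha$; 6. $TU^+\cap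 U^-=\{1\}$ for every choice $\Phi^+$ of positive roots, where $U^{\pm}=\langle U_\alpha,\ \alpha\in\pm\Phi^+\rangle$. It is *generating* if $T$ and the $U_\alpha$ generate $G$. Put $U_{2\alpha}=1$ if $2\alpha\notin\Phi$. An *$R$-valuation* of the datum is a family of maps $\varphi_\alpha:U_\alpha\to R\cup\{\infty\}$ such that, with $U_{\alpha,\lambda}=\varphi_\alpha^{-1}([\lambda,\infty])$: * $\varphi_\alpha(U_\alpha)$ has at least $3$ elements; * each $U_{\alpha,\lambda}$ ($\lambda\in R\cup\{\infty\}$) is a subgroup, and $U_{\alpha,\infty}=1$; * for $m\in M_\alpha$, the map $u\mapsto\varphi_{-\alpha}(u)-\varphi_\alpha(mum^{-1})$ is constant on $U_{-\alpha}\setminus\{1\}$; * if $\beta\notin\mathbb R_{\le0}\alpha$, then $[U_{\alpha,\lambda},U_{\beta,\mu}]$ is contained in the group generated by the $U_{r\alpha+s\beta,\,r\lambda+s\mu}$ with $r,s\in\mathbb Z_{>0}$ and $r\alpha+s\beta\in\Phi$; * $\varphi_{2\alpha}=2\varphi_\alpha|_{U_{2\alpha}}$ if $\alpha,2\alpha\in\Phi$;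 * if $u\in U_\alpha$, $u',u''\in U_{-\alpha}$ and $u'uu''\in M_\alpha$, then $\varphi_{-\alpha}(u')=-\varphi_\alpha(u)$. Let $\mathbb A_R$ be an affine space over $V_R=V_{\mathbb Z}\otimes_{\mathbb Z}R$ with an origin $o$, and write $\alpha(x)=\alpha(x-o)\in R$ for $\alpha\in\Phi$, $x\in\mathbb A_R$. Let $G$ be a group with a generating root group datum $(T,(U_\alpha,M_\alpha)_{\alpha\in\Phi})$ and an $R$-valuation $(\varphi_\alpha)$. Let $N$ be the subgroup generated by the $M_\alpha$, and let $\nu$ be an action of $N$ on $\mathbb A_R$, by affine bijections whose linear parts come from $\mathrm{GL}(V_{\mathbb Z})$, which is compatible with the valuation. This means that the linear part of $\nu(m)$ is $r_\alpha$ for $m\in M_\alpha$, and that $2\varphi_\alpha(u)+\alpha(\nu(m)(o)-o)=0$ for $u\in U_\alpha\setminus\{1\}$ and $m\in M_\alpha\cap U_{-\alpha}uU_{-\alpha}$. **Local objects.** Put $U'_{\alpha,\lambda}=\varphi_\alpha^{-1}(]\lambda,\infty])$ and $$\Gamma'_\alpha=\Big\{\varphi_\alpha(u)\ :\ u\in U_\alpha\setminus\{1\},\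 U_{\alpha,\varphi_\alpha(u)}=\bigcap_{v\in U_{2\alpha}}U_{\alpha,\varphi_\alpha(uv)}\Big\},\qquad M_{\alpha,\lambda}=M_\alpha\cap U_{-\alpha}\varphi_\alpha^{-1}(\{\lambda\})U_{-\alpha}.$$ For a nonempty subset $\Omega\subset\mathbb A_R$, put * $U_{\alpha,\Omega}=\bigcap_{x\in\Omega}U_{\alpha,-\alpha(x)}$, $\ U'_{\alpha,\Omega}=\bigcap_{x\in\Omega}U'_{\alpha,-\alpha(x)}$, $\ U_\Omega=\langle U_{\alpha,\Omega},\ \alpha\in\Phi\rangle$, $\ T_\Omega=T\cap U_\Omega$; * $\Phi^*_\Omega$ the set of the roots that are constant on $\Omega$, and $\Phi_\Omega$ the set of the $\alpha\in\Phi$ for which there is $\lambda_\alpha\in\Gamma'_\alpha$ with $-\alpha(x)=\lambda_\alpha$ for all $x\in\Omega$; * $T^*_\Omega$ the group generated by the $T\cap\langle U_{\alpha,\Omega},U'_{-\alpha,\Omega}\rangle$ for $\alpha\in\Phi$; * $U^*_{\alpha,\Omega}=U'_{\alpha,\Omega}$ if $\alpha\in\Phi^*_\Omega$ and $U^*_{\alpha,\Omega}=U_{\alpha,\Omega}$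 otherwise, and $U^*_\Omega$ the group generated by $T^*_\Omega$ and the $U^*_{\alpha,\Omega}$ for $\alpha\in\Phi$. **Theorem.** The set $\Phi_\Omega$ is a root system in the subspace of $V_{\mathbb R}^*$ that it spans, and $U^*_\Omega$ is a normal subgroup of $U_\Omega$. Let $\overline{G}_\Omega=U_\Omega/U^*_\Omega$, let $\overline{T}_\Omega$ and $\overline{U}_{\alpha,\Omega}$ be the images of $T_\Omega$ and $U_{\alpha,\Omega}$ in $\overline{G}_\Omega$, and for $\alpha\in\Phi_\Omega$ let $\overline{M}_{\alpha,\Omega}$ be the product of $\overline{T}_\Omega$ and the image of $M_{\alpha,\lambda_\alpha}\subset U_\Omega$, where $\lambda_\alpha=-\alpha(x)$ for $x\in\Omega$. Then $\big(\overline{T}_\Omega,(\overline{U}_{\alpha,\Omega},\overline{M}_{\alpha,\Omega})_{\alpha\in\Phi_\Omega}\big)$ is a generating root group datum of type $\Phi_\Omega$ in $\overline{G}_\Omega$. -/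

import Mathlib

open scoped Pointwise TensorProduct

namespace LocalRootDatum

/-! ### Root systems -/

section Roots

variable {ι E V : Type*} [AddCommGroup E] [Module ℝ E] [AddCommGroup V] [Module ℝ V]
  (P : RootPairing ι ℝ E V)

/-- The index of the root `-α`. -/
def negIdx (i : ι) : ι := P.reflectionPerm i i

theorem root_negIdx (i : ι) : P.root (negIdx P i) = -P.root i := by
  simp [negIdx]

/-- The set `(α, β)` of the roots `r α + s β` with `r, s` positive integers. -/
def posCombs (i j : ι) : Set ι :=
  {k | ∃ r s : ℕ, 0 < r ∧ 0 < s ∧ P.root k = r • P.root i + s • P.root j}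

end Roots

/-! ### Root group data -/

section RootGroupDatum

variable {ι E V G : Type*} [AddCommGroup E] [Module ℝ E] [AddCommGroup V] [Module ℝ V] [Group G]

/-- `(T, (U_α, M_α)_α)` is a root group datum of `G` of type the root system `P`.
A choice of positive roots is given by the chamber of a vector `v` on which no root vanishes. -/
structure IsRootGroupDatum (P : RootPairing ι ℝ E V) (T : Subgroup G) (U : ι → Subgroup G)
    (M : ι → Set G) : Prop where
  nontrivial : ∀ i, U i ≠ ⊥
  commutator_le : ∀ i j, (∀ c : ℝ, c < 0 → P.root j ≠ c • P.root i) →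
    ⁅U i, U j⁆ ≤ ⨆ k ∈ posCombs P i j, U k
  double_lt : ∀ i j, P.root j = (2 : ℝ) • P.root i → U j < U i
  isCoset : ∀ i, ∃ m : G, M i = {g | ∃ t ∈ T, g = t * m}
  opposite_subset : ∀ i, (U (negIdx P i) : Set G) \ {1} ⊆ (U i : Set G) * M i * (U i : Set G)
  conj_eq : ∀ i j, ∀ m ∈ M i,
    (U j).map (MulAut.conj m).toMonoidHom = U (P.reflectionPerm i j)
  inter_eq : ∀ v : V, (∀ i, P.root' i v ≠ 0) →
    ((T : Set G) * ((⨆ (i) (_ : 0 < P.root' i v), U i : Subgroup G) : Set G)) ∩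
      ((⨆ (i) (_ : P.root' i v < 0), U i : Subgroup G) : Set G) = {1}

/-- The datum is generating: `G` is generated by `T` and the `U_α`. -/
def IsGeneratingDatum (T : Subgroup G) (U : ι → Subgroup G) : Prop :=
  T ⊔ ⨆ i, U i = ⊤

/-- The subgroup `N` of `G` generated by the `M_α` (for a nonempty root system). -/
def groupN (M : ι → Set G) : Subgroup G := Subgroup.closure (⋃ i, M i)

/-- The group `U_{2α}`, trivial when `2α` is not a root. -/
def doubleGroup (P : RootPairing ι ℝ E V) (U : ι → Subgroup G) (i : ι) : Subgroup G :=
  ⨆ (j) (_ : P.root j = (2 : ℝ) • P.root i), U j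

end RootGroupDatum

/-! ### Valuations of root group data -/

section Valuation

variable {ι E V G R : Type*} [AddCommGroup E] [Module ℝ E] [AddCommGroup V] [Module ℝ V] [Group G]
  [AddCommGroup R] [LinearOrder R]

/-- The set `U_{α,l}` of the elements of `U_α` with value in `[l, ∞]`. -/
def valSet (U : ι → Subgroup G) (φ : ι → G → WithTop R) (i : ι) (l : WithTop R) : Set G :=
  {g | g ∈ U i ∧ l ≤ φ i g}

/-- An `R`-valuation of a root group datum, where `R ∪ {∞}` is `WithTop R`.
Only the restriction of `φ_α` to `U_α` is meaningful. -/
structure RValuation (P : RootPairing ι ℝ E V) (U : ι → Subgroup G) (M : ι → Set G)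
    (R : Type*) [AddCommGroup R] [LinearOrder R] where
  φ : ι → G → WithTop R
  three_le : ∀ i, 3 ≤ (φ i '' (U i : Set G)).encard
  isSubgroup : ∀ i (l : WithTop R), ∃ H : Subgroup G, (H : Set G) = valSet U φ i l
  valSet_top : ∀ i, valSet U φ i ⊤ = {1}
  conj_const : ∀ i, ∀ m ∈ M i, ∃ c : R, ∀ u ∈ U (negIdx P i), u ≠ 1 →
    φ (negIdx P i) u = φ i (m * u * m⁻¹) + (c : WithTop R)
  commutator_mem : ∀ i j, (∀ c : ℝ, c ≤ 0 → P.root j ≠ c • P.root i) → ∀ l μ : R,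
    ∀ u ∈ valSet U φ i (l : WithTop R), ∀ v ∈ valSet U φ j (μ : WithTop R),
      u * v * u⁻¹ * v⁻¹ ∈ Subgroup.closure {g : G | ∃ (k : ι) (r s : ℕ), 0 < r ∧ 0 < s ∧
        P.root k = r • P.root i + s • P.root j ∧
        g ∈ valSet U φ k ((r • l + s • μ : R) : WithTop R)}
  double_eq : ∀ i j, P.root j = (2 : ℝ) • P.root i → ∀ u ∈ U j, φ j u = φ i u + φ i u
  opposite_eq : ∀ i, ∀ u ∈ U i, ∀ u₁ ∈ U (negIdx P i), ∀ u₂ ∈ U (negIdx P i),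
    u₁ * u * u₂ ∈ M i → φ (negIdx P i) u₁ + φ i u = 0

namespace RValuation

variable {P : RootPairing ι ℝ E V} {U : ι → Subgroup G} {M : ι → Set G} (w : RValuation P U M R)

/-- The subgroup `U_{α,l}`. -/
def subgroupGE (i : ι) (l : R) : Subgroup G where
  carrier := valSet U w.φ i (l : WithTop R)
  mul_mem' {a b} ha hb := by
    obtain ⟨H, hH⟩ := w.isSubgroup i l
    rw [← hH] at ha hb ⊢
    exact H.mul_mem ha hb
  one_mem' := by
    obtain ⟨H, hH⟩ := w.isSubgroup i l
    rw [← hH]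
    exact H.one_mem
  inv_mem' {a} ha := by
    obtain ⟨H, hH⟩ := w.isSubgroup i l
    rw [← hH] at ha ⊢
    exact H.inv_mem ha

/-- The subgroup of the elements of `U_α` with value in `]l, ∞]`. -/
def subgroupGT (i : ι) (l : R) : Subgroup G where
  carrier := {g | g ∈ U i ∧ (l : WithTop R) < w.φ i g}
  mul_mem' {a b} ha hb := by
    obtain ⟨H, hH⟩ := w.isSubgroup i (min (w.φ i a) (w.φ i b))
    have h1 : a ∈ H := by
      rw [← SetLike.mem_coe, hH]; exact ⟨ha.1, min_le_left _ _⟩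
    have h2 : b ∈ H := by
      rw [← SetLike.mem_coe, hH]; exact ⟨hb.1, min_le_right _ _⟩
    have h3 : a * b ∈ (H : Set G) := H.mul_mem h1 h2
    rw [hH] at h3
    exact ⟨h3.1, lt_of_lt_of_le (lt_min ha.2 hb.2) h3.2⟩
  one_mem' := by
    have h : (1 : G) ∈ valSet U w.φ i ⊤ := by rw [w.valSet_top]; rfl
    exact ⟨h.1, lt_of_lt_of_le (WithTop.coe_lt_top l) h.2⟩
  inv_mem' {a} ha := by
    obtain ⟨H, hH⟩ := w.isSubgroup i (w.φ i a)
    have h1 : a ∈ H := by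
      rw [← SetLike.mem_coe, hH]; exact ⟨ha.1, le_rfl⟩
    have h3 : a⁻¹ ∈ (H : Set G) := H.inv_mem h1
    rw [hH] at h3
    exact ⟨h3.1, lt_of_lt_of_le ha.2 h3.2⟩

/-- The set of values `Γ'_α`. -/
def valuesPrime (i : ι) : Set R :=
  {l | ∃ u ∈ U i, u ≠ 1 ∧ w.φ i u = (l : WithTop R) ∧
    valSet U w.φ i (w.φ i u) = ⋂ v ∈ doubleGroup P U i, valSet U w.φ i (w.φ i (u * v))}

/-- The set `M_{α,l}`, the intersection of `M_α` with `U_{-α} φ_α⁻¹(l) U_{-α}`. -/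
def valuedCoset (i : ι) (l : R) : Set G :=
  M i ∩ ((U (negIdx P i) : Set G) * {u | u ∈ U i ∧ w.φ i u = (l : WithTop R)} *
    (U (negIdx P i) : Set G))

end RValuation

end Valuation

/-! ### The affine apartment -/

section Apartment

variable {ι E V : Type*} [AddCommGroup E] [Module ℝ E] [AddCommGroup V] [Module ℝ V]
  (P : RootPairing ι ℝ E V) (R : Type*) [AddCommGroup R]

/-- `V_R = V_ℤ ⊗ R`, with `V_ℤ` the `ℤ`-span of the coroots. -/
abbrev VR : Type _ := P.corootSpan ℤ ⊗[ℤ] R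

variable {R} in
/-- The map `V_R → R` induced by the root `α`. -/
noncomputable def rootEval [P.IsCrystallographic] (i : ι) : VR P R →ₗ[ℤ] R :=
  (TensorProduct.lid ℤ R).toLinearMap ∘ₗ (P.root'In ℤ i).rTensor R

/-- The coroot `α^∨` as an element of `V_ℤ`. -/
def corootZ (i : ι) : P.corootSpan ℤ :=
  ⟨P.coroot i, Submodule.subset_span (Set.mem_range_self i)⟩

/-- The group of the automorphisms of the `R`-aff space `A` with underlying module `V_R`: the
affine bijections whose linear part is `g ⊗ id` for an automorphism `g` of `V_ℤ`. -/
def affGroup (A : Type*) [AddTorsor (VR P R) A] : Subgroup (A ≃ᵃ[ℤ] A) where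
  carrier := {f | ∃ g : P.corootSpan ℤ ≃ₗ[ℤ] P.corootSpan ℤ,
    ∀ x, f.linear x = LinearMap.rTensor R g.toLinearMap x}
  mul_mem' := by
    rintro a b ⟨g, hg⟩ ⟨h, hh⟩
    refine ⟨h.trans g, fun x => ?_⟩
    have h1 : (a * b).linear x = a.linear (b.linear x) := rfl
    rw [h1, hg, hh, LinearEquiv.coe_trans, LinearMap.rTensor_comp, LinearMap.comp_apply]
  one_mem' := by
    refine ⟨LinearEquiv.refl ℤ _, fun x => ?_⟩
    have h1 : (1 : A ≃ᵃ[ℤ] A).linear x = x := rfl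
    rw [h1, LinearEquiv.refl_toLinearMap, LinearMap.rTensor_id, LinearMap.id_apply]
  inv_mem' := by
    rintro a ⟨g, hg⟩
    refine ⟨g.symm, fun x => ?_⟩
    have h1 : (a⁻¹).linear x = a.linear.symm x := rfl
    rw [h1, LinearEquiv.symm_apply_eq, hg, ← LinearMap.comp_apply, ← LinearMap.rTensor_comp,
      LinearEquiv.comp_symm, LinearMap.rTensor_id, LinearMap.id_apply]

end Apartment

/-! ### Compatible actions -/

section Action

variable {ι E V G R A : Type*} [AddCommGroup E] [Module ℝ E] [AddCommGroup V] [Module ℝ V]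
  [Group G] [AddCommGroup R] [LinearOrder R]
  {P : RootPairing ι ℝ E V} [P.IsCrystallographic] {U : ι → Subgroup G} {M : ι → Set G}

/-- The action `ν` of `N` on the apartment with origin `o` is compatible with the valuation.
The first field says that the linear part of `ν` is the homomorphism from `N` to the Weyl group
that sends every element of `M_α` to the reflection `r_α` (it is determined by these values,
because the `M_α` generate `N`). In the second field, `n` is the element `m(u)`. -/
structure IsCompatibleAction (w : RValuation P U M R) [AddTorsor (VR P R) A] (o : A)
    (ν : groupN M →* affGroup P R A) : Prop where
  linear_eq : ∀ i, ∀ n : groupN M, (n : G) ∈ M i → ∀ x : VR P R,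
    (ν n : A ≃ᵃ[ℤ] A).linear x = x - corootZ P i ⊗ₜ[ℤ] rootEval P i x
  value_eq : ∀ i, ∀ u ∈ U i, u ≠ 1 → ∀ n : groupN M, (n : G) ∈ M i →
    (∃ u₁ ∈ U (negIdx P i), ∃ u₂ ∈ U (negIdx P i), (n : G) = u₁ * u * u₂) →
    w.φ i u + w.φ i u + ((rootEval P i ((ν n : A ≃ᵃ[ℤ] A) o -ᵥ o) : R) : WithTop R) = 0

end Action

/-! ### The local root system and the local groups of a subset of the apartment -/

namespace RValuation

variable {ι E V G R A : Type*} [AddCommGroup E] [Module ℝ E] [AddCommGroup V] [Module ℝ V]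
  [Group G] [AddCommGroup R] [LinearOrder R]
  {P : RootPairing ι ℝ E V} [P.IsCrystallographic] {U : ι → Subgroup G} {M : ι → Set G}
  (w : RValuation P U M R) [AddTorsor (VR P R) A] (o : A) (Ω : Set A) (T : Subgroup G)

/-- `U_{α,Ω}`, the intersection of the `U_{α,-α(x)}` for `x ∈ Ω`. -/
noncomputable def rootGroup (i : ι) : Subgroup G :=
  ⨅ x ∈ Ω, w.subgroupGE i (-rootEval P i (x -ᵥ o))

/-- `U'_{α,Ω}`, the intersection of the `U'_{α,-α(x)}` for `x ∈ Ω`. -/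
noncomputable def rootGroupPrime (i : ι) : Subgroup G :=
  ⨅ x ∈ Ω, w.subgroupGT i (-rootEval P i (x -ᵥ o))

/-- `U_Ω`. -/
noncomputable def localGroup : Subgroup G := ⨆ i, w.rootGroup o Ω i

/-- `T_Ω`. -/
noncomputable def localTorus : Subgroup G := w.localGroup o Ω ⊓ T

/-- `T'_{α,Ω}`, the intersection with `T` of the group `L'_{α,Ω}` generated by `U_{α,Ω}` and
`U'_{-α,Ω}`. -/
noncomputable def torusPrime (i : ι) : Subgroup G :=
  (w.rootGroup o Ω i ⊔ w.rootGroupPrime o Ω (negIdx P i)) ⊓ T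

/-- `T*_Ω`. -/
noncomputable def torusStar : Subgroup G := ⨆ i, w.torusPrime o Ω T i

/-- `Φ*_Ω`, the set of the roots that are constant on `Ω`. -/
def rootsStar (P : RootPairing ι ℝ E V) [P.IsCrystallographic] (R : Type*) [AddCommGroup R]
    {A : Type*} [AddTorsor (VR P R) A] (o : A) (Ω : Set A) : Set ι :=
  {i | ∃ l : R, ∀ x ∈ Ω, -rootEval P i (x -ᵥ o) = l}

/-- `Φ_Ω`, the set of the roots `α` such that `-α` is constant on `Ω` with value in `Γ'_α`. -/
def localRoots : Set ι :=
  {i | ∃ l ∈ w.valuesPrime i, ∀ x ∈ Ω, -rootEval P i (x -ᵥ o) = l}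

open Classical in
/-- `U*_{α,Ω}`. -/
noncomputable def rootGroupStar (i : ι) : Subgroup G :=
  if i ∈ rootsStar P R o Ω then w.rootGroupPrime o Ω i else w.rootGroup o Ω i

/-- `U*_Ω`. -/
noncomputable def localGroupStar : Subgroup G :=
  w.torusStar o Ω T ⊔ ⨆ i, w.rootGroupStar o Ω i

/-- The kernel `U*_Ω` as a subgroup of `U_Ω`. -/
noncomputable abbrev localKernel : Subgroup (w.localGroup o Ω) :=
  (w.localGroupStar o Ω T).subgroupOf (w.localGroup o Ω)

variable [(w.localKernel o Ω T).Normal]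

/-- The image of `T_Ω` in `U_Ω / U*_Ω`. -/
noncomputable def torusBar : Subgroup (w.localGroup o Ω ⧸ w.localKernel o Ω T) :=
  ((w.localTorus o Ω T).subgroupOf (w.localGroup o Ω)).map (QuotientGroup.mk' _)

/-- The image of `U_{α,Ω}` in `U_Ω / U*_Ω`. -/
noncomputable def rootGroupBar (i : ι) : Subgroup (w.localGroup o Ω ⧸ w.localKernel o Ω T) :=
  ((w.rootGroup o Ω i).subgroupOf (w.localGroup o Ω)).map (QuotientGroup.mk' _)

/-- For a root `α` with constant value `-l` on `Ω`, the product of the image of `T_Ω` and of the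
image of `M_{α,l}` (a subset of `U_Ω`) in `U_Ω / U*_Ω`. -/
noncomputable def cosetBar (i : ι) : Set (w.localGroup o Ω ⧸ w.localKernel o Ω T) :=
  (w.torusBar o Ω T : Set (w.localGroup o Ω ⧸ w.localKernel o Ω T)) *
    (QuotientGroup.mk' (w.localKernel o Ω T)) ''
      {m | ∃ l : R, (∀ x ∈ Ω, -rootEval P i (x -ᵥ o) = l) ∧ (m : G) ∈ w.valuedCoset i l}

end RValuation

end LocalRootDatum

open LocalRootDatum

/-! Modulo `U*_Ω` only the roots that are constant on `Ω` survive. If `-α` has the value `l` on `Ω`,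
what is left of `U_α` is `U_{α,l} / U'_{α,l}`, and `l ∈ Γ'_α` says that `U_{2α}` does not exhaust
this quotient. The substance of the theorem is that `U*_Ω` is normal in `U_Ω` and meets each `U_α`
exactly in `U*_{α,Ω}`; the axioms of a root group datum then descend from `G` to the quotient.

Normality. The commutator relations show that `U_{α,Ω}` conjugates `U*_{β,Ω}` into `U*_Ω`, unless
`β` is a negative multiple of `α` (`commutator_mem_rootGroupStar`). The opposite case is a
computation in rank one. Elements of `U_α` and `U_{-α}` whose values have a positive sum can be
interchanged at the cost of a factor in `T` that preserves all valuations (`exists_mul_eq`). This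
factor is a product of two elements of `M_α`, and compatibility with `ν` says how such elements
shift the valuations (`exists_shift`). For roots `β` not proportional to `α`, its effect is
controlled by `commutator_mem_subgroupGT`: its commutator with `U_{β,l}` lies in a group attached to
the roots `pα + qβ` with `q > 0`, out of which uniqueness of decompositions isolates `U'_{β,l}`. For
`α` itself, `torus_mem_sup_and_commutator_mem` shows that it acts trivially on `U_{α,k} / U'_{α,k}`.

Intersection. For a system of positive roots, the product of the positive part of `U*_Ω`, the
valuation-preserving torus and the negative part is a cell. Crossing a wall does not change it, by
the rank one computation, so it is stable under left multiplication by all generators and contains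
`U*_Ω` (`mem_bigCell`). Since `T U⁺ ∩ U⁻ = 1`, decompositions in the cell are unique. This gives the
intersection with `U_α`, and also the last axiom for the quotient.

Local roots. An element of `M_{α,l}`, with `l` the value of `-α` on `Ω`, lies in `U_Ω`. Normality
forces the shift of valuations that it produces to agree with the change of the values of the roots
on `Ω` (`add_le_of_conj`, `exists_shift_hasLevel`). Hence the local roots are stable under their own
reflections, and the axiom on conjugation by `M_α` holds in the quotient. -/

namespace LocalRootDatum

/-! ### Rays of roots and chambers -/

section Rays

variable {ι E V : Type*} [AddCommGroup E] [Module ℝ E] [AddCommGroup V] [Module ℝ V]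
  (P : RootPairing ι ℝ E V)

/-- The root `β` is a positive multiple of the root `α`. -/
def SameRay (i j : ι) : Prop := ∃ c : ℝ, 0 < c ∧ P.root j = c • P.root i

/-- No root vanishes on `v`. -/
def IsRegular (v : V) : Prop := ∀ i, P.root' i v ≠ 0

theorem negIdx_negIdx (i : ι) : negIdx P (negIdx P i) = i := by
  apply P.root.injective
  simp [root_negIdx]

theorem reflectionPerm_negIdx (i j : ι) :
    P.reflectionPerm i (negIdx P j) = negIdx P (P.reflectionPerm i j) := by
  apply P.root.injective
  simp [root_negIdx, RootPairing.root_reflectionPerm]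

theorem root'_negIdx (i : ι) (v : V) : P.root' (negIdx P i) v = -P.root' i v := by
  simp [RootPairing.root', root_negIdx]

theorem root'_of_root_eq_smul {i j : ι} {c : ℝ} (h : P.root j = c • P.root i) (v : V) :
    P.root' j v = c * P.root' i v := by
  simp [RootPairing.root', h]

variable {P}

theorem SameRay.refl (i : ι) : SameRay P i i := ⟨1, one_pos, by simp⟩

theorem SameRay.symm {i j : ι} (h : SameRay P i j) : SameRay P j i := by
  obtain ⟨c, hc, h⟩ := h
  exact ⟨c⁻¹, inv_pos.2 hc, by rw [h, smul_smul, inv_mul_cancel₀ hc.ne', one_smul]⟩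

theorem SameRay.trans {i j k : ι} (h : SameRay P i j) (h' : SameRay P j k) : SameRay P i k := by
  obtain ⟨c, hc, h⟩ := h
  obtain ⟨d, hd, h'⟩ := h'
  exact ⟨d * c, mul_pos hd hc, by rw [h', h, smul_smul]⟩

theorem SameRay.negIdx {i j : ι} (h : SameRay P i j) :
    SameRay P (negIdx P i) (LocalRootDatum.negIdx P j) := by
  obtain ⟨c, hc, h⟩ := h
  exact ⟨c, hc, by rw [root_negIdx, root_negIdx, h, smul_neg]⟩

theorem SameRay.pos_iff {i j : ι} (h : SameRay P i j) (v : V) :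
    0 < P.root' j v ↔ 0 < P.root' i v := by
  obtain ⟨c, hc, h⟩ := h
  rw [root'_of_root_eq_smul P h]
  exact mul_pos_iff_of_pos_left hc

theorem sameRay_of_root_eq_two {i j : ι} (h : P.root j = (2 : ℝ) • P.root i) : SameRay P i j :=
  ⟨2, two_pos, h⟩

/-- The two pairings are positive integers `2c` and `2/c` with product `4`, so the ratio `c` is
`1/2`, `1` or `2`. -/
theorem SameRay.cases [Finite ι] [P.IsCrystallographic] {i j : ι} (h : SameRay P i j) :
    i = j ∨ P.root j = (2 : ℝ) • P.root i ∨ P.root i = (2 : ℝ) • P.root j := by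
  obtain ⟨c, hc, h⟩ := h
  obtain ⟨a, ha⟩ := P.exists_value (S := ℤ) j i
  obtain ⟨b, hb⟩ := P.exists_value (S := ℤ) i j
  simp only [algebraMap_int_eq, eq_intCast] at ha hb
  have h1 : P.pairing j i = c * 2 := by
    rw [← P.root_coroot_eq_pairing, h]; simp
  have h2 : c * P.pairing i j = 2 := by
    have := P.pairing_same j
    rw [← P.root_coroot_eq_pairing, h] at this
    simpa using this
  have hac : (a : ℝ) = c * 2 := by rw [← h1, ← ha]
  have hbc : c * (b : ℝ) = 2 := by rw [← h2, ← hb]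
  have hab : (a * b : ℤ) = 4 := by
    have : (a * b : ℝ) = 4 := by rw [hac]; linarith
    exact_mod_cast this
  have ha0 : 0 < a := by
    have : (0 : ℝ) < a := by rw [hac]; positivity
    exact_mod_cast this
  have ha4 : a ≤ 4 := Int.le_of_dvd (by norm_num) ⟨b, hab.symm⟩
  have : a = 1 ∨ a = 2 ∨ a = 4 := by
    interval_cases a
    · simp
    · simp
    · omega
    · simp
  rcases this with rfl | rfl | rfl
  · right; right
    have : c = 1 / 2 := by push_cast at hac; linarith
    rw [h, this, smul_smul]; norm_num
  · left
    have : c = 1 := by push_cast at hac; linarith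
    apply P.root.injective
    rw [h, this, one_smul]
  · right; left
    have : c = 2 := by push_cast at hac; linarith
    rw [h, this]

theorem root_ne_two_smul_of_eq_two_smul [Finite ι] [P.IsCrystallographic] {i j k : ι}
    (h : P.root j = (2 : ℝ) • P.root i) : P.root k ≠ (2 : ℝ) • P.root j := by
  intro h'
  have h4 : P.root k = (4 : ℝ) • P.root i := by rw [h', h, smul_smul]; norm_num
  have hne : P.root i ≠ 0 := P.ne_zero i
  rcases SameRay.cases (P := P) ⟨4, by norm_num, h4⟩ with rfl | h5 | h5
  · have : (3 : ℝ) • P.root i = 0 := by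
      rw [show (3 : ℝ) = 4 - 1 by norm_num, sub_smul, ← h4, one_smul, sub_self]
    simp [hne] at this
  · rw [h4, ← sub_eq_zero, ← sub_smul] at h5
    norm_num [hne] at h5
  · rw [h4, smul_smul, ← sub_eq_zero] at h5
    nth_rewrite 1 [← one_smul ℝ (P.root i)] at h5
    rw [← sub_smul] at h5
    norm_num [hne] at h5

/-- Every ray contains a root whose multiples by `1` and `2` are the only roots of the ray. -/
theorem exists_sameRay_forall [Finite ι] [P.IsCrystallographic] (i : ι) :
    ∃ j, SameRay P i j ∧ ∀ k, SameRay P i k → k = j ∨ P.root k = (2 : ℝ) • P.root j := by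
  by_cases h : ∃ j, P.root i = (2 : ℝ) • P.root j
  · obtain ⟨j, hj⟩ := h
    refine ⟨j, (sameRay_of_root_eq_two hj).symm, fun k hk => ?_⟩
    rcases ((sameRay_of_root_eq_two hj).trans hk).cases with rfl | h | h
    · exact Or.inl rfl
    · exact Or.inr h
    · exact absurd hj (root_ne_two_smul_of_eq_two_smul h)
  · refine ⟨i, SameRay.refl i, fun k hk => ?_⟩
    rcases hk.cases with rfl | h' | h'
    · exact Or.inl rfl
    · exact Or.inr h'
    · exact absurd ⟨k, h'⟩ h

theorem IsRegular.neg {v : V} (h : IsRegular P v) : IsRegular P (-v) := fun i => by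
  simpa using h i

theorem IsRegular.not_pos_iff {v : V} (h : IsRegular P v) (i : ι) :
    ¬ 0 < P.root' i v ↔ P.root' i v < 0 :=
  ⟨fun h' => lt_of_le_of_ne (not_lt.1 h') (h i), fun h' => h'.asymm⟩

theorem exists_forall_apply_ne_zero {κ : Type*} [Finite κ]
    (f : κ → Module.Dual ℝ V) (hf : ∀ k, f k ≠ 0) : ∃ v : V, ∀ k, f k v ≠ 0 := by
  apply Module.Dual.exists_forall_ne_zero_of_forall_exists
  intro k
  by_contra! h
  exact hf k (LinearMap.ext h)

theorem root'_ne_zero (i : ι) : P.root' i ≠ 0 := by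
  intro h
  have := P.root_coroot_two i
  have h2 : P.root' i (P.coroot i) = 0 := by rw [h]; rfl
  rw [h2] at this
  norm_num at this

theorem root_eq_smul_of_root' {i j : ι} {c : ℝ} (h : P.root' j = c • P.root' i) :
    P.root j = c • P.root i := by
  apply P.toPerfPair.injective
  ext v
  simpa using LinearMap.congr_fun h v

open Filter Topology in
/-- Every vector can be moved to a regular one without changing the signs of the roots that do not
vanish on it. -/
theorem exists_isRegular_near [Finite ι] (v₀ : V) :
    ∃ v, IsRegular P v ∧ ∀ i, 0 < P.root' i v₀ → 0 < P.root' i v := by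
  obtain ⟨y, hy⟩ := exists_forall_apply_ne_zero (fun i => P.root' i) root'_ne_zero
  have key : ∀ᶠ t : ℝ in 𝓝[>] 0, ∀ i, P.root' i (v₀ + t • y) ≠ 0 ∧
      (0 < P.root' i v₀ → 0 < P.root' i (v₀ + t • y)) := by
    rw [Filter.eventually_all]
    intro i
    have hc : Continuous fun t : ℝ => P.root' i v₀ + t * P.root' i y := by fun_prop
    have ht : Tendsto (fun t : ℝ => P.root' i v₀ + t * P.root' i y) (𝓝[>] 0)
        (𝓝 (P.root' i v₀)) := by
      have := hc.tendsto 0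
      simp only [zero_mul, add_zero] at this
      exact this.mono_left nhdsWithin_le_nhds
    simp only [map_add, map_smul, smul_eq_mul]
    rcases lt_trichotomy (P.root' i v₀) 0 with h | h | h
    · filter_upwards [ht.eventually (gt_mem_nhds h)] with t ht
      exact ⟨ht.ne, fun h' => absurd h' h.asymm⟩
    · filter_upwards [self_mem_nhdsWithin] with t ht
      rw [h]
      refine ⟨?_, fun h' => absurd h' (lt_irrefl _)⟩
      rw [zero_add]
      exact mul_ne_zero (ne_of_gt ht) (hy i)
    · filter_upwards [ht.eventually (lt_mem_nhds h)] with t ht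
      exact ⟨ht.ne', fun _ => ht⟩
  obtain ⟨t, ht⟩ := key.exists
  exact ⟨v₀ + t • y, fun i => (ht i).1, fun i => (ht i).2⟩

variable (P) in
/-- The chambers of `v` and `v'` are adjacent along the wall of the root `α`, which is positive
on `v`. -/
structure Crossing (i : ι) (v v' : V) : Prop where
  regular : IsRegular P v
  regular' : IsRegular P v'
  pos : 0 < P.root' i v
  neg : P.root' i v' < 0
  pos_iff : ∀ j, ¬ SameRay P i j → ¬ SameRay P (negIdx P i) j →
    (0 < P.root' j v ↔ 0 < P.root' j v')

theorem Crossing.symm {i : ι} {v v' : V} (h : Crossing P i v v') :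
    Crossing P (negIdx P i) v' v where
  regular := h.regular'
  regular' := h.regular
  pos := by rw [root'_negIdx]; linarith [h.neg]
  neg := by rw [root'_negIdx]; linarith [h.pos]
  pos_iff j h1 h2 := (h.pos_iff j (by rwa [negIdx_negIdx] at h2) h1).symm

theorem Crossing.pos' {i j : ι} {v v' : V} (h : Crossing P i v v') (hj : 0 < P.root' j v)
    (hij : ¬ SameRay P i j) : 0 < P.root' j v' := by
  refine (h.pos_iff j hij fun h' => ?_).1 hj
  rw [h'.pos_iff, root'_negIdx] at hj
  linarith [h.pos]

theorem Crossing.not_sameRay {i j : ι} {v v' : V} (h : Crossing P i v v')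
    (hj : 0 < P.root' j v') : ¬ SameRay P i j := by
  intro h'
  rw [h'.pos_iff] at hj
  linarith [h.neg]

open Filter Topology in
-- Walk from `v` straight towards `y`. The wall of `i` is the first one met among the roots that
-- change from positive to negative; `hgen` says that only proportional roots can vanish at the same
-- time. The last conjunct makes the number of walls still to be crossed decrease.
theorem exists_crossing_toward [Finite ι] {k : ι} {v y : V} (hv : IsRegular P v)
    (hy : IsRegular P y) (hk : 0 < P.root' k v) (hky : P.root' k y < 0)
    (hgen : ∀ i j, P.root' i v * P.root' j y = P.root' j v * P.root' i y →
      ∃ c : ℝ, P.root j = c • P.root i) :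
    ∃ (s : ℝ) (i : ι), s < 1 ∧ P.root' i y < 0 ∧ Crossing P i v (v + s • (y - v)) ∧
      ∀ j, 0 < P.root' j (v + s • (y - v)) → P.root' j y < 0 → 0 < P.root' j v := by
  classical
  have : Fintype ι := Fintype.ofFinite ι
  set D : Finset ι := Finset.univ.filter fun j => 0 < P.root' j v ∧ P.root' j y < 0 with hD
  have hmem : ∀ j, j ∈ D ↔ 0 < P.root' j v ∧ P.root' j y < 0 := fun j => by simp [hD]
  -- For a root of `D`, this is the time at which it vanishes on the segment.
  set ρ : ι → ℝ := fun j => P.root' j v / (P.root' j v - P.root' j y) with hρ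
  obtain ⟨i, hi, hmin⟩ := D.exists_min_image ρ ⟨k, (hmem k).2 ⟨hk, hky⟩⟩
  obtain ⟨hi1, hi2⟩ := (hmem i).1 hi
  have hden : ∀ j ∈ D, 0 < P.root' j v - P.root' j y := fun j hj => by
    have := (hmem j).1 hj; linarith [this.1, this.2]
  have hρ1 : ρ i < 1 := by
    simp only [hρ]; rw [div_lt_one (hden i hi)]; linarith
  have hρ0 : 0 < ρ i := div_pos hi1 (hden i hi)
  -- Stop just after the first crossing, before any later one and before reaching `y`.
  have hex : ∀ᶠ s in 𝓝[>] (ρ i), s < 1 ∧ ∀ j, ρ i < ρ j → s < ρ j := by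
    refine Filter.Eventually.and ?_ ?_
    · exact nhdsWithin_le_nhds (gt_mem_nhds hρ1)
    · rw [Filter.eventually_all]
      intro j
      by_cases hj : ρ i < ρ j
      · filter_upwards [nhdsWithin_le_nhds (gt_mem_nhds hj)] with s hs _ using hs
      · exact Filter.Eventually.of_forall fun s h => absurd h hj
  obtain ⟨s, ⟨hs1, hs⟩, hsi⟩ := (hex.and self_mem_nhdsWithin).exists
  have hsi : ρ i < s := hsi
  have hs0 : 0 < s := hρ0.trans hsi
  have hval : ∀ j, P.root' j (v + s • (y - v)) = (1 - s) * P.root' j v + s * P.root' j y := by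
    intro j
    simp only [map_add, map_smul, map_sub, smul_eq_mul]; ring
  have hpp : ∀ j, 0 < P.root' j v → ¬ SameRay P i j → 0 < P.root' j (v + s • (y - v)) := by
    intro j hj hij
    rw [hval]
    rcases lt_or_gt_of_ne (hy j) with hjy | hjy
    · have hjD := (hmem j).2 ⟨hj, hjy⟩
      have hne : ρ i ≠ ρ j := by
        intro h
        simp only [hρ] at h
        rw [div_eq_div_iff (hden i hi).ne' (hden j hjD).ne'] at h
        obtain ⟨c, hc⟩ := hgen i j (by linarith)
        refine hij ⟨c, ?_, hc⟩
        rw [root'_of_root_eq_smul P hc] at hj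
        exact (pos_iff_pos_of_mul_pos hj).2 hi1
      have h2 := hs j (lt_of_le_of_ne (hmin j hjD) hne)
      simp only [hρ] at h2
      rw [lt_div_iff₀ (hden j hjD)] at h2
      linarith
    · have := mul_pos (sub_pos.2 hs1) hj
      have := mul_pos hs0 hjy
      linarith
  have hneg : ∀ j, SameRay P i j → P.root' j (v + s • (y - v)) < 0 := by
    rintro j ⟨c, hc, hj⟩
    rw [root'_of_root_eq_smul P hj, hval]
    refine mul_neg_of_pos_of_neg hc ?_
    have h2 := hsi
    simp only [hρ] at h2
    rw [div_lt_iff₀ (hden i hi)] at h2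
    linarith
  have hpn : ∀ j, P.root' j v < 0 → ¬ SameRay P (negIdx P i) j →
      P.root' j (v + s • (y - v)) < 0 := by
    intro j hj hij
    have := hpp (negIdx P j) (by rw [root'_negIdx]; linarith) fun h => hij (by
      simpa [negIdx_negIdx] using h.negIdx)
    rw [root'_negIdx] at this
    linarith
  have hnn : ∀ j, SameRay P (negIdx P i) j → 0 < P.root' j (v + s • (y - v)) := by
    intro j hij
    have := hneg (negIdx P j) (by simpa [negIdx_negIdx] using hij.negIdx)
    rw [root'_negIdx] at this
    linarith
  refine ⟨s, i, hs1, hi2, ⟨hv, ?_, hi1, hneg i (SameRay.refl i), ?_⟩, ?_⟩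
  · intro j
    rcases lt_or_gt_of_ne (hv j) with h | h
    · by_cases h' : SameRay P (negIdx P i) j
      · exact (hnn j h').ne'
      · exact (hpn j h h').ne
    · by_cases h' : SameRay P i j
      · exact (hneg j h').ne
      · exact (hpp j h h').ne'
  · intro j h1 h2
    rcases lt_or_gt_of_ne (hv j) with h | h
    · exact ⟨fun h' => absurd h' h.asymm, fun h' => absurd h' (hpn j h h2).asymm⟩
    · exact ⟨fun _ => hpp j h h1, fun _ => h⟩
  · intro j h1 h2
    rw [hval] at h1
    by_contra h3
    have h4 : P.root' j v ≤ 0 := not_lt.1 h3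
    have := mul_nonpos_of_nonneg_of_nonpos (sub_pos.2 hs1).le h4
    have := mul_neg_of_pos_of_neg hs0 h2
    linarith

/-- Induction along a gallery of adjacent chambers, which ends when the wall of the positive root
`γ` is crossed. -/
theorem crossing_induction [Finite ι] (k : ι) {C : V → Prop}
    (h : ∀ v v' i, Crossing P i v v' → (SameRay P i k ∨ (0 < P.root' k v' ∧ C v')) → C v)
    {v : V} (hv : IsRegular P v) (hk : 0 < P.root' k v) : C v := by
  classical
  -- The functional `f (i, j)` vanishes identically only if the roots are proportional. Choosing `y`
  -- off the kernels of the nonzero ones makes the segment from `v` to `y` generic.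
  set f : ι × ι → Module.Dual ℝ V :=
    fun p => P.root' p.1 v • P.root' p.2 - P.root' p.2 v • P.root' p.1 with hf
  obtain ⟨y₀, hy₀⟩ := exists_forall_apply_ne_zero
    (Sum.elim (fun i => P.root' i) fun p : {p : ι × ι // f p ≠ 0} => f p)
    (by rintro (i | p); exacts [root'_ne_zero i, p.2])
  obtain ⟨y, hy, hyk⟩ : ∃ y, (∀ p : ι ⊕ {p : ι × ι // f p ≠ 0},
      (Sum.elim (fun i => P.root' i) (fun p : {p : ι × ι // f p ≠ 0} => f p)) p y ≠ 0) ∧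
      P.root' k y < 0 := by
    rcases lt_or_gt_of_ne (hy₀ (Sum.inl k)) with h | h
    · exact ⟨y₀, hy₀, h⟩
    · refine ⟨-y₀, fun p => ?_, ?_⟩
      · rw [map_neg]; exact neg_ne_zero.2 (hy₀ p)
      · rw [map_neg]; exact neg_neg_of_pos h
  have hyr : IsRegular P y := fun i => hy (Sum.inl i)
  have hgen : ∀ i j, P.root' i v * P.root' j y = P.root' j v * P.root' i y →
      ∃ c : ℝ, P.root j = c • P.root i := by
    intro i j hij
    have h0 : f (i, j) = 0 := by
      by_contra hne
      refine hy (Sum.inr ⟨(i, j), hne⟩) ?_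
      simp only [Sum.elim_inr, hf, LinearMap.sub_apply, LinearMap.smul_apply, smul_eq_mul]
      linarith
    refine ⟨(P.root' i v)⁻¹ * P.root' j v, root_eq_smul_of_root' ?_⟩
    rw [hf] at h0
    rw [mul_smul, ← sub_eq_zero.1 h0, smul_smul, inv_mul_cancel₀ (hv i), one_smul]
  clear_value f
  clear hf hy hy₀
  have : Fintype ι := Fintype.ofFinite ι
  -- The induction is on the number of roots that are positive on `v` and negative on `y`.
  induction hn : (Finset.univ.filter fun j => 0 < P.root' j v ∧ P.root' j y < 0).card
    using Nat.strong_induction_on generalizing v with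
  | _ n ih =>
    obtain ⟨s, i, hs, hiy, hc, hsub⟩ := exists_crossing_toward hv hyr hk hyk hgen
    refine h _ _ i hc ?_
    by_cases hik : SameRay P i k
    · exact Or.inl hik
    · have hk' := hc.pos' hk hik
      refine Or.inr ⟨hk', ih _ ?_ hc.regular' hk' ?_ rfl⟩
      · rw [← hn]
        apply Finset.card_lt_card
        rw [Finset.ssubset_iff_of_subset]
        · refine ⟨i, ?_, ?_⟩
          · simpa using ⟨hc.pos, hiy⟩
          · simp only [Finset.mem_filter, Finset.mem_univ, true_and, not_and_or]
            left; exact hc.neg.asymm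
        · intro j hj
          simp only [Finset.mem_filter, Finset.mem_univ, true_and] at hj ⊢
          exact ⟨hsub j hj.1 hj.2, hj.2⟩
      · intro a b hab
        apply hgen a b
        simp only [map_add, map_smul, map_sub, smul_eq_mul] at hab
        -- Moving along the segment multiplies these determinants by `1 - s`, so genericity
        -- persists.
        have h1 : (1 - s) * (P.root' a v * P.root' b y - P.root' b v * P.root' a y) = 0 := by
          linear_combination hab
        rcases mul_eq_zero.1 h1 with h2 | h2
        · linarith
        · linarith

end Rays

/-! ### Evaluation of roots on the apartment -/

section Eval

variable {ι E V R : Type*} [AddCommGroup E] [Module ℝ E] [AddCommGroup V] [Module ℝ V]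
  [AddCommGroup R] {P : RootPairing ι ℝ E V} [P.IsCrystallographic]

theorem rootEval_tmul (i : ι) (a : P.corootSpan ℤ) (r : R) :
    rootEval P i (a ⊗ₜ[ℤ] r) = P.root'In ℤ i a • r := by
  change TensorProduct.lid ℤ R (LinearMap.rTensor R (P.root'In ℤ i) (a ⊗ₜ[ℤ] r)) = _
  rw [LinearMap.rTensor_tmul, TensorProduct.lid_tmul]

theorem rootEval_of_root_eq {i j k : ι} {a b : ℤ}
    (h : P.root k = (a : ℝ) • P.root i + (b : ℝ) • P.root j) (x : VR P R) :
    rootEval P k x = a • rootEval P i x + b • rootEval P j x := by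
  induction x using TensorProduct.induction_on with
  | zero => simp
  | tmul c r =>
    have : P.root'In ℤ k c = a * P.root'In ℤ i c + b * P.root'In ℤ j c := by
      apply FaithfulSMul.algebraMap_injective ℤ ℝ
      rw [map_add, map_mul, map_mul]
      simp only [RootPairing.algebraMap_root'In_apply]
      simp [RootPairing.root', h]
    rw [rootEval_tmul, rootEval_tmul, rootEval_tmul, this, add_smul, mul_smul, mul_smul]
  | add x y hx hy => rw [map_add, map_add, map_add, hx, hy]; module

theorem rootEval_of_root_eq_smul {i j : ι} {a : ℤ}
    (h : P.root j = (a : ℝ) • P.root i) (x : VR P R) :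
    rootEval P j x = a • rootEval P i x := by
  have := rootEval_of_root_eq (i := i) (j := i) (k := j) (a := a) (b := 0) (by simp [h]) x
  simpa using this

theorem rootEval_negIdx (i : ι) (x : VR P R) :
    rootEval P (negIdx P i) x = -rootEval P i x := by
  have := rootEval_of_root_eq_smul (i := i) (j := negIdx P i) (a := -1) (by simp [root_negIdx]) x
  simpa using this

theorem rootEval_corootZ_tmul (i j : ι) (r : R) :
    rootEval P j (corootZ P i ⊗ₜ[ℤ] r) = P.pairingIn ℤ j i • r :=
  rootEval_tmul j _ r

theorem rootEval_reflectionPerm (i j : ι) (x : VR P R) :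
    rootEval P (P.reflectionPerm i j) x =
      rootEval P j x - P.pairingIn ℤ j i • rootEval P i x := by
  have := rootEval_of_root_eq (i := j) (j := i) (k := P.reflectionPerm i j) (a := 1)
    (b := -P.pairingIn ℤ j i) (by
      have h := P.algebraMap_pairingIn ℤ j i
      simp only [algebraMap_int_eq, eq_intCast] at h
      rw [RootPairing.root_reflectionPerm, RootPairing.reflection_apply_root, ← h]
      simp [sub_eq_add_neg]) x
  rw [this]
  module

/-- Invariance of the pairing: the argument on the left is the reflection `r_α` of `x`. -/
theorem rootEval_reflectionPerm_reflection (i j : ι) (x : VR P R) :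
    rootEval P (P.reflectionPerm i j) (x - corootZ P i ⊗ₜ[ℤ] rootEval P i x) =
      rootEval P j x := by
  have h1 : P.pairingIn ℤ (P.reflectionPerm i j) i = -P.pairingIn ℤ j i := by
    apply FaithfulSMul.algebraMap_injective ℤ ℝ
    rw [map_neg, RootPairing.algebraMap_pairingIn, RootPairing.algebraMap_pairingIn,
      ← RootPairing.pairing_reflectionPerm, RootPairing.pairing_reflectionPerm_self_right]
  rw [map_sub, rootEval_corootZ_tmul, rootEval_reflectionPerm, h1]
  module

end Eval

end LocalRootDatum

namespace LocalRootDatum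

/-! ### Root group data: the torus, the unipotent groups and the cosets -/

section Datum

variable {ι E V G : Type*} [AddCommGroup E] [Module ℝ E] [AddCommGroup V] [Module ℝ V] [Group G]

/-- The group generated by the members of a family of subgroups that are attached to the roots
which are positive on `v`. -/
def chamberGroup (P : RootPairing ι ℝ E V) (X : ι → Subgroup G) (v : V) : Subgroup G :=
  ⨆ (i) (_ : 0 < P.root' i v), X i

/-- Conjugation by `m` exchanges `U_α` and `U_{-α}`. -/
structure SwapsRootGroups (P : RootPairing ι ℝ E V) (U : ι → Subgroup G) (i : ι) (m : G) :
    Prop where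
  mem_iff : ∀ g, m * g * m⁻¹ ∈ U (negIdx P i) ↔ g ∈ U i
  mem_iff' : ∀ g, m * g * m⁻¹ ∈ U i ↔ g ∈ U (negIdx P i)

variable {P : RootPairing ι ℝ E V} {T : Subgroup G} {U : ι → Subgroup G} {M : ι → Set G}

theorem mem_chamberGroup {X : ι → Subgroup G} {v : V} {i : ι} (hi : 0 < P.root' i v) {g : G}
    (hg : g ∈ X i) : g ∈ chamberGroup P X v :=
  (le_iSup₂ (f := fun i (_ : 0 < P.root' i v) => X i) i hi) hg

theorem mem_chamberGroup_neg {X : ι → Subgroup G} {v : V} {i : ι} (hi : 0 < P.root' i v) {g : G}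
    (hg : g ∈ X (negIdx P i)) : g ∈ chamberGroup P X (-v) :=
  mem_chamberGroup (by rw [root'_negIdx, map_neg, neg_neg]; exact hi) hg

theorem chamberGroup_mono {X Y : ι → Subgroup G} (h : ∀ i, X i ≤ Y i) (v : V) :
    chamberGroup P X v ≤ chamberGroup P Y v :=
  iSup₂_mono fun i _ => h i

theorem exists_isRegular_pos [Finite ι] (i : ι) : ∃ v, IsRegular P v ∧ 0 < P.root' i v := by
  obtain ⟨v, hv, h⟩ := exists_isRegular_near (P := P) (P.coroot i)
  exact ⟨v, hv, h i (by simp)⟩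

namespace SwapsRootGroups

theorem inv {i : ι} {m : G} (h : SwapsRootGroups P U i m) : SwapsRootGroups P U i m⁻¹ where
  mem_iff g := by rw [← h.mem_iff']; group
  mem_iff' g := by rw [← h.mem_iff]; group

theorem negIdx {i : ι} {m : G} (h : SwapsRootGroups P U i m) :
    SwapsRootGroups P U (LocalRootDatum.negIdx P i) m where
  mem_iff g := by rw [negIdx_negIdx]; exact h.mem_iff' g
  mem_iff' g := by rw [negIdx_negIdx]; exact h.mem_iff g

end SwapsRootGroups

namespace IsRootGroupDatum

variable (hd : IsRootGroupDatum P T U M)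
include hd

theorem eq_one_of_torus_mul_eq {v : V} (hv : IsRegular P v) {t a b : G} (ht : t ∈ T)
    (ha : a ∈ chamberGroup P U v) (hb : b ∈ chamberGroup P U (-v)) (h : t * a = b) : b = 1 := by
  have h1 := hd.inter_eq v hv
  have h2 : b ∈ ((T : Set G) * ((⨆ (i) (_ : 0 < P.root' i v), U i : Subgroup G) : Set G)) ∩
      ((⨆ (i) (_ : P.root' i v < 0), U i : Subgroup G) : Set G) := by
    refine ⟨⟨t, ht, a, ha, h⟩, ?_⟩
    simpa [chamberGroup] using hb
  rw [h1] at h2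
  exact h2

theorem eq_one_of_mem_chamberGroup {v : V} (hv : IsRegular P v) {a : G}
    (ha : a ∈ chamberGroup P U v) (hb : a ∈ chamberGroup P U (-v)) : a = 1 :=
  hd.eq_one_of_torus_mul_eq hv T.one_mem ha hb (one_mul a)

theorem eq_one_of_mem_torus {v : V} (hv : IsRegular P v) {t : G} (ht : t ∈ T)
    (ha : t ∈ chamberGroup P U v) : t = 1 :=
  hd.eq_one_of_torus_mul_eq hv.neg ht (one_mem _) (by rwa [neg_neg]) (mul_one t)

theorem conj_mem_iff {i : ι} {m : G} (hm : m ∈ M i) (j : ι) (g : G) :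
    m * g * m⁻¹ ∈ U (P.reflectionPerm i j) ↔ g ∈ U j := by
  rw [← hd.conj_eq i j m hm, Subgroup.mem_map]
  constructor
  · rintro ⟨x, hx, h⟩
    have : x = g := by simpa using h
    rwa [← this]
  · intro hg
    exact ⟨g, hg, rfl⟩

theorem conj_mem {i : ι} {m : G} (hm : m ∈ M i) {j : ι} {g : G} (hg : g ∈ U j) :
    m * g * m⁻¹ ∈ U (P.reflectionPerm i j) :=
  (hd.conj_mem_iff hm j g).2 hg

theorem swaps {i : ι} {m : G} (hm : m ∈ M i) : SwapsRootGroups P U i m where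
  mem_iff g := hd.conj_mem_iff hm i g
  mem_iff' g := by
    have := hd.conj_mem_iff hm (negIdx P i) g
    rwa [reflectionPerm_negIdx, show P.reflectionPerm i i = negIdx P i from rfl,
      negIdx_negIdx] at this

theorem mul_mem_coset {i : ι} {t m : G} (ht : t ∈ T) (hm : m ∈ M i) : t * m ∈ M i := by
  obtain ⟨n, hn⟩ := hd.isCoset i
  rw [hn] at hm ⊢
  obtain ⟨s, hs, rfl⟩ := hm
  exact ⟨t * s, T.mul_mem ht hs, by group⟩

theorem mul_inv_mem_torus {i : ι} {m n : G} (hm : m ∈ M i) (hn : n ∈ M i) : m * n⁻¹ ∈ T := by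
  obtain ⟨k, hk⟩ := hd.isCoset i
  rw [hk] at hm hn
  obtain ⟨s, hs, rfl⟩ := hm
  obtain ⟨s', hs', rfl⟩ := hn
  have : s * k * (s' * k)⁻¹ = s * s'⁻¹ := by group
  rw [this]
  exact T.mul_mem hs (T.inv_mem hs')

/-- Write `t = (t m) m⁻¹` with `m ∈ M_α`: both `m` and `t m` carry `U_{-α}` to `U_α`. -/
theorem torus_conj_mem {t : G} (ht : t ∈ T) {i : ι} {g : G} (hg : g ∈ U i) :
    t * g * t⁻¹ ∈ U i := by
  obtain ⟨m, hm⟩ : ∃ m, m ∈ M i := by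
    obtain ⟨m, hm⟩ := hd.isCoset i
    exact ⟨1 * m, by rw [hm]; exact ⟨1, T.one_mem, rfl⟩⟩
  have h1 : m⁻¹ * g * m ∈ U (P.reflectionPerm i i) := by
    rw [← hd.conj_mem_iff hm, P.reflectionPerm_self]
    simpa [mul_assoc] using hg
  have h2 := hd.conj_mem (hd.mul_mem_coset ht hm) h1
  rw [P.reflectionPerm_self] at h2
  convert h2 using 1
  group

theorem torus_conj_mem_iff {t : G} (ht : t ∈ T) {i : ι} {g : G} :
    t * g * t⁻¹ ∈ U i ↔ g ∈ U i := by
  refine ⟨fun h => ?_, hd.torus_conj_mem ht⟩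
  have := hd.torus_conj_mem (T.inv_mem ht) h
  simpa [mul_assoc] using this

theorem exists_ne_one (i : ι) : ∃ g ∈ U i, g ≠ 1 := by
  by_contra! h
  exact hd.nontrivial i ((Subgroup.eq_bot_iff_forall _).2 h)

theorem double_le {i j : ι} (h : P.root j = (2 : ℝ) • P.root i) : U j ≤ U i :=
  (hd.double_lt i j h).le

variable [Finite ι]

theorem eq_one_of_mem_of_mem {i : ι} {g : G} (h1 : g ∈ U i) (h2 : g ∈ U (negIdx P i)) : g = 1 := by
  obtain ⟨v, hv, hi⟩ := exists_isRegular_pos (P := P) i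
  exact hd.eq_one_of_mem_chamberGroup hv (mem_chamberGroup hi h1) (mem_chamberGroup_neg hi h2)

/-- Uniqueness of the decomposition in `U_α T U_{-α}`. -/
theorem eq_of_mul_mul_eq {i : ι} {a a' t t' b b' : G} (ha : a ∈ U i) (ha' : a' ∈ U i)
    (ht : t ∈ T) (ht' : t' ∈ T) (hb : b ∈ U (negIdx P i)) (hb' : b' ∈ U (negIdx P i))
    (h : a * t * b = a' * t' * b') : a = a' ∧ t = t' ∧ b = b' := by
  obtain ⟨v, hv, hi⟩ := exists_isRegular_pos (P := P) i
  have hc : t⁻¹ * (a'⁻¹ * a) * t ∈ U i := by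
    simpa using hd.torus_conj_mem (T.inv_mem ht) ((U i).mul_mem ((U i).inv_mem ha') ha)
  have h1 : t'⁻¹ * t * (t⁻¹ * (a'⁻¹ * a) * t) = b' * b⁻¹ := by
    have : t'⁻¹ * t * (t⁻¹ * (a'⁻¹ * a) * t) = t'⁻¹ * a'⁻¹ * (a * t * b) * b⁻¹ := by group
    rw [this, h]; group
  have h2 := hd.eq_one_of_torus_mul_eq hv (T.mul_mem (T.inv_mem ht') ht) (mem_chamberGroup hi hc)
    (mem_chamberGroup_neg hi ((U _).mul_mem hb' ((U _).inv_mem hb))) h1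
  have hbb : b = b' := by rw [mul_inv_eq_one] at h2; exact h2.symm
  subst hbb
  have h3 : a * t = a' * t' := mul_right_cancel h
  have h4 : a'⁻¹ * a = t' * t⁻¹ := by
    rw [inv_mul_eq_iff_eq_mul, ← mul_assoc, ← h3]; group
  have h5 := hd.eq_one_of_mem_torus hv (T.mul_mem ht' (T.inv_mem ht))
    (h4 ▸ mem_chamberGroup hi ((U i).mul_mem ((U i).inv_mem ha') ha))
  have htt : t = t' := by rw [mul_inv_eq_one] at h5; exact h5.symm
  subst htt
  exact ⟨mul_right_cancel h3, rfl, rfl⟩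

theorem not_forall_conj_mem {i : ι} {m : G} (hm : SwapsRootGroups P U i m) :
    ¬ ∀ g ∈ U i, m * g * m⁻¹ ∈ U i := by
  intro h
  obtain ⟨g, hg, hg1⟩ := hd.exists_ne_one i
  have := hd.eq_one_of_mem_of_mem (h g hg) ((hm.mem_iff g).2 hg)
  rw [mul_inv_eq_one, mul_eq_left] at this
  exact hg1 this

/-- A nontrivial `x` is `a m b` with `a, b ∈ U_α` and `m ∈ M_α`. If `x` preserved `U_α`, so would
`m`, which carries `U_α` to `U_{-α}`. -/
theorem eq_one_of_conj_mem {i : ι} {x : G} (hx : x ∈ U (negIdx P i))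
    (h : ∀ g ∈ U i, x * g * x⁻¹ ∈ U i) : x = 1 := by
  by_contra hx1
  obtain ⟨y, ⟨a, ha, m, hm, rfl⟩, b, hb, rfl⟩ := hd.opposite_subset i ⟨hx, hx1⟩
  refine hd.not_forall_conj_mem (hd.swaps hm) fun g hg => ?_
  have h1 := h (b⁻¹ * g * b) ((U i).mul_mem ((U i).mul_mem ((U i).inv_mem hb) hg) hb)
  have h2 := (U i).mul_mem ((U i).mul_mem ((U i).inv_mem ha) h1) ha
  convert h2 using 1
  group

theorem eq_one_of_conj_mem' {i : ι} {x : G} (hx : x ∈ U i)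
    (h : ∀ g ∈ U (negIdx P i), x * g * x⁻¹ ∈ U (negIdx P i)) : x = 1 :=
  hd.eq_one_of_conj_mem (i := negIdx P i) (by rwa [negIdx_negIdx]) h

/-- A double coset of `U_{-α}` contains at most one element that exchanges `U_α` and `U_{-α}`. -/
theorem swaps_unique {i : ι} {m n x z : G} (hm : SwapsRootGroups P U i m)
    (hn : SwapsRootGroups P U i n) (hx : x ∈ U (negIdx P i)) (hz : z ∈ U (negIdx P i))
    (h : n = x * m * z) : n = m := by
  have hp : m * z * m⁻¹ ∈ U i := (hm.mem_iff' z).2 hz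
  -- The quotient `n m⁻¹` preserves both `U_α` and `U_{-α}` and is a product of `x ∈ U_{-α}` and an
  -- element of `U_α`, so both factors are trivial.
  have hnm : n * m⁻¹ = x * (m * z * m⁻¹) := by rw [h]; group
  have h1 : ∀ g ∈ U i, n * m⁻¹ * g * (n * m⁻¹)⁻¹ ∈ U i := fun g hg => by
    have := (hn.mem_iff' _).2 ((hm.inv.mem_iff g).2 hg)
    convert this using 1; group
  have h2 : ∀ g ∈ U (negIdx P i), n * m⁻¹ * g * (n * m⁻¹)⁻¹ ∈ U (negIdx P i) := fun g hg => by
    have := (hn.mem_iff _).2 ((hm.inv.mem_iff' g).2 hg)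
    convert this using 1; group
  have hx1 : x = 1 := by
    refine hd.eq_one_of_conj_mem hx fun g hg => ?_
    have := h1 _ ((U i).mul_mem ((U i).mul_mem ((U i).inv_mem hp) hg) hp)
    rw [hnm] at this
    convert this using 1; group
  have hp1 : m * z * m⁻¹ = 1 := by
    refine hd.eq_one_of_conj_mem' hp fun g hg => ?_
    have := h2 g hg
    rw [hnm, hx1, one_mul] at this
    exact this
  rw [hx1, hp1, mul_one, mul_inv_eq_one] at hnm
  exact hnm

/-- If `u = a m b` with `u ∈ U_{-α}`, solving for `a⁻¹` and for `a` exhibits `m` and `m⁻¹` as the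
swapping elements in the `U_{-α}`-double cosets of `a⁻¹` and `a`. By `swaps_unique` these are the
elements provided by the axiom for `-α`. -/
theorem exists_mem_coset_inv_mem (i : ι) :
    (∃ m ∈ M i, m ∈ M (negIdx P i)) ∧ (∃ m ∈ M i, m⁻¹ ∈ M (negIdx P i)) := by
  obtain ⟨u, hu, hu1⟩ := hd.exists_ne_one (negIdx P i)
  obtain ⟨y, ⟨a, ha, m, hm, rfl⟩, b, hb, hab⟩ := hd.opposite_subset i ⟨hu, hu1⟩
  replace hab : u = a * m * b := hab.symm
  have hs := hd.swaps hm
  have hy : m * b * m⁻¹ ∈ U (negIdx P i) := (hs.mem_iff b).2 hb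
  have ha1 : a ≠ 1 := by
    rintro rfl
    have hmU : m ∈ U (negIdx P i) := by
      have : m = (m * b * m⁻¹)⁻¹ * u := by rw [hab]; group
      rw [this]
      exact (U _).mul_mem ((U _).inv_mem hy) hu
    exact hd.not_forall_conj_mem hs.negIdx fun g hg =>
      (U _).mul_mem ((U _).mul_mem hmU hg) ((U _).inv_mem hmU)
  have key : ∀ c ∈ U i, c ≠ 1 → ∀ n, SwapsRootGroups P U i n → ∀ x ∈ U (negIdx P i),
      ∀ z ∈ U (negIdx P i), c = x * n * z → n ∈ M (negIdx P i) := by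
    intro c hc hc1 n hn x hx z hz hcn
    obtain ⟨y, ⟨p, hp, k, hk, rfl⟩, q, hq, hpq⟩ := hd.opposite_subset (negIdx P i)
      ⟨by rwa [negIdx_negIdx], hc1⟩
    replace hpq : c = p * k * q := hpq.symm
    have hks : SwapsRootGroups P U i k := by
      have := (hd.swaps hk).negIdx
      rwa [negIdx_negIdx] at this
    have : n = k := hd.swaps_unique hks hn ((U _).mul_mem ((U _).inv_mem hx) hp)
      ((U _).mul_mem hq ((U _).inv_mem hz)) (by
        have : n = x⁻¹ * c * z⁻¹ := by rw [hcn]; group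
        rw [this, hpq]; group)
    rwa [this]
  refine ⟨⟨m, hm, ?_⟩, m, hm, ?_⟩
  · exact key a⁻¹ ((U i).inv_mem ha) (inv_ne_one.2 ha1) m hs _ hy u⁻¹ ((U _).inv_mem hu)
      (by rw [hab]; group)
  · exact key a ha ha1 m⁻¹ hs.inv u hu _ ((U _).inv_mem hy) (by rw [hab]; group)

theorem coset_negIdx (i : ι) : M (negIdx P i) = M i := by
  obtain ⟨m, hm, hm'⟩ := (hd.exists_mem_coset_inv_mem i).1
  ext n
  constructor
  · intro hn
    have := hd.mul_mem_coset (hd.mul_inv_mem_torus hn hm') hm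
    simpa using this
  · intro hn
    have := hd.mul_mem_coset (hd.mul_inv_mem_torus hn hm) hm'
    simpa using this

/-- Every nontrivial element `u` of `U_α` defines an element `m(u)` of `M_α`. -/
theorem exists_mem_coset {i : ι} {u : G} (hu : u ∈ U i) (hu1 : u ≠ 1) :
    ∃ a ∈ U (negIdx P i), ∃ b ∈ U (negIdx P i), a * u * b ∈ M i := by
  obtain ⟨y, ⟨p, hp, k, hk, rfl⟩, q, hq, hpq⟩ := hd.opposite_subset (negIdx P i)
      ⟨by rwa [negIdx_negIdx], hu1⟩
  refine ⟨p⁻¹, (U _).inv_mem hp, q⁻¹, (U _).inv_mem hq, ?_⟩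
  rw [← hd.coset_negIdx i]
  convert hk using 1
  rw [← hpq]; group

/-- Describes `m(u)` without reference to `M_α`, which makes its behaviour under conjugation
visible. -/
theorem mem_coset_of_swaps {i : ι} {u a b n : G} (hu : u ∈ U i) (hu1 : u ≠ 1)
    (ha : a ∈ U (negIdx P i)) (hb : b ∈ U (negIdx P i)) (hn : SwapsRootGroups P U i n)
    (h : n = a * u * b) : n ∈ M i := by
  obtain ⟨p, hp, q, hq, hpq⟩ := hd.exists_mem_coset hu hu1
  have : n = p * u * q := hd.swaps_unique (hd.swaps hpq) hn ((U _).mul_mem ha ((U _).inv_mem hp))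
    ((U _).mul_mem ((U _).inv_mem hq) hb) (by rw [h]; group)
  rwa [this]

/-- The element is `m = m(u)`, and `t m(u) t⁻¹ = m(t u t⁻¹)`. -/
theorem torus_conj_mem_coset (i : ι) : ∃ m ∈ M i, ∀ t ∈ T, t * m * t⁻¹ ∈ M i := by
  obtain ⟨u, hu, hu1⟩ := hd.exists_ne_one i
  obtain ⟨a, ha, b, hb, hm⟩ := hd.exists_mem_coset hu hu1
  refine ⟨_, hm, fun t ht => ?_⟩
  have hs := hd.swaps hm
  refine hd.mem_coset_of_swaps (hd.torus_conj_mem ht hu) (by simpa using hu1)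
    (hd.torus_conj_mem ht ha) (hd.torus_conj_mem ht hb) ⟨fun g => ?_, fun g => ?_⟩
    (by group : _ = t * a * t⁻¹ * (t * u * t⁻¹) * (t * b * t⁻¹))
  · have h1 : t * (a * u * b) * t⁻¹ * g * (t * (a * u * b) * t⁻¹)⁻¹ =
      t * (a * u * b * (t⁻¹ * g * t) * (a * u * b)⁻¹) * t⁻¹ := by group
    rw [h1, hd.torus_conj_mem_iff ht, hs.mem_iff, ← hd.torus_conj_mem_iff ht]
    group
  · have h1 : t * (a * u * b) * t⁻¹ * g * (t * (a * u * b) * t⁻¹)⁻¹ =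
      t * (a * u * b * (t⁻¹ * g * t) * (a * u * b)⁻¹) * t⁻¹ := by group
    rw [h1, hd.torus_conj_mem_iff ht, hs.mem_iff', ← hd.torus_conj_mem_iff ht]
    group

/-- For the element `n` of `torus_conj_mem_coset`, the commutator of `t` and `n` is a quotient of
two elements of `M_α`, hence in `T`. Any other `m` differs from `n` by an element of `T`. -/
theorem coset_conj_mem_torus {i : ι} {m t : G} (hm : m ∈ M i) (ht : t ∈ T) :
    m * t * m⁻¹ ∈ T := by
  obtain ⟨n, hn, h⟩ := hd.torus_conj_mem_coset i
  have h1 := T.inv_mem (hd.mul_inv_mem_torus (h t ht) hn)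
  have h2 : n * t * n⁻¹ ∈ T := by
    have := T.mul_mem h1 ht
    convert this using 1; group
  have h3 := hd.mul_inv_mem_torus hm hn
  have := T.mul_mem (T.mul_mem h3 h2) (T.inv_mem h3)
  convert this using 1; group

theorem inv_mem_coset {i : ι} {m : G} (hm : m ∈ M i) : m⁻¹ ∈ M i := by
  obtain ⟨n, hn, hn'⟩ := (hd.exists_mem_coset_inv_mem i).2
  rw [hd.coset_negIdx] at hn'
  have h1 := hd.coset_conj_mem_torus hn' (T.inv_mem (hd.mul_inv_mem_torus hm hn))
  have := hd.mul_mem_coset h1 hn'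
  convert this using 1; group

theorem mul_mem_torus {i : ι} {m n : G} (hm : m ∈ M i) (hn : n ∈ M i) : m * n ∈ T := by
  have := hd.mul_inv_mem_torus hm (hd.inv_mem_coset hn)
  rwa [inv_inv] at this

end IsRootGroupDatum

end Datum

end LocalRootDatum

namespace LocalRootDatum

/-! ### Elementary properties of valuations -/

namespace RValuation

section Basic

variable {ι E V G R : Type*} [AddCommGroup E] [Module ℝ E] [AddCommGroup V] [Module ℝ V]
  [Group G] [AddCommGroup R] [LinearOrder R]
  {P : RootPairing ι ℝ E V} {T : Subgroup G} {U : ι → Subgroup G} {M : ι → Set G}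
  (w : RValuation P U M R)
include w

theorem mem_subgroupGE {i : ι} {l : R} {g : G} :
    g ∈ w.subgroupGE i l ↔ g ∈ U i ∧ (l : WithTop R) ≤ w.φ i g := Iff.rfl

theorem mem_subgroupGT {i : ι} {l : R} {g : G} :
    g ∈ w.subgroupGT i l ↔ g ∈ U i ∧ (l : WithTop R) < w.φ i g := Iff.rfl

theorem subgroupGE_le (i : ι) (l : R) : w.subgroupGE i l ≤ U i := fun _ h => h.1

theorem subgroupGT_le (i : ι) (l : R) : w.subgroupGT i l ≤ U i := fun _ h => h.1

theorem subgroupGT_le_subgroupGE (i : ι) (l : R) : w.subgroupGT i l ≤ w.subgroupGE i l :=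
  fun _ h => ⟨h.1, h.2.le⟩

theorem φ_one (i : ι) : w.φ i 1 = ⊤ := by
  have h : (1 : G) ∈ valSet U w.φ i ⊤ := by rw [w.valSet_top]; rfl
  exact top_le_iff.1 h.2

theorem eq_one_of_φ_eq_top {i : ι} {g : G} (hg : g ∈ U i) (h : w.φ i g = ⊤) : g = 1 := by
  have : g ∈ valSet U w.φ i ⊤ := ⟨hg, h.ge⟩
  rwa [w.valSet_top] at this

theorem exists_φ_eq {i : ι} {g : G} (hg : g ∈ U i) (h : g ≠ 1) : ∃ k : R, w.φ i g = k := by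
  have : w.φ i g ≠ ⊤ := fun h' => h (w.eq_one_of_φ_eq_top hg h')
  exact ⟨(w.φ i g).untop this, (WithTop.coe_untop _ _).symm⟩

theorem ne_one_of_φ_eq {i : ι} {g : G} {k : R} (h : w.φ i g = k) : g ≠ 1 := by
  rintro rfl
  rw [w.φ_one] at h
  exact WithTop.coe_ne_top h.symm

theorem φ_inv {i : ι} {g : G} (hg : g ∈ U i) : w.φ i g⁻¹ = w.φ i g := by
  have key : ∀ g ∈ U i, w.φ i g ≤ w.φ i g⁻¹ := by
    intro g hg
    obtain ⟨H, hH⟩ := w.isSubgroup i (w.φ i g)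
    have h1 : g ∈ H := by rw [← SetLike.mem_coe, hH]; exact ⟨hg, le_rfl⟩
    have h2 : g⁻¹ ∈ (H : Set G) := H.inv_mem h1
    rw [hH] at h2
    exact h2.2
  refine le_antisymm ?_ (key g hg)
  simpa using key g⁻¹ ((U i).inv_mem hg)

theorem le_φ_mul {i : ι} {g h : G} (hg : g ∈ U i) (hh : h ∈ U i) {l : WithTop R}
    (h1 : l ≤ w.φ i g) (h2 : l ≤ w.φ i h) : l ≤ w.φ i (g * h) := by
  obtain ⟨H, hH⟩ := w.isSubgroup i l
  have h3 : g ∈ H := by rw [← SetLike.mem_coe, hH]; exact ⟨hg, h1⟩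
  have h4 : h ∈ H := by rw [← SetLike.mem_coe, hH]; exact ⟨hh, h2⟩
  have h5 : g * h ∈ (H : Set G) := H.mul_mem h3 h4
  rw [hH] at h5
  exact h5.2

theorem φ_mul_of_lt {i : ι} {g h : G} (hg : g ∈ U i) (hh : h ∈ U i) (hlt : w.φ i g < w.φ i h) :
    w.φ i (g * h) = w.φ i g := by
  refine le_antisymm ?_ (w.le_φ_mul hg hh le_rfl hlt.le)
  by_contra! h1
  have h2 := w.le_φ_mul ((U i).mul_mem hg hh) ((U i).inv_mem hh)
    (l := min (w.φ i (g * h)) (w.φ i h)) (min_le_left _ _)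
    (by rw [w.φ_inv hh]; exact min_le_right _ _)
  rw [mul_inv_cancel_right] at h2
  exact absurd (lt_of_lt_of_le (lt_min h1 hlt) h2) (lt_irrefl _)

/-- The commutator axiom for two elements of root groups. -/
theorem commutator_mem_iSup (X : ι → Subgroup G) {i j : ι}
    (hij : ∀ c : ℝ, c ≤ 0 → P.root j ≠ c • P.root i) {u v : G} (hu : u ∈ U i) (hv : v ∈ U j)
    (h : ∀ l μ : R, w.φ i u = l → w.φ j v = μ → ∀ (k : ι) (r s : ℕ), 0 < r → 0 < s →
      P.root k = r • P.root i + s • P.root j → w.subgroupGE k (r • l + s • μ) ≤ X k) :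
    u * v * u⁻¹ * v⁻¹ ∈ ⨆ k ∈ posCombs P i j, X k := by
  by_cases hu1 : u = 1
  · simp [hu1, one_mem]
  by_cases hv1 : v = 1
  · simp [hv1, one_mem]
  obtain ⟨l, hl⟩ := w.exists_φ_eq hu hu1
  obtain ⟨μ, hμ⟩ := w.exists_φ_eq hv hv1
  have h1 := w.commutator_mem i j hij l μ u ⟨hu, hl.ge⟩ v ⟨hv, hμ.ge⟩
  refine (Subgroup.closure_le _).2 ?_ h1
  rintro g ⟨k, r, s, hr, hs, hk, hg⟩
  exact (le_iSup₂ (f := fun k (_ : k ∈ posCombs P i j) => X k) k ⟨r, s, hr, hs, hk⟩)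
    (h l μ hl hμ k r s hr hs hk hg)

end Basic

section Ordered

variable {ι E V G R : Type*} [AddCommGroup E] [Module ℝ E] [AddCommGroup V] [Module ℝ V]
  [Group G] [AddCommGroup R] [LinearOrder R]
  {P : RootPairing ι ℝ E V} {T : Subgroup G} {U : ι → Subgroup G} {M : ι → Set G}
  (w : RValuation P U M R) (hd : IsRootGroupDatum P T U M)

theorem φ_opposite {i : ι} {u a b : G} {k : R} (hk : w.φ i u = k) (hu : u ∈ U i)
    (ha : a ∈ U (negIdx P i)) (hb : b ∈ U (negIdx P i)) (h : a * u * b ∈ M i) :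
    w.φ (negIdx P i) a = ((-k : R) : WithTop R) := by
  have h1 := w.opposite_eq i u hu a ha b hb h
  rw [hk] at h1
  have h2 : a ≠ 1 := by
    rintro rfl
    rw [w.φ_one, WithTop.top_add] at h1
    exact WithTop.top_ne_zero h1
  obtain ⟨l, hl⟩ := w.exists_φ_eq ha h2
  rw [hl] at h1 ⊢
  norm_cast at h1 ⊢
  exact eq_neg_of_add_eq_zero_left h1

include hd

theorem φ_opposite' [Finite ι] {i : ι} {u a b : G} {k : R} (hk : w.φ i u = k) (hu : u ∈ U i)
    (ha : a ∈ U (negIdx P i)) (hb : b ∈ U (negIdx P i)) (h : a * u * b ∈ M i) :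
    w.φ (negIdx P i) b = ((-k : R) : WithTop R) := by
  rw [← w.φ_inv hb]
  refine w.φ_opposite (u := u⁻¹) (b := a⁻¹) (by rw [w.φ_inv hu, hk]) ((U i).inv_mem hu)
    ((U _).inv_mem hb) ((U _).inv_mem ha) ?_
  convert hd.inv_mem_coset h using 1
  group

/-- A nontrivial element of `U_α` of value `k` lies in `U_{-α,-k} M_{α,k} U_{-α,-k}`. -/
theorem exists_valuedCoset [Finite ι] {i : ι} {u : G} (hu : u ∈ U i) {k : R}
    (hk : w.φ i u = k) :
    ∃ a m b, a ∈ U (negIdx P i) ∧ b ∈ U (negIdx P i) ∧ w.φ (negIdx P i) a = ((-k : R) : WithTop R) ∧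
      w.φ (negIdx P i) b = ((-k : R) : WithTop R) ∧ m ∈ w.valuedCoset i k ∧ u = a * m * b := by
  obtain ⟨a, ha, b, hb, h⟩ := hd.exists_mem_coset hu (w.ne_one_of_φ_eq hk)
  refine ⟨a⁻¹, a * u * b, b⁻¹, (U _).inv_mem ha, (U _).inv_mem hb, ?_, ?_, ⟨h, ?_⟩, by group⟩
  · rw [w.φ_inv ha]; exact w.φ_opposite hk hu ha hb h
  · rw [w.φ_inv hb]; exact w.φ_opposite' hd hk hu ha hb h
  · exact ⟨a * u, ⟨a, ha, u, ⟨hu, hk⟩, rfl⟩, b, hb, rfl⟩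

/-- If `m = a u b`, then moving `b` to the left by conjugation with `m` gives `m = b' a u` with `b',
u ∈ U_α`. The middle factor is now `a ∈ U_{-α}`, of value `-k`. -/
theorem valuedCoset_negIdx [Finite ι] {i : ι} {k : R} :
    w.valuedCoset (negIdx P i) (-k) = w.valuedCoset i k := by
  have key : ∀ (i : ι) (k : R), w.valuedCoset i k ⊆ w.valuedCoset (negIdx P i) (-k) := by
    rintro i k m ⟨hm, -, ⟨a, ha, u, ⟨hu, hk⟩, rfl⟩, b, hb, rfl⟩
    refine ⟨by rw [hd.coset_negIdx]; exact hm, ?_⟩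
    rw [negIdx_negIdx]
    have h1 : a * u * b * b⁻¹ * (a * u * b)⁻¹ ∈ U i :=
      ((hd.swaps hm).mem_iff' _).2 ((U _).inv_mem hb)
    refine ⟨(a * u * b * b⁻¹ * (a * u * b)⁻¹)⁻¹ * a, ⟨_, (U i).inv_mem h1, a,
      ⟨ha, w.φ_opposite hk hu ha hb hm⟩, rfl⟩, u, hu, ?_⟩
    dsimp only
    group
  refine subset_antisymm ?_ (key i k)
  have := key (negIdx P i) (-k)
  rwa [negIdx_negIdx, neg_neg] at this

end Ordered

/-! ### Shifts of the valuations under conjugation by the `M_α` and by `T` -/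

section Shift

variable {ι E V G R A : Type*} [Finite ι] [AddCommGroup E] [Module ℝ E] [AddCommGroup V]
  [Module ℝ V] [Group G] [AddCommGroup R] [LinearOrder R]
  {P : RootPairing ι ℝ E V} [P.IsCrystallographic] {T : Subgroup G} {U : ι → Subgroup G}
  {M : ι → Set G} (w : RValuation P U M R) (hd : IsRootGroupDatum P T U M)
  [AddTorsor (VR P R) A] {o : A} {ν : groupN M →* affGroup P R A}

omit [Finite ι] [LinearOrder R] [P.IsCrystallographic] in
theorem mem_groupN {i : ι} {m : G} (hm : m ∈ M i) : m ∈ groupN M :=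
  Subgroup.subset_closure (Set.mem_iUnion.2 ⟨i, hm⟩)

include hd

omit [AddCommGroup R] [LinearOrder R] [P.IsCrystallographic] in
theorem _root_.LocalRootDatum.IsRootGroupDatum.conj_mem_coset {i j : ι} {n u a b : G}
    (hn : n ∈ M i) (hu : u ∈ U j) (hu1 : u ≠ 1) (ha : a ∈ U (negIdx P j)) (hb : b ∈ U (negIdx P j))
    (hm : a * u * b ∈ M j) : n * (a * u * b) * n⁻¹ ∈ M (P.reflectionPerm i j) := by
  have hneg := reflectionPerm_negIdx P i j
  have hs := hd.swaps hm
  have hc : ∀ g, n * (a * u * b) * n⁻¹ * g * (n * (a * u * b) * n⁻¹)⁻¹ =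
      n * (a * u * b * (n⁻¹ * g * n) * (a * u * b)⁻¹) * n⁻¹ := fun g => by group
  have hg : ∀ g, n * (n⁻¹ * g * n) * n⁻¹ = g := fun g => by group
  refine hd.mem_coset_of_swaps (hd.conj_mem hn hu) (by simpa using hu1)
    (hneg ▸ hd.conj_mem hn ha) (hneg ▸ hd.conj_mem hn hb) ⟨fun g => ?_, fun g => ?_⟩
    (by group : _ = n * a * n⁻¹ * (n * u * n⁻¹) * (n * b * n⁻¹))
  · rw [hc, ← hneg, hd.conj_mem_iff hn, hs.mem_iff, ← hd.conj_mem_iff hn, hg]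
  · rw [hc, hd.conj_mem_iff hn, hs.mem_iff', ← hd.conj_mem_iff hn, hg, hneg]

variable [IsOrderedAddMonoid R] (hν : IsCompatibleAction w o ν)
include hν

/-- Conjugation by an element `m` of `M_α` shifts the valuations, by an amount which depends
linearly on the root; for `m` in `M_{α,l}` the shift of `φ_α` is `-2l`. -/
theorem exists_shift {i : ι} {m : G} (hm : m ∈ M i) :
    ∃ y : VR P R, (∀ j, ∀ u ∈ U j, w.φ (P.reflectionPerm i j) (m * u * m⁻¹) =
      w.φ j u + ((rootEval P j y : R) : WithTop R)) ∧
      ∀ l : R, m ∈ w.valuedCoset i l → rootEval P i y = -(l + l) := by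
  set n : groupN M := ⟨m, mem_groupN hm⟩ with hn
  set f : A ≃ᵃ[ℤ] A := (ν n : A ≃ᵃ[ℤ] A) with hf
  have hflin : ∀ x : VR P R, f.linear x = x - corootZ P i ⊗ₜ[ℤ] rootEval P i x :=
    fun x => hν.linear_eq i n hm x
  -- The shift is the displacement of the origin under `ν(m)⁻¹`.
  set y : VR P R := f.symm o -ᵥ o with hy
  have hfo : f (y +ᵥ o) = o := by rw [hy, vsub_vadd, AffineEquiv.apply_symm_apply]
  have two_inj : ∀ a b : R, a + a = b + b → a = b := fun a b h => by
    rcases lt_trichotomy a b with h' | h' | h'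
    · exact absurd h (add_lt_add h' h').ne
    · exact h'
    · exact absurd h (add_lt_add h' h').ne'
  refine ⟨y, fun j u hu => ?_, fun l hl => ?_⟩
  · by_cases hu1 : u = 1
    · rw [hu1, mul_one, mul_inv_cancel, w.φ_one, w.φ_one, WithTop.top_add]
    obtain ⟨a, ha, b, hb, hab⟩ := hd.exists_mem_coset hu hu1
    have hc := hd.conj_mem_coset hm hu hu1 ha hb hab
    set p : groupN M := ⟨a * u * b, mem_groupN hab⟩ with hp
    set g : A ≃ᵃ[ℤ] A := (ν p : A ≃ᵃ[ℤ] A) with hg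
    have hglin : ∀ x : VR P R, g.linear x = x - corootZ P j ⊗ₜ[ℤ] rootEval P j x :=
      fun x => hν.linear_eq j p hab x
    have hneg := reflectionPerm_negIdx P i j
    have e1 := hν.value_eq j u hu hu1 p hab ⟨a, ha, b, hb, rfl⟩
    -- Conjugation carries `m(u)` to `m(m u m⁻¹)`. Comparing the compatibility formulas for these
    -- two elements gives twice the shift, and an ordered group has no `2`-torsion.
    have e2 := hν.value_eq (P.reflectionPerm i j) _ (hd.conj_mem hm hu) (by simpa using hu1)
      (n * p * n⁻¹) hc ⟨m * a * m⁻¹, hneg ▸ hd.conj_mem hm ha, m * b * m⁻¹,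
        hneg ▸ hd.conj_mem hm hb, by
        change m * (a * u * b) * m⁻¹ = _
        group⟩
    have hcomp : ((ν (n * p * n⁻¹) : affGroup P R A) : A ≃ᵃ[ℤ] A) o = f (g (f.symm o)) := by
      rw [map_mul, map_mul, map_inv]; rfl
    have hval : ((ν (n * p * n⁻¹) : affGroup P R A) : A ≃ᵃ[ℤ] A) o -ᵥ o =
        f.linear ((g o -ᵥ o) - corootZ P j ⊗ₜ[ℤ] rootEval P j y) := by
      have h1 : f.symm o = y +ᵥ o := by rw [hy, vsub_vadd]
      have h2 : g (y +ᵥ o) = ((g o -ᵥ o) - corootZ P j ⊗ₜ[ℤ] rootEval P j y) +ᵥ (y +ᵥ o) := by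
        rw [AffineEquiv.map_vadd, hglin]
        conv_lhs => rw [← vsub_vadd (g o) o]
        rw [vadd_vadd, vadd_vadd]
        congr 1
        abel
      rw [hcomp, h1, h2, AffineEquiv.map_vadd, hfo, vadd_vsub]
    rw [hval, hflin, rootEval_reflectionPerm_reflection, map_sub, rootEval_corootZ_tmul,
      RootPairing.pairingIn_same] at e2
    obtain ⟨k, hk⟩ := w.exists_φ_eq hu hu1
    obtain ⟨k', hk'⟩ := w.exists_φ_eq (hd.conj_mem hm hu) (by simpa using hu1 : m * u * m⁻¹ ≠ 1)
    rw [hk] at e1 ⊢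
    rw [hk'] at e2 ⊢
    norm_cast at e1 e2 ⊢
    apply two_inj
    rw [two_nsmul] at e2
    have h3 : rootEval P j (g o -ᵥ o) = -(k + k) := eq_neg_of_add_eq_zero_right e1
    rw [h3] at e2
    rw [← sub_eq_zero]
    rw [← e2]
    abel
  · obtain ⟨-, -, ⟨a, ha, u, ⟨hu, hk⟩, rfl⟩, b, hb, hab⟩ := hl
    have e1 := hν.value_eq i u hu (w.ne_one_of_φ_eq hk) n hm ⟨a, ha, b, hb, hab.symm⟩
    rw [hk] at e1
    norm_cast at e1
    rw [← eq_neg_of_add_eq_zero_right e1]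
    have h1 : f o -ᵥ o = -(f.linear y) := by
      have := hfo
      rw [AffineEquiv.map_vadd] at this
      rw [eq_neg_iff_add_eq_zero, add_comm, ← vadd_vsub_assoc, this, vsub_self]
    rw [← hf, h1, map_neg, hflin, map_sub, rootEval_corootZ_tmul, RootPairing.pairingIn_same,
      two_zsmul]
    abel

/-- With `t = (t m) m⁻¹` and `m ∈ M_α`, the shift by `t` is the difference of the shifts by `t m`
and by `m`. -/
theorem exists_torus_shift {t : G} (ht : t ∈ T) (i : ι) :
    ∃ c : R, ∀ u ∈ U i, w.φ i (t * u * t⁻¹) = w.φ i u + (c : WithTop R) := by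
  obtain ⟨u, hu, hu1⟩ := hd.exists_ne_one i
  obtain ⟨a, ha, b, hb, hm⟩ := hd.exists_mem_coset hu hu1
  set m := a * u * b
  obtain ⟨y, hy, -⟩ := w.exists_shift hd hν hm
  obtain ⟨z, hz, -⟩ := w.exists_shift hd hν (hd.mul_mem_coset ht hm)
  refine ⟨rootEval P (negIdx P i) z - rootEval P (negIdx P i) y, fun v hv => ?_⟩
  have hv' : m⁻¹ * v * m ∈ U (negIdx P i) := by
    have := ((hd.swaps hm).inv.mem_iff v).2 hv
    simpa using this
  have h1 := hy _ _ hv'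
  have h2 := hz _ _ hv'
  have e1 : m * (m⁻¹ * v * m) * m⁻¹ = v := by group
  have e2 : t * m * (m⁻¹ * v * m) * (t * m)⁻¹ = t * v * t⁻¹ := by group
  have e3 : P.reflectionPerm i (negIdx P i) = i := by
    rw [reflectionPerm_negIdx]; exact negIdx_negIdx P i
  rw [e1, e3] at h1
  rw [e2, e3] at h2
  by_cases hv1 : v = 1
  · rw [hv1, mul_one, mul_inv_cancel, w.φ_one, WithTop.top_add]
  obtain ⟨k, hk⟩ := w.exists_φ_eq hv' (by
    intro h; apply hv1; rw [← e1, h]; group)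
  rw [hk] at h1 h2
  rw [h1, h2]
  norm_cast
  abel

end Shift

end RValuation

end LocalRootDatum

namespace LocalRootDatum

/-! ### Families of subgroups of the root groups that are closed under commutators -/

section Family

variable {ι E V G : Type*} [AddCommGroup E] [Module ℝ E] [AddCommGroup V] [Module ℝ V] [Group G]

theorem le_normalizer_of_forall_conj_mem {K H : Subgroup G}
    (h : ∀ x ∈ K, ∀ g ∈ H, x * g * x⁻¹ ∈ H) : K ≤ Subgroup.normalizer (H : Set G) := by
  intro x hx
  rw [Subgroup.mem_normalizer_iff]
  refine fun g => ⟨h x hx g, fun hg => ?_⟩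
  have := h x⁻¹ (K.inv_mem hx) _ hg
  convert this using 1
  group

theorem conj_mem_of_le_normalizer {K H : Subgroup G} (h : K ≤ Subgroup.normalizer (H : Set G))
    {x g : G} (hx : x ∈ K) (hg : g ∈ H) : x * g * x⁻¹ ∈ H :=
  (Subgroup.mem_normalizer_iff.1 (h hx) g).1 hg

theorem forall_conj_mem_iSup {κ : Type*} {q : κ → Prop} {Y : κ → Subgroup G} {H : Subgroup G}
    {x : G} (h : ∀ j, q j → ∀ y ∈ Y j, x * y * x⁻¹ ∈ H) {g : G} (hg : g ∈ ⨆ (j) (_ : q j), Y j) :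
    x * g * x⁻¹ ∈ H := by
  have : (⨆ (j) (_ : q j), Y j) ≤ H.comap (MulAut.conj x).toMonoidHom :=
    iSup₂_le fun j hj y hy => h j hj y hy
  exact this hg

/-- The members `X_α` of a family of subgroups `X_α ≤ U_α` satisfy the commutator relations of a
root group datum. -/
structure IsCommClosed (P : RootPairing ι ℝ E V) (U X : ι → Subgroup G) : Prop where
  le : ∀ i, X i ≤ U i
  commutator_mem : ∀ i j, (∀ c : ℝ, c ≤ 0 → P.root j ≠ c • P.root i) → ∀ x ∈ X i, ∀ y ∈ X j,
    x * y * x⁻¹ * y⁻¹ ∈ ⨆ k ∈ posCombs P i j, X k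

/-- The group generated by the members of the family attached to the positive multiples of `α`. -/
def rayGroup (P : RootPairing ι ℝ E V) (X : ι → Subgroup G) (i : ι) : Subgroup G :=
  ⨆ (j) (_ : SameRay P i j), X j

/-- The group generated by the members of the family attached to the roots that are positive
on `v` and no positive multiples of `α`. -/
def restGroup (P : RootPairing ι ℝ E V) (X : ι → Subgroup G) (i : ι) (v : V) : Subgroup G :=
  ⨆ (j) (_ : 0 < P.root' j v ∧ ¬ SameRay P i j), X j

variable {P : RootPairing ι ℝ E V} {T : Subgroup G} {U X : ι → Subgroup G} {M : ι → Set G}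

theorem mem_rayGroup {i j : ι} (h : SameRay P i j) {g : G} (hg : g ∈ X j) : g ∈ rayGroup P X i :=
  (le_iSup₂ (f := fun j (_ : SameRay P i j) => X j) j h) hg

theorem rayGroup_le {i j : ι} (h : SameRay P i j) : rayGroup P X i ≤ rayGroup P X j :=
  iSup₂_le fun _ hk _ hg => mem_rayGroup (h.symm.trans hk) hg

theorem rayGroup_le_chamberGroup {i : ι} {v : V} (hi : 0 < P.root' i v) :
    rayGroup P X i ≤ chamberGroup P X v :=
  iSup₂_le fun _ hk _ hg => mem_chamberGroup ((hk.pos_iff v).2 hi) hg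

theorem Crossing.neg_neg {i : ι} {v v' : V} (h : Crossing P i v v') :
    Crossing P (negIdx P i) (-v) (-v') where
  regular := h.regular.neg
  regular' := h.regular'.neg
  pos := by rw [root'_negIdx, map_neg, _root_.neg_neg]; exact h.pos
  neg := by rw [root'_negIdx, map_neg, _root_.neg_neg]; exact h.neg
  pos_iff j h1 h2 := by
    rw [negIdx_negIdx] at h2
    have h3 := h.pos_iff j h2 h1
    rw [map_neg, map_neg, Left.neg_pos_iff, Left.neg_pos_iff, ← h.regular.not_pos_iff,
      ← h.regular'.not_pos_iff, h3]

theorem Crossing.chamberGroup_eq {i : ι} {v v' : V} (h : Crossing P i v v') :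
    chamberGroup P X v = rayGroup P X i ⊔ restGroup P X i v := by
  refine le_antisymm (iSup₂_le fun j hj => ?_) (sup_le (rayGroup_le_chamberGroup h.pos) ?_)
  · by_cases hij : SameRay P i j
    · exact le_sup_of_le_left fun g hg => mem_rayGroup hij hg
    · exact le_sup_of_le_right
        (le_iSup₂ (f := fun j (_ : 0 < P.root' j v ∧ ¬ SameRay P i j) => X j) j ⟨hj, hij⟩)
  · exact iSup₂_le fun j hj g hg => mem_chamberGroup hj.1 hg

theorem Crossing.restGroup_eq {i : ι} {v v' : V} (h : Crossing P i v v') :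
    restGroup P X (negIdx P i) v' = restGroup P X i v := by
  have key : ∀ j, (0 < P.root' j v' ∧ ¬ SameRay P (negIdx P i) j) ↔
      (0 < P.root' j v ∧ ¬ SameRay P i j) := fun j =>
    ⟨fun hj => ⟨h.symm.pos' hj.1 hj.2, h.not_sameRay hj.1⟩,
      fun hj => ⟨h.pos' hj.1 hj.2, h.symm.not_sameRay hj.1⟩⟩
  simp only [restGroup, key]

theorem Crossing.restGroup_le {i : ι} {v v' : V} (h : Crossing P i v v') :
    restGroup P X i v ≤ chamberGroup P X v' := by
  rw [h.symm.chamberGroup_eq, h.restGroup_eq]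
  exact le_sup_right

theorem not_root_eq_nonpos_smul {i j : ι} {v : V} (hi : 0 < P.root' i v) (hj : 0 < P.root' j v) :
    ∀ c : ℝ, c ≤ 0 → P.root j ≠ c • P.root i := by
  intro c hc h
  rw [root'_of_root_eq_smul P h] at hj
  exact absurd hj (not_lt.2 (mul_nonpos_of_nonpos_of_nonneg hc hi.le))

theorem root'_of_posCombs {i j k : ι} (h : k ∈ posCombs P i j) {v : V} (hi : 0 < P.root' i v)
    (hj : 0 < P.root' j v) : 0 < P.root' k v := by
  obtain ⟨r, s, hr, hs, hk⟩ := h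
  have : P.root' k v = r * P.root' i v + s * P.root' j v := by
    simp [RootPairing.root', hk]
  rw [this]
  positivity

/-- If a positive combination of a root on the ray and a root `β` lay on the ray, `β` would be
proportional to `α` and, being positive on `v`, on the ray itself. -/
theorem IsCommClosed.rayGroup_le_normalizer (hX : IsCommClosed P U X) {i : ι} {v v' : V}
    (h : Crossing P i v v') :
    rayGroup P X i ≤ Subgroup.normalizer (restGroup P X i v : Set G) := by
  refine iSup₂_le fun k hk => le_normalizer_of_forall_conj_mem fun x hx g hg =>
    forall_conj_mem_iSup (fun j hj y hy => ?_) hg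
  have hkv : 0 < P.root' k v := (hk.pos_iff v).2 h.pos
  have h1 := hX.commutator_mem k j (not_root_eq_nonpos_smul hkv hj.1) x hx y hy
  have h2 : (⨆ l ∈ posCombs P k j, X l) ≤ restGroup P X i v := by
    refine iSup₂_le fun l hl => le_iSup₂
      (f := fun l (_ : 0 < P.root' l v ∧ ¬ SameRay P i l) => X l) l
      ⟨root'_of_posCombs hl hkv hj.1, fun hil => hj.2 ?_⟩
    obtain ⟨r, s, hr, hs, hrs⟩ := hl
    obtain ⟨c, hc, hil⟩ := hil
    obtain ⟨d, hd, hk⟩ := hk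
    have h3 : P.root j = ((s : ℝ)⁻¹ * (c - r * d)) • P.root i := by
      have hs0 : (s : ℝ) ≠ 0 := by positivity
      rw [hil, hk, ← Nat.cast_smul_eq_nsmul ℝ, ← Nat.cast_smul_eq_nsmul ℝ] at hrs
      have h4 : (s : ℝ) • P.root j = (c - r * d) • P.root i := by
        rw [sub_smul, hrs]; module
      rw [mul_smul, ← h4, smul_smul, inv_mul_cancel₀ hs0, one_smul]
    refine ⟨_, ?_, h3⟩
    have h5 := hj.1
    rw [root'_of_root_eq_smul P h3] at h5
    exact pos_of_mul_pos_left h5 h.pos.le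
  have h3 : x * y * x⁻¹ = x * y * x⁻¹ * y⁻¹ * y := by group
  rw [h3]
  exact Subgroup.mul_mem _ (h2 h1) ((le_iSup₂
    (f := fun l (_ : 0 < P.root' l v ∧ ¬ SameRay P i l) => X l) j hj) hy)

theorem IsCommClosed.exists_ray_mul_rest (hX : IsCommClosed P U X) {i : ι} {v v' : V}
    (h : Crossing P i v v') {g : G} (hg : g ∈ chamberGroup P X v) :
    ∃ x ∈ rayGroup P X i, ∃ r ∈ restGroup P X i v, x * r = g := by
  rw [h.chamberGroup_eq, ← SetLike.mem_coe,
    Subgroup.coe_mul_of_left_le_normalizer_right _ _ (hX.rayGroup_le_normalizer h)] at hg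
  exact hg

theorem IsCommClosed.exists_rest_mul_ray (hX : IsCommClosed P U X) {i : ι} {v v' : V}
    (h : Crossing P i v v') {g : G} (hg : g ∈ chamberGroup P X v) :
    ∃ r ∈ restGroup P X i v, ∃ x ∈ rayGroup P X i, r * x = g := by
  obtain ⟨x, hx, r, hr, hxr⟩ := hX.exists_ray_mul_rest h (Subgroup.inv_mem _ hg)
  refine ⟨r⁻¹, Subgroup.inv_mem _ hr, x⁻¹, Subgroup.inv_mem _ hx, ?_⟩
  rw [← mul_inv_rev, hxr, inv_inv]

variable [Finite ι]

/-- An element of `U_γ` which lies in the group generated by the members of a commutator closed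
family for a system of positive roots lies already in the members for the ray of `γ`. -/
theorem IsRootGroupDatum.mem_rayGroup_of_mem_chamberGroup (hd : IsRootGroupDatum P T U M)
    (hX : IsCommClosed P U X) {k : ι} {v : V} (hv : IsRegular P v) (hk : 0 < P.root' k v) {g : G}
    (hg : g ∈ chamberGroup P X v) (hgk : g ∈ U k) : g ∈ rayGroup P X k := by
  revert g
  refine crossing_induction (P := P) k (C := fun v => ∀ {g : G}, g ∈ chamberGroup P X v →
    g ∈ U k → g ∈ rayGroup P X k) (fun v v' i hc hor g hg hgk => ?_) hv hk
  obtain ⟨x, hx, r, hr, rfl⟩ := hX.exists_ray_mul_rest hc hg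
  have hiv : 0 < P.root' i (-v') := by rw [map_neg]; linarith [hc.neg]
  have hx' : x ∈ chamberGroup P U (-v') :=
    chamberGroup_mono hX.le _ (rayGroup_le_chamberGroup hiv hx)
  have hr' := hc.restGroup_le hr
  have hr'' : r ∈ chamberGroup P U v' := chamberGroup_mono hX.le _ hr'
  -- The factors `x` and `r` lie on opposite sides of the chamber of `v'`, and `g` lies on one of
  -- them: the other factor is trivial. Either `γ` is on the ray just crossed and `r = 1`, or `x =
  -- 1` and the gallery continues.
  rcases hor with hik | ⟨hk', ih⟩
  · have h1 : x * r ∈ chamberGroup P U (-v') :=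
      mem_chamberGroup ((hik.pos_iff _).2 hiv) hgk
    have h2 : r ∈ chamberGroup P U (-v') := by
      have := Subgroup.mul_mem _ (Subgroup.inv_mem _ hx') h1
      simpa using this
    rw [hd.eq_one_of_mem_chamberGroup hc.regular' hr'' h2, mul_one]
    exact rayGroup_le hik hx
  · have h1 : x * r ∈ chamberGroup P U v' := mem_chamberGroup hk' hgk
    have h2 : x ∈ chamberGroup P U v' := by
      have := Subgroup.mul_mem _ h1 (Subgroup.inv_mem _ hr'')
      simpa using this
    have h3 := hd.eq_one_of_mem_chamberGroup hc.regular' h2 hx'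
    rw [h3, one_mul] at hgk ⊢
    exact ih hr' hgk

/-- The product of the positive part of a family, of a torus and of the negative part. -/
def bigCell (P : RootPairing ι ℝ E V) (X : ι → Subgroup G) (S : Subgroup G) (v : V) : Set G :=
  {g | ∃ a ∈ chamberGroup P X v, ∃ s ∈ S, ∃ b ∈ chamberGroup P X (-v), g = a * s * b}

/-! ### Independence of the big cell from the chamber -/

section BigCell

variable {S : Subgroup G} (hX : IsCommClosed P U X)
  (hS : ∀ s ∈ S, ∀ i, ∀ x ∈ X i, s * x * s⁻¹ ∈ X i)
  (hswap : ∀ i, ∀ a ∈ rayGroup P X i, ∀ b ∈ rayGroup P X (negIdx P i),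
    ∃ b' ∈ rayGroup P X (negIdx P i), ∃ s ∈ S, ∃ a' ∈ rayGroup P X i, a * b = b' * s * a')
include hS

omit [Finite ι] in
theorem conj_mem_iSup_of_forall {q : ι → Prop} {s g : G} (hs : s ∈ S)
    (hg : g ∈ ⨆ (j) (_ : q j), X j) : s * g * s⁻¹ ∈ ⨆ (j) (_ : q j), X j :=
  forall_conj_mem_iSup (fun j hj y hy => (le_iSup₂ (f := fun j (_ : q j) => X j) j hj)
    (hS s hs j y hy)) hg

include hX hswap

omit [Finite ι] in
-- Place the ray factor last in the positive part and first in the negative part. The two ray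
-- factors then meet in the middle, up to an element of `S`, and `hswap` interchanges them; the
-- remaining factors keep their signs.
theorem bigCell_subset {i : ι} {v v' : V} (h : Crossing P i v v') :
    bigCell P X S v ⊆ bigCell P X S v' := by
  rintro g ⟨a, ha, s, hs, b, hb, rfl⟩
  obtain ⟨r, hr, x, hx, rfl⟩ := hX.exists_rest_mul_ray h ha
  obtain ⟨y, hy, r', hr', rfl⟩ := hX.exists_ray_mul_rest h.neg_neg hb
  have hx1 : s⁻¹ * x * s ∈ rayGroup P X i := by
    have := conj_mem_iSup_of_forall hS (S.inv_mem hs) hx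
    rwa [inv_inv] at this
  obtain ⟨y', hy', s', hs', x', hx', e⟩ := hswap i _ hx1 y hy
  have hy1 := conj_mem_iSup_of_forall hS hs hy'
  have hneg : 0 < P.root' (negIdx P i) v' := by rw [root'_negIdx]; linarith [h.neg]
  have hpos : 0 < P.root' i (-v') := by rw [map_neg]; linarith [h.neg]
  refine ⟨r * (s * y' * s⁻¹), Subgroup.mul_mem _ (h.restGroup_le hr)
    (rayGroup_le_chamberGroup hneg hy1), s * s', S.mul_mem hs hs', x' * r',
    Subgroup.mul_mem _ (rayGroup_le_chamberGroup hpos hx') (h.neg_neg.restGroup_le hr'), ?_⟩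
  calc r * x * s * (y * r') = r * s * (s⁻¹ * x * s * y) * r' := by group
    _ = r * s * (y' * s' * x') * r' := by rw [e]
    _ = _ := by group

/-- This is clear when the root is positive on `v`. Otherwise move the cell along a gallery until
the wall of the root is crossed, multiply there, and move back. -/
theorem mul_mem_bigCell {k : ι} {v : V} (hv : IsRegular P v) {u g : G} (hu : u ∈ X k)
    (hg : g ∈ bigCell P X S v) : u * g ∈ bigCell P X S v := by
  have hpos : ∀ v, 0 < P.root' k v → ∀ g ∈ bigCell P X S v, u * g ∈ bigCell P X S v := by
    rintro v hk g ⟨a, ha, s, hs, b, hb, rfl⟩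
    exact ⟨u * a, Subgroup.mul_mem _ (mem_chamberGroup hk hu) ha, s, hs, b, hb, by group⟩
  rcases lt_or_gt_of_ne (hv k) with hk | hk
  · have hk' : 0 < P.root' (negIdx P k) v := by rw [root'_negIdx]; linarith
    revert g
    refine crossing_induction (P := P) (negIdx P k) (C := fun v => ∀ {g}, g ∈ bigCell P X S v →
      u * g ∈ bigCell P X S v) (fun v v' i hc hor g hg => ?_) hv hk'
    have h1 := bigCell_subset hX hS hswap hc hg
    apply bigCell_subset hX hS hswap hc.symm
    rcases hor with hik | ⟨-, ih⟩
    · refine hpos v' ?_ g h1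
      have := (hik.pos_iff (-v')).2 (by rw [map_neg]; linarith [hc.neg])
      rwa [root'_negIdx, map_neg, neg_neg] at this
    · exact ih h1
  · exact hpos v hk g hg

/-- The stabilizer of the cell under left translation contains all generators, and the cell contains
`1`. -/
theorem mem_bigCell {v : V} (hv : IsRegular P v) {g : G} (hg : g ∈ S ⊔ ⨆ i, X i) :
    g ∈ bigCell P X S v := by
  have key : ∀ K : Subgroup G, (∀ x ∈ K, ∀ g ∈ bigCell P X S v, x * g ∈ bigCell P X S v) →
      K ≤ MulAction.stabilizer G (bigCell P X S v) := by
    intro K hK x hx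
    rw [MulAction.mem_stabilizer_iff]
    ext g
    rw [Set.mem_smul_set_iff_inv_smul_mem, smul_eq_mul]
    refine ⟨fun h => ?_, fun h => hK _ (K.inv_mem hx) _ h⟩
    simpa using hK x hx _ h
  have h1 : S ⊔ ⨆ i, X i ≤ MulAction.stabilizer G (bigCell P X S v) := by
    refine sup_le (key S ?_) (iSup_le fun i => key _ fun u hu g hg =>
      mul_mem_bigCell hX hS hswap hv hu hg)
    rintro s hs g ⟨a, ha, s', hs', b, hb, rfl⟩
    exact ⟨s * a * s⁻¹, conj_mem_iSup_of_forall hS hs ha, s * s', S.mul_mem hs hs', b, hb,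
      by group⟩
  have h2 := MulAction.mem_stabilizer_iff.1 (h1 hg)
  have h3 : (1 : G) ∈ bigCell P X S v :=
    ⟨1, one_mem _, 1, one_mem _, 1, one_mem _, by group⟩
  have h4 := Set.smul_mem_smul_set (a := g) h3
  rwa [h2, smul_eq_mul, mul_one] at h4

end BigCell

end Family

end LocalRootDatum

namespace LocalRootDatum

/-! ### Pairs of linearly independent roots -/

section Independent

variable {ι E V : Type*} [AddCommGroup E] [Module ℝ E] [AddCommGroup V] [Module ℝ V]
  {P : RootPairing ι ℝ E V}

/-- Otherwise the kernel of one root would be contained in that of the other, and the roots would be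
proportional. -/
theorem exists_root'_eq_zero_pos {i j : ι} (hij : ∀ c : ℝ, P.root j ≠ c • P.root i) :
    ∃ v : V, P.root' i v = 0 ∧ 0 < P.root' j v := by
  by_contra! h
  have h1 : ∀ v, P.root' i v = 0 → P.root' j v = 0 := fun v hv => by
    refine le_antisymm (h v hv) ?_
    have := h (-v) (by simp [hv])
    simpa using this
  have h2 : P.root' j ∈ Submodule.span ℝ (Set.range fun _ : Unit => P.root' i) :=
    mem_span_of_iInf_ker_le_ker (by
      intro v hv
      simp only [Submodule.mem_iInf, LinearMap.mem_ker] at hv ⊢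
      exact h1 v (hv ()))
  rw [Set.range_const, Submodule.mem_span_singleton] at h2
  obtain ⟨c, hc⟩ := h2
  exact hij c (root_eq_smul_of_root' hc.symm)

theorem coeff_unique {i j : ι} (hij : ∀ c : ℝ, P.root j ≠ c • P.root i) {a b a' b' : ℝ}
    (h : a • P.root i + b • P.root j = a' • P.root i + b' • P.root j) : a = a' ∧ b = b' := by
  have hb : b = b' := by
    by_contra hne
    have h1 : (b - b') • P.root j = (a' - a) • P.root i := by
      rw [sub_smul, sub_smul, sub_eq_sub_iff_add_eq_add, add_comm, h, add_comm]
    apply hij ((b - b')⁻¹ * (a' - a))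
    rw [mul_smul, ← h1, smul_smul, inv_mul_cancel₀ (sub_ne_zero.2 hne), one_smul]
  subst hb
  refine ⟨?_, rfl⟩
  have h1 := add_right_cancel h
  rw [← sub_eq_zero, ← sub_smul, smul_eq_zero] at h1
  exact sub_eq_zero.1 (h1.resolve_right (P.ne_zero i))

end Independent

namespace RValuation

variable {ι E V G R : Type*} [AddCommGroup E] [Module ℝ E] [AddCommGroup V] [Module ℝ V]
  [Group G] [AddCommGroup R] [LinearOrder R] [IsOrderedAddMonoid R]
  {P : RootPairing ι ℝ E V} {T : Subgroup G} {U : ι → Subgroup G} {M : ι → Set G}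
  (w : RValuation P U M R) (hd : IsRootGroupDatum P T U M)

/-! ### Strings of roots -/

/-- The group `U_{γ,l}` if `p` is positive and the group `U'_{γ,l}` otherwise. -/
noncomputable def signedGroup (p : ℤ) (c : ι) (l : R) : Subgroup G :=
  if 0 < p then w.subgroupGE c l else w.subgroupGT c l

/-- The family of the groups `U_{pα+qβ,pk+ql}` for `p, q > 0` and `U'_{pα+qβ,pk+ql}` for
`p ≤ 0 < q`. -/
noncomputable def stringFamily (i j : ι) (k l : R) (c : ι) : Subgroup G :=
  ⨆ (p : ℤ) (q : ℕ) (_ : 0 < q ∧ P.root c = (p : ℝ) • P.root i + (q : ℝ) • P.root j),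
    w.signedGroup p c (p • k + q • l)

omit [IsOrderedAddMonoid R] in
theorem signedGroup_le (p : ℤ) (c : ι) (l : R) : w.signedGroup p c l ≤ U c := by
  unfold signedGroup
  split_ifs
  exacts [w.subgroupGE_le _ _, w.subgroupGT_le _ _]

omit [IsOrderedAddMonoid R] in
theorem stringFamily_le (i j : ι) (k l : R) (c : ι) : w.stringFamily i j k l c ≤ U c :=
  iSup_le fun _ => iSup_le fun _ => iSup_le fun _ => w.signedGroup_le _ _ _

omit [IsOrderedAddMonoid R] in
theorem signedGroup_le_stringFamily {i j : ι} (k l : R) {c : ι} {p : ℤ} {q : ℕ} (hq : 0 < q)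
    (h : P.root c = (p : ℝ) • P.root i + (q : ℝ) • P.root j) :
    w.signedGroup p c (p • k + q • l) ≤ w.stringFamily i j k l c :=
  le_iSup_of_le p <| le_iSup_of_le q <| le_iSup_of_le ⟨hq, h⟩ le_rfl

omit [IsOrderedAddMonoid R] in
theorem mem_stringFamily {i j : ι} (hij : ∀ c : ℝ, P.root j ≠ c • P.root i) {k l : R} {c : ι}
    {g : G} (hg : g ∈ w.stringFamily i j k l c) :
    g = 1 ∨ ∃ (p : ℤ) (q : ℕ), 0 < q ∧
      P.root c = (p : ℝ) • P.root i + (q : ℝ) • P.root j ∧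
      g ∈ w.signedGroup p c (p • k + q • l) := by
  by_cases h : ∃ (p : ℤ) (q : ℕ), 0 < q ∧ P.root c = (p : ℝ) • P.root i + (q : ℝ) • P.root j
  · obtain ⟨p, q, hq, h⟩ := h
    refine Or.inr ⟨p, q, hq, h, ?_⟩
    have : w.stringFamily i j k l c ≤ w.signedGroup p c (p • k + q • l) := by
      refine iSup_le fun p' => iSup_le fun q' => iSup_le fun h' => ?_
      obtain ⟨h1, h2⟩ := coeff_unique hij (h'.2.symm.trans h)
      have h1 : p' = p := by exact_mod_cast h1
      have h2 : q' = q := by exact_mod_cast h2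
      subst h1 h2
      exact le_rfl
    exact this hg
  · left
    have : w.stringFamily i j k l c ≤ ⊥ :=
      iSup_le fun p => iSup_le fun q => iSup_le fun h' => absurd ⟨p, q, h'⟩ h
    exact this hg

omit [IsOrderedAddMonoid R] in
theorem subgroupGE_le_signedGroup {p : ℤ} {c : ι} {l l' : R} (h : l ≤ l')
    (h' : p ≤ 0 → l < l') : w.subgroupGE c l' ≤ w.signedGroup p c l := by
  intro g hg
  unfold signedGroup
  split_ifs with hp
  · exact ⟨hg.1, le_trans (WithTop.coe_le_coe.2 h) hg.2⟩
  · exact ⟨hg.1, lt_of_lt_of_le (WithTop.coe_lt_coe.2 (h' (not_lt.1 hp))) hg.2⟩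

omit [IsOrderedAddMonoid R] in
theorem le_of_mem_signedGroup {p : ℤ} {c : ι} {l l' : R} {g : G} (hg : g ∈ w.signedGroup p c l)
    (h : w.φ c g = l') : l ≤ l' ∧ (p ≤ 0 → l < l') := by
  unfold signedGroup at hg
  split_ifs at hg with hp
  · have := hg.2
    rw [h, WithTop.coe_le_coe] at this
    exact ⟨this, fun h => absurd hp (not_lt.2 h)⟩
  · have := hg.2
    rw [h, WithTop.coe_lt_coe] at this
    exact ⟨this.le, fun _ => this⟩

theorem nsmul_add_nsmul_le {a b a' b' : R} (r s : ℕ) (ha : a ≤ a') (hb : b ≤ b') :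
    r • a + s • b ≤ r • a' + s • b' :=
  add_le_add (nsmul_le_nsmul_right ha r) (nsmul_le_nsmul_right hb s)

theorem nsmul_add_nsmul_lt_left {a b a' b' : R} {r : ℕ} (s : ℕ) (hr : 0 < r) (ha : a < a')
    (hb : b ≤ b') : r • a + s • b < r • a' + s • b' :=
  add_lt_add_of_lt_of_le (nsmul_lt_nsmul_right hr.ne' ha) (nsmul_le_nsmul_right hb s)

theorem nsmul_add_nsmul_lt_right {a b a' b' : R} (r : ℕ) {s : ℕ} (hs : 0 < s) (ha : a ≤ a')
    (hb : b < b') : r • a + s • b < r • a' + s • b' :=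
  add_lt_add_of_le_of_lt (nsmul_le_nsmul_right ha r) (nsmul_lt_nsmul_right hs.ne' hb)

/-- The strict inequality required when `r p + s p' ≤ 0` is available, because then `p ≤ 0` or `p' ≤
0`. -/
theorem isCommClosed_stringFamily {i j : ι} (hij : ∀ c : ℝ, P.root j ≠ c • P.root i) (k l : R) :
    IsCommClosed P U (w.stringFamily i j k l) where
  le := w.stringFamily_le i j k l
  commutator_mem c d hcd x hx y hy := by
    rcases w.mem_stringFamily hij hx with rfl | ⟨p, q, hq, hc, hx'⟩
    · simp [one_mem]
    rcases w.mem_stringFamily hij hy with rfl | ⟨p', q', hq', hd, hy'⟩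
    · simp [one_mem]
    refine w.commutator_mem_iSup _ hcd (w.stringFamily_le _ _ _ _ _ hx)
      (w.stringFamily_le _ _ _ _ _ hy) fun a b ha hb m r s hr hs hm => ?_
    obtain ⟨h1, h1'⟩ := w.le_of_mem_signedGroup hx' ha
    obtain ⟨h2, h2'⟩ := w.le_of_mem_signedGroup hy' hb
    have e : (r * p + s * p' : ℤ) • k + (r * q + s * q' : ℕ) • l =
        r • (p • k + q • l) + s • (p' • k + q' • l) := by
      module
    refine le_trans ?_ (w.signedGroup_le_stringFamily k l (p := r * p + s * p')
      (q := r * q + s * q') (by positivity) ?_)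
    · rw [e]
      refine w.subgroupGE_le_signedGroup (nsmul_add_nsmul_le r s h1 h2) fun h => ?_
      by_cases hp : p ≤ 0
      · exact nsmul_add_nsmul_lt_left s hr (h1' hp) h2
      · refine nsmul_add_nsmul_lt_right r hs h1 (h2' ?_)
        by_contra hp'
        have := mul_pos (Int.natCast_pos.2 hr) (not_le.1 hp)
        have := mul_pos (Int.natCast_pos.2 hs) (not_le.1 hp')
        linarith
    · rw [hm, hc, hd]; push_cast; module

/-- Strictness is assumed only for `p < 0`, since `r + s p ≤ 0` with `r > 0` forces `p < 0`. So `y`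
may be taken in `U_{β,l}` itself (`p = 0`, `q = 1`), which the family does not contain. -/
theorem commutator_mem_stringFamily {i j : ι} (hij : ∀ c : ℝ, P.root j ≠ c • P.root i) {k l : R}
    {g y : G} (hg : g ∈ w.subgroupGE i k) {c : ι} {p : ℤ} {q : ℕ} (hq : 0 < q)
    (hc : P.root c = (p : ℝ) • P.root i + (q : ℝ) • P.root j) (hy : y ∈ U c)
    (h : ∀ b : R, w.φ c y = b → p • k + q • l ≤ b ∧ (p < 0 → p • k + q • l < b)) :
    g * y * g⁻¹ * y⁻¹ ∈ ⨆ c, w.stringFamily i j k l c := by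
  have hic : ∀ e : ℝ, e ≤ 0 → P.root c ≠ e • P.root i := by
    intro e _ h
    have := (coeff_unique hij (a := p) (b := q) (a' := e) (b' := 0) (by rw [← hc, h]; simp)).2
    have : q = 0 := by exact_mod_cast this
    omega
  have := w.commutator_mem_iSup (w.stringFamily i j k l) hic hg.1 hy
    fun a b ha hb m r s hr hs hm => by
      have h1 := hg.2
      rw [ha, WithTop.coe_le_coe] at h1
      obtain ⟨h2, h2'⟩ := h b hb
      have e : (r + s * p : ℤ) • k + (s * q : ℕ) • l = r • k + s • (p • k + q • l) := by
        module
      refine le_trans ?_ (w.signedGroup_le_stringFamily k l (p := r + s * p) (q := s * q)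
        (by positivity) ?_)
      · rw [e]
        refine w.subgroupGE_le_signedGroup (nsmul_add_nsmul_le r s h1 h2) fun h => ?_
        refine nsmul_add_nsmul_lt_right r hs h1 (h2' ?_)
        by_contra hp'
        have := mul_nonneg (Int.natCast_nonneg s) (not_lt.1 hp')
        omega
      · rw [hm, hc]; push_cast; module
  exact (iSup₂_le fun m _ => le_iSup (w.stringFamily i j k l) m) this

/-- Here the strict inequality always comes from `g`. -/
theorem commutator_mem_stringFamily_negIdx {i j : ι}
    (hij : ∀ c : ℝ, P.root j ≠ c • P.root i) {k l : R}
    {g y : G} (hg : g ∈ w.subgroupGT (negIdx P i) (-k)) {c : ι} {p : ℤ} {q : ℕ} (hq : 0 < q)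
    (hc : P.root c = (p : ℝ) • P.root i + (q : ℝ) • P.root j) (hy : y ∈ U c)
    (h : ∀ b : R, w.φ c y = b → p • k + q • l ≤ b) :
    g * y * g⁻¹ * y⁻¹ ∈ ⨆ c, w.stringFamily i j k l c := by
  have hic : ∀ e : ℝ, e ≤ 0 → P.root c ≠ e • P.root (negIdx P i) := by
    intro e _ h
    have := (coeff_unique hij (a := p) (b := q) (a' := -e) (b' := 0)
      (by rw [← hc, h, root_negIdx]; simp)).2
    have : q = 0 := by exact_mod_cast this
    omega
  have := w.commutator_mem_iSup (w.stringFamily i j k l) hic hg.1 hy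
    fun a b ha hb m r s hr hs hm => by
      have h1 := hg.2
      rw [ha, WithTop.coe_lt_coe] at h1
      have e : (-r + s * p : ℤ) • k + (s * q : ℕ) • l = r • (-k) + s • (p • k + q • l) := by
        module
      refine le_trans ?_ (w.signedGroup_le_stringFamily k l (p := -r + s * p) (q := s * q)
        (by positivity) ?_)
      · have hlt := nsmul_add_nsmul_lt_left s hr h1 (h b hb)
        rw [e]
        exact w.subgroupGE_le_signedGroup hlt.le fun _ => hlt
      · rw [hm, hc, root_negIdx]; push_cast; module
  exact (iSup₂_le fun m _ => le_iSup (w.stringFamily i j k l) m) this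

omit [IsOrderedAddMonoid R] in
theorem φ_of_double {i j : ι} (h : P.root j = (2 : ℝ) • P.root i) {g : G} (hg : g ∈ U j) {k : R}
    (hk : w.φ i g = k) : w.φ j g = ((k + k : R) : WithTop R) := by
  rw [w.double_eq i j h g hg, hk]
  rfl

/-- The group generated by the string family is normalized by both generating subgroups and contains
the commutators of their elements with `u`; hence it contains the commutators of all products. -/
theorem commutator_mem_iSup_stringFamily {i j : ι} (hij : ∀ c : ℝ, P.root j ≠ c • P.root i)
    {k l : R} {g u : G} (hg : g ∈ w.subgroupGE i k ⊔ w.subgroupGT (negIdx P i) (-k))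
    (hu : u ∈ w.subgroupGE j l) : g * u * g⁻¹ * u⁻¹ ∈ ⨆ c, w.stringFamily i j k l c := by
  set H := ⨆ c, w.stringFamily i j k l c with hH
  have hsub : ∀ c, w.stringFamily i j k l c ≤ H := le_iSup _
  have hconj : ∀ {K : Subgroup G}, (∀ g ∈ K, ∀ c, ∀ y ∈ w.stringFamily i j k l c,
      g * y * g⁻¹ * y⁻¹ ∈ H) → K ≤ Subgroup.normalizer (H : Set G) := by
    intro K hK
    refine le_normalizer_of_forall_conj_mem fun x hx g hg => ?_
    have hle : H ≤ H.comap (MulAut.conj x).toMonoidHom := by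
      refine iSup_le fun c y hy => ?_
      have h1 : x * y * x⁻¹ = x * y * x⁻¹ * y⁻¹ * y := by group
      change x * y * x⁻¹ ∈ H
      rw [h1]
      exact H.mul_mem (hK x hx c y hy) (hsub c hy)
    exact hle hg
  have hnorm : w.subgroupGE i k ⊔ w.subgroupGT (negIdx P i) (-k) ≤
      Subgroup.normalizer (H : Set G) := by
    refine sup_le (hconj fun g hg c y hy => ?_) (hconj fun g hg c y hy => ?_)
    · rcases w.mem_stringFamily hij hy with rfl | ⟨p, q, hq, hc, hy'⟩
      · simp [one_mem]
      refine w.commutator_mem_stringFamily hij hg hq hc (w.stringFamily_le _ _ _ _ _ hy)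
        fun b hb => ?_
      obtain ⟨h1, h2⟩ := w.le_of_mem_signedGroup hy' hb
      exact ⟨h1, fun h => h2 h.le⟩
    · rcases w.mem_stringFamily hij hy with rfl | ⟨p, q, hq, hc, hy'⟩
      · simp [one_mem]
      exact w.commutator_mem_stringFamily_negIdx hij hg hq hc (w.stringFamily_le _ _ _ _ _ hy)
        fun b hb => (w.le_of_mem_signedGroup hy' hb).1
  have hj : P.root j = ((0 : ℤ) : ℝ) • P.root i + ((1 : ℕ) : ℝ) • P.root j := by simp
  have hul : ∀ b : R, w.φ j u = b → (0 : ℤ) • k + (1 : ℕ) • l ≤ b := fun b hb => by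
    have h2 := hu.2
    rw [hb, WithTop.coe_le_coe] at h2
    simpa using h2
  rw [Subgroup.sup_eq_closure] at hg
  induction hg using Subgroup.closure_induction with
  | mem g hg =>
    rcases hg with hg | hg
    · exact w.commutator_mem_stringFamily hij hg one_pos hj hu.1
        fun b hb => ⟨hul b hb, fun h => absurd h (lt_irrefl _)⟩
    · exact w.commutator_mem_stringFamily_negIdx hij hg one_pos hj hu.1 hul
  | one => simp [one_mem]
  | mul a b ha hb iha ihb =>
    rw [← Subgroup.sup_eq_closure] at ha hb
    have e : a * b * u * (a * b)⁻¹ * u⁻¹ =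
      a * (b * u * b⁻¹ * u⁻¹) * a⁻¹ * (a * u * a⁻¹ * u⁻¹) := by group
    rw [e]
    exact H.mul_mem (conj_mem_of_le_normalizer hnorm ha ihb) iha
  | inv a ha iha =>
    rw [← Subgroup.sup_eq_closure] at ha
    have e : a⁻¹ * u * a⁻¹⁻¹ * u⁻¹ = a⁻¹ * (a * u * a⁻¹ * u⁻¹)⁻¹ * a⁻¹⁻¹ := by group
    rw [e]
    exact conj_mem_of_le_normalizer hnorm (Subgroup.inv_mem _ ha) (H.inv_mem iha)

include hd in
/-- An element of the group generated by `U_{α,k}` and `U'_{-α,-k}` which normalizes `U_β` acts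
trivially on `U_{β,l} / U'_{β,l}`, if `β` is not proportional to `α`. -/
theorem commutator_mem_subgroupGT [Finite ι] [P.IsCrystallographic] {i j : ι}
    (hij : ∀ c : ℝ, P.root j ≠ c • P.root i)
    {k l : R} {g u : G} (hg : g ∈ w.subgroupGE i k ⊔ w.subgroupGT (negIdx P i) (-k))
    (hu : u ∈ w.subgroupGE j l) (hgu : g * u * g⁻¹ ∈ U j) :
    g * u * g⁻¹ * u⁻¹ ∈ w.subgroupGT j l := by
  have h1 := w.commutator_mem_iSup_stringFamily hij hg hu
  -- On a vector where `α` vanishes and `β` is positive, all roots `pα + qβ` with `q > 0` are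
  -- positive. A nearby regular vector provides one system of positive roots containing the whole
  -- string.
  obtain ⟨v₀, hi, hj⟩ := exists_root'_eq_zero_pos hij
  obtain ⟨v, hv, hvv⟩ := exists_isRegular_near (P := P) v₀
  have h2 : (⨆ c, w.stringFamily i j k l c) ≤ chamberGroup P (w.stringFamily i j k l) v := by
    refine iSup_le fun c x hx => ?_
    rcases w.mem_stringFamily hij hx with rfl | ⟨p, q, hq, hc, hx'⟩
    · exact one_mem _
    · refine mem_chamberGroup (hvv c ?_) hx
      have : P.root' c v₀ = p * P.root' i v₀ + q * P.root' j v₀ := by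
        simp [RootPairing.root', hc]
      rw [this, hi, mul_zero, zero_add]
      exact mul_pos (Nat.cast_pos.2 hq) hj
  have h3 := hd.mem_rayGroup_of_mem_chamberGroup (w.isCommClosed_stringFamily hij k l) hv
    (hvv j hj) (h2 h1) ((U j).mul_mem hgu ((U j).inv_mem hu.1))
  refine (iSup₂_le fun c hc x hx => ?_ : rayGroup P (w.stringFamily i j k l) j ≤ _) h3
  rcases w.mem_stringFamily hij hx with rfl | ⟨p, q, hq, hpq, hx'⟩
  · exact one_mem _
  -- The only string roots on the ray of `β` are `β` and `2β`; `β/2` would need `2q = 1`. Since `p =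
  -- 0`, their groups in the family are the strict ones.
  have hcase : c = j ∧ p = 0 ∧ q = 1 ∨ P.root c = (2 : ℝ) • P.root j ∧ p = 0 ∧ q = 2 := by
    rcases hc.cases with rfl | h | h
    · have := coeff_unique hij (a := p) (b := q) (a' := 0) (b' := 1) (by rw [← hpq]; simp)
      exact Or.inl ⟨rfl, by exact_mod_cast this.1, by exact_mod_cast this.2⟩
    · have := coeff_unique hij (a := p) (b := q) (a' := 0) (b' := 2) (by rw [← hpq, h]; simp)
      exact Or.inr ⟨h, by exact_mod_cast this.1, by exact_mod_cast this.2⟩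
    · have := coeff_unique hij (a := 0) (b := 1) (a' := 2 * p) (b' := 2 * q) (by
        rw [mul_smul, mul_smul, ← smul_add, ← hpq, ← h]; simp)
      have h2 : (1 : ℕ) = 2 * q := by exact_mod_cast this.2
      omega
  unfold signedGroup at hx'
  rcases hcase with ⟨rfl, rfl, rfl⟩ | ⟨hcj, rfl, rfl⟩
  · simpa using hx'
  · have hxj := hd.double_le hcj hx'.1
    refine ⟨hxj, ?_⟩
    by_cases hx1 : x = 1
    · rw [hx1, w.φ_one]; exact WithTop.coe_lt_top l
    obtain ⟨b, hb⟩ := w.exists_φ_eq hxj hx1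
    have h4 := hx'.2
    rw [w.φ_of_double hcj hx'.1 hb, WithTop.coe_lt_coe] at h4
    rw [hb, WithTop.coe_lt_coe]
    by_contra! h5
    have := add_le_add h5 h5
    simp only [zero_smul, zero_add, two_nsmul] at h4
    exact absurd h4 (not_lt.2 this)

end RValuation

end LocalRootDatum

namespace LocalRootDatum

namespace RValuation

/-! ### Groups of rank one -/

section RankOne

variable {ι E V G R A : Type*} [Finite ι] [AddCommGroup E] [Module ℝ E] [AddCommGroup V]
  [Module ℝ V] [Group G] [AddCommGroup R] [LinearOrder R] [IsOrderedAddMonoid R]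
  {P : RootPairing ι ℝ E V} [P.IsCrystallographic] {T : Subgroup G} {U : ι → Subgroup G}
  {M : ι → Set G} (w : RValuation P U M R)

/-- The elements of the torus that preserve the valuations. -/
noncomputable def fixedTorus (T : Subgroup G) : Subgroup G :=
  T ⊓ ⨅ (j) (l : R), Subgroup.normalizer (w.subgroupGE j l : Set G)

omit [Finite ι] [IsOrderedAddMonoid R] [P.IsCrystallographic] in
theorem mem_fixedTorus_iff {t : G} : t ∈ w.fixedTorus T ↔ t ∈ T ∧ ∀ (j : ι) (l : R) (g : G),
    g ∈ w.subgroupGE j l ↔ t * g * t⁻¹ ∈ w.subgroupGE j l := by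
  rw [fixedTorus, Subgroup.mem_inf]
  simp only [Subgroup.mem_iInf, Subgroup.mem_normalizer_iff]

omit [Finite ι] [IsOrderedAddMonoid R] [P.IsCrystallographic] in
theorem fixedTorus_le : w.fixedTorus T ≤ T := inf_le_left

omit [Finite ι] [IsOrderedAddMonoid R] [P.IsCrystallographic] in
theorem φ_le_of_mem_fixedTorus {t : G} (ht : t ∈ w.fixedTorus T) {j : ι} {u : G} (hu : u ∈ U j) :
    t * u * t⁻¹ ∈ U j ∧ w.φ j u ≤ w.φ j (t * u * t⁻¹) := by
  by_cases hu1 : u = 1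
  · simp [hu1, one_mem]
  obtain ⟨k, hk⟩ := w.exists_φ_eq hu hu1
  have := ((w.mem_fixedTorus_iff.1 ht).2 j k u).1 ⟨hu, hk.ge⟩
  exact ⟨this.1, hk ▸ this.2⟩

omit [Finite ι] [IsOrderedAddMonoid R] [P.IsCrystallographic] in
theorem mem_fixedTorus (hd : IsRootGroupDatum P T U M) {t : G} (ht : t ∈ T)
    (h : ∀ j, ∀ u ∈ U j, w.φ j u ≤ w.φ j (t * u * t⁻¹))
    (h' : ∀ j, ∀ u ∈ U j, w.φ j u ≤ w.φ j (t⁻¹ * u * t)) : t ∈ w.fixedTorus T := by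
  refine w.mem_fixedTorus_iff.2 ⟨ht, ?_⟩
  refine fun j l g => ⟨fun hg => ⟨hd.torus_conj_mem ht hg.1, hg.2.trans (h j g hg.1)⟩,
    fun hg => ⟨(hd.torus_conj_mem_iff ht).1 hg.1, hg.2.trans ?_⟩⟩
  have := h' j _ hg.1
  simpa [mul_assoc] using this

/-- The subgroup `A` of `U_α` is an upper set for the valuation. -/
structure IsUpper (i : ι) (A : Subgroup G) : Prop where
  le : A ≤ U i
  mem : ∀ a ∈ A, ∀ a' ∈ U i, w.φ i a ≤ w.φ i a' → a' ∈ A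

/-- The sum of the values of nontrivial elements of `A` and `B` is positive. -/
def SumPos (i : ι) (A B : Subgroup G) : Prop :=
  ∀ a ∈ A, ∀ b ∈ B, ∀ k l : R, w.φ i a = k → w.φ (negIdx P i) b = l → 0 < k + l

omit [Finite ι] [IsOrderedAddMonoid R] [P.IsCrystallographic] in
theorem isUpper_subgroupGE (i : ι) (l : R) : w.IsUpper i (w.subgroupGE i l) :=
  ⟨fun _ h => h.1, fun _ h _ ha h' => ⟨ha, h.2.trans h'⟩⟩

omit [Finite ι] [IsOrderedAddMonoid R] [P.IsCrystallographic] in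
theorem isUpper_subgroupGT (i : ι) (l : R) : w.IsUpper i (w.subgroupGT i l) :=
  ⟨fun _ h => h.1, fun _ h _ ha h' => ⟨ha, h.2.trans_le h'⟩⟩

omit [Finite ι] [IsOrderedAddMonoid R] [P.IsCrystallographic] in
theorem IsUpper.conj_mem {w : RValuation P U M R} {i : ι} {A : Subgroup G} (hA : w.IsUpper i A)
    {t : G} (ht : t ∈ w.fixedTorus T) {a : G} (ha : a ∈ A) : t * a * t⁻¹ ∈ A :=
  hA.mem a ha _ (w.φ_le_of_mem_fixedTorus ht (hA.le ha)).1
    (w.φ_le_of_mem_fixedTorus ht (hA.le ha)).2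

omit [Finite ι] [P.IsCrystallographic] in
theorem sumPos_subgroupGE_subgroupGT (i : ι) (k : R) :
    w.SumPos i (w.subgroupGE i k) (w.subgroupGT (negIdx P i) (-k)) := by
  intro a ha b hb k' l' hk hl
  have h1 := ha.2
  have h2 := hb.2
  rw [hk, WithTop.coe_le_coe] at h1
  rw [hl, WithTop.coe_lt_coe] at h2
  simpa using add_lt_add_of_le_of_lt h1 h2

omit [Finite ι] [P.IsCrystallographic] in
theorem sumPos_subgroupGT_subgroupGE (i : ι) (k : R) :
    w.SumPos i (w.subgroupGT i k) (w.subgroupGE (negIdx P i) (-k)) := by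
  intro a ha b hb k' l' hk hl
  have h1 := ha.2
  have h2 := hb.2
  rw [hk, WithTop.coe_lt_coe] at h1
  rw [hl, WithTop.coe_le_coe] at h2
  simpa using add_lt_add_of_lt_of_le h1 h2

variable (hd : IsRootGroupDatum P T U M) [AddTorsor (VR P R) A] {o : A}
  {ν : groupN M →* affGroup P R A} (hν : IsCompatibleAction w o ν)
include hd hν

/-- The product of two elements of `M_{α,l}` preserves the valuations for the roots proportional
to `α`. -/
theorem φ_mul_conj_eq {i j : ι} {c : ℝ} (hij : P.root j = c • P.root i) {l : R} {m n : G}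
    (hm : m ∈ w.valuedCoset i l) (hn : n ∈ w.valuedCoset i l) {u : G} (hu : u ∈ U j) :
    w.φ j (m * n * u * (m * n)⁻¹) = w.φ j u := by
  obtain ⟨y, hy, hyl⟩ := w.exists_shift hd hν hm.1
  obtain ⟨z, hz, hzl⟩ := w.exists_shift hd hν hn.1
  have hr : P.reflectionPerm i j = negIdx P j := by
    apply P.root.injective
    rw [RootPairing.root_reflectionPerm, root_negIdx, hij, map_smul,
      RootPairing.reflection_apply_self, smul_neg]
  have hu' := hd.conj_mem hn.1 hu
  have h1 := hz j u hu
  have h2 := hy _ _ hu'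
  rw [P.reflectionPerm_self] at h2
  have e : m * n * u * (m * n)⁻¹ = m * (n * u * n⁻¹) * m⁻¹ := by group
  have hdbl : ∀ x : VR P R, P.pairingIn ℤ j i • rootEval P i x =
      rootEval P j x + rootEval P j x := fun x => by
    have h3 := rootEval_reflectionPerm i j x
    rw [hr, rootEval_negIdx] at h3
    rw [eq_sub_iff_add_eq, neg_add_eq_iff_eq_add] at h3
    exact h3
  have hyz : rootEval P j z = rootEval P j y := by
    have h3 := hdbl y
    have h4 := hdbl z
    rw [hyl l hm] at h3
    rw [hzl l hn, h3] at h4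
    rcases lt_trichotomy (rootEval P j z) (rootEval P j y) with h | h | h
    · exact absurd h4 (add_lt_add h h).ne'
    · exact h
    · exact absurd h4 (add_lt_add h h).ne
  rw [e, h2, h1, hr, rootEval_negIdx, hyz, add_assoc, ← WithTop.coe_add, add_neg_cancel]
  simp

/-- Write `v = a m b`, with `b ∈ U_α` of value `-l < k`. Then `b u` also has value `-l`, so `b u = x
n y` with `n` in the same `M_{α,-l}` as `m`. Hence `v u = a (m x m⁻¹) (m n) y`, and the shifts of
`m` and `n` cancel in `t = m n`. The value of `u'` is not yet determined. -/
theorem exists_mul_eq_aux {i : ι} {u v : G} (hu : u ∈ U i) (hv : v ∈ U (negIdx P i)) {k l : R}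
    (hk : w.φ i u = k) (hl : w.φ (negIdx P i) v = l) (hkl : 0 < k + l) :
    ∃ u' ∈ U i, ∃ t ∈ T, ∃ v' ∈ U (negIdx P i), v * u = u' * t * v' ∧
      w.φ (negIdx P i) v' = l ∧ ∀ (j : ι) (c : ℝ), P.root j = c • P.root i →
        ∀ x ∈ U j, w.φ j (t * x * t⁻¹) = w.φ j x := by
  obtain ⟨a, m, b, ha, hb, -, hbl, hm, rfl⟩ := w.exists_valuedCoset hd hv hl
  rw [negIdx_negIdx] at ha hb hbl
  have hm' : m ∈ w.valuedCoset i (-l) := by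
    rw [← w.valuedCoset_negIdx hd, neg_neg]; exact hm
  have hbu : w.φ i (b * u) = ((-l : R) : WithTop R) := by
    rw [w.φ_mul_of_lt hb hu, hbl]
    rw [hbl, hk, WithTop.coe_lt_coe]
    exact neg_lt_iff_pos_add.2 hkl
  obtain ⟨x, n, y, hx, hy, -, hyl, hn, hxy⟩ := w.exists_valuedCoset hd ((U i).mul_mem hb hu) hbu
  rw [neg_neg] at hyl
  refine ⟨a * (m * x * m⁻¹), (U i).mul_mem ha (((hd.swaps hm'.1).mem_iff' x).2 hx), m * n,
    hd.mul_mem_torus hm'.1 hn.1, y, hy, ?_, hyl, fun j c hj x hx =>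
      w.φ_mul_conj_eq hd hν hj hm' hn hx⟩
  calc a * m * b * u = a * m * (b * u) := by group
    _ = a * m * (x * n * y) := by rw [hxy]
    _ = _ := by group

/-- The commutation rule for elements of `U_α` and `U_{-α}` whose values have a positive sum. -/
theorem exists_mul_eq {i : ι} {u v : G} (hu : u ∈ U i) (hv : v ∈ U (negIdx P i)) {k l : R}
    (hk : w.φ i u = k) (hl : w.φ (negIdx P i) v = l) (hkl : 0 < k + l) :
    ∃ u' ∈ U i, ∃ t ∈ w.fixedTorus T, ∃ v' ∈ U (negIdx P i), v * u = u' * t * v' ∧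
      w.φ i u' = k ∧ w.φ (negIdx P i) v' = l := by
  obtain ⟨u₁, hu₁, t, ht, v₁, hv₁, h1, hv₁l, hprop⟩ := w.exists_mul_eq_aux hd hν hu hv hk hl hkl
  -- Interchanging `u⁻¹` and `v⁻¹` gives a second decomposition of `v u`, in which the value of the
  -- factor in `U_α` is known. Uniqueness identifies the two.
  obtain ⟨v₂, hv₂, t₂, ht₂, u₂, hu₂, h2, hu₂k, -⟩ := w.exists_mul_eq_aux hd hν (i := negIdx P i)
    (u := v⁻¹) (v := u⁻¹) (k := l) (l := k) ((U _).inv_mem hv)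
    (by rw [negIdx_negIdx]; exact (U i).inv_mem hu) (by rw [w.φ_inv hv, hl])
    (by rw [negIdx_negIdx, w.φ_inv hu, hk]) (by rwa [add_comm])
  rw [negIdx_negIdx] at hu₂ hu₂k
  have h3 : u₁ * t * v₁ = u₂⁻¹ * t₂⁻¹ * v₂⁻¹ := by
    rw [← h1]
    calc v * u = (u⁻¹ * v⁻¹)⁻¹ := by group
      _ = _ := by rw [h2]; group
  have h4 := (hd.eq_of_mul_mul_eq hu₁ ((U i).inv_mem hu₂) ht (T.inv_mem ht₂) hv₁
    ((U _).inv_mem hv₂) h3).1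
  have hu₁k : w.φ i u₁ = k := by rw [h4, w.φ_inv hu₂, hu₂k]
  have hlk : -k < l := neg_lt_iff_pos_add.2 (by rwa [add_comm])
  -- This makes `commutator_mem_subgroupGT` applicable to `t` for the roots not proportional to `α`;
  -- the proportional ones are covered by `hprop`.
  have hmem : t ∈ w.subgroupGE i k ⊔ w.subgroupGT (negIdx P i) (-k) := by
    have e : t = u₁⁻¹ * (v * u) * v₁⁻¹ := by rw [h1]; group
    rw [e]
    have hi : ∀ x ∈ U i, w.φ i x = k →
        x ∈ w.subgroupGE i k ⊔ w.subgroupGT (negIdx P i) (-k) := fun x hx hxk =>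
      Subgroup.mem_sup_left ⟨hx, hxk.ge⟩
    have hj : ∀ x ∈ U (negIdx P i), w.φ (negIdx P i) x = l →
        x ∈ w.subgroupGE i k ⊔ w.subgroupGT (negIdx P i) (-k) := fun x hx hxl =>
      Subgroup.mem_sup_right ⟨hx, by rw [hxl]; exact WithTop.coe_lt_coe.2 hlk⟩
    exact mul_mem (mul_mem (inv_mem (hi _ hu₁ hu₁k)) (mul_mem (hj _ hv hl) (hi _ hu hk)))
      (inv_mem (hj _ hv₁ hv₁l))
  have key : ∀ s ∈ T, s ∈ w.subgroupGE i k ⊔ w.subgroupGT (negIdx P i) (-k) → ∀ j,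
      (∀ c : ℝ, P.root j ≠ c • P.root i) → ∀ x ∈ U j, w.φ j x ≤ w.φ j (s * x * s⁻¹) := by
    intro s hs hsL j hj x hx
    by_cases hx1 : x = 1
    · simp [hx1]
    obtain ⟨b, hb⟩ := w.exists_φ_eq hx hx1
    have h5 := w.commutator_mem_subgroupGT hd hj hsL (l := b) ⟨hx, hb.ge⟩
      (hd.torus_conj_mem hs hx)
    have e : s * x * s⁻¹ = s * x * s⁻¹ * x⁻¹ * x := by group
    rw [e, hb]
    exact w.le_φ_mul h5.1 hx h5.2.le hb.ge
  refine ⟨u₁, hu₁, t, w.mem_fixedTorus hd ht (fun j x hx => ?_) (fun j x hx => ?_), v₁, hv₁, h1,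
    hu₁k, hv₁l⟩
  · by_cases hj : ∀ c : ℝ, P.root j ≠ c • P.root i
    · exact key t ht hmem j hj x hx
    · push Not at hj
      obtain ⟨c, hc⟩ := hj
      exact (hprop j c hc x hx).ge
  · by_cases hj : ∀ c : ℝ, P.root j ≠ c • P.root i
    · have := key t⁻¹ (T.inv_mem ht) (inv_mem hmem) j hj x hx
      rwa [inv_inv] at this
    · push Not at hj
      obtain ⟨c, hc⟩ := hj
      have h6 := hd.torus_conj_mem (T.inv_mem ht) hx
      rw [inv_inv] at h6
      have := hprop j c hc _ h6
      have e : t * (t⁻¹ * x * t) * t⁻¹ = x := by group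
      rw [e] at this
      exact this.le

theorem exists_mul_eq_of_isUpper {i : ι} {A B : Subgroup G} (hA : w.IsUpper i A)
    (hB : w.IsUpper (negIdx P i) B) (hAB : w.SumPos i A B) {a b : G} (ha : a ∈ A) (hb : b ∈ B) :
    ∃ a' ∈ A, ∃ t ∈ w.fixedTorus T, ∃ b' ∈ B, b * a = a' * t * b' := by
  by_cases ha1 : a = 1
  · exact ⟨1, one_mem _, 1, one_mem _, b, hb, by rw [ha1]; group⟩
  by_cases hb1 : b = 1
  · exact ⟨a, ha, 1, one_mem _, 1, one_mem _, by rw [hb1]; group⟩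
  obtain ⟨k, hk⟩ := w.exists_φ_eq (hA.le ha) ha1
  obtain ⟨l, hl⟩ := w.exists_φ_eq (hB.le hb) hb1
  obtain ⟨a', ha', t, ht, b', hb', h, hk', hl'⟩ :=
    w.exists_mul_eq hd hν (hA.le ha) (hB.le hb) hk hl (hAB a ha b hb k l hk hl)
  exact ⟨a', hA.mem a ha a' ha' (by rw [hk, hk']), t, ht, b', hB.mem b hb b' hb' (by rw [hl, hl']),
    h⟩

/-- The product of `A`, the valuation-preserving torus and `B` is stable under left multiplication
by `A` and, through the interchange rule, by `B`. -/
theorem exists_eq_of_mem_sup {i : ι} {A B : Subgroup G} (hA : w.IsUpper i A)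
    (hB : w.IsUpper (negIdx P i) B) (hAB : w.SumPos i A B) {g : G} (hg : g ∈ A ⊔ B) :
    ∃ a ∈ A, ∃ t ∈ w.fixedTorus T, ∃ b ∈ B, g = a * t * b := by
  rw [Subgroup.sup_eq_closure] at hg
  have hl : ∀ x ∈ (A : Set G) ∪ B, ∀ g, (∃ a ∈ A, ∃ t ∈ w.fixedTorus T, ∃ b ∈ B, g = a * t * b) →
      ∃ a ∈ A, ∃ t ∈ w.fixedTorus T, ∃ b ∈ B, x * g = a * t * b := by
    rintro x (hx | hx) g ⟨a, ha, t, ht, b, hb, rfl⟩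
    · exact ⟨x * a, A.mul_mem hx ha, t, ht, b, hb, by group⟩
    · obtain ⟨a', ha', t', ht', b', hb', h⟩ := w.exists_mul_eq_of_isUpper hd hν hA hB hAB ha hx
      have h1 := hB.conj_mem (Subgroup.inv_mem _ ht) hb'
      refine ⟨a', ha', t' * t, Subgroup.mul_mem _ ht' ht, t⁻¹ * b' * t⁻¹⁻¹ * b,
        B.mul_mem h1 hb, ?_⟩
      calc x * (a * t * b) = x * a * t * b := by group
        _ = _ := by rw [h]; group
  induction hg using Subgroup.closure_induction_left with
  | one => exact ⟨1, one_mem _, 1, one_mem _, 1, one_mem _, by group⟩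
  | mul_left x hx y _ ih => exact hl x hx y ih
  | inv_mul_cancel x hx y _ ih =>
    refine hl x⁻¹ ?_ y ih
    rcases hx with hx | hx
    · exact Or.inl (A.inv_mem hx)
    · exact Or.inr (B.inv_mem hx)

omit hν [P.IsCrystallographic] [Finite ι] in
-- A commutator of elements with values `≥ k` and `> k` lies in `U_{2α}` and has `φ_{2α}`-value
-- above `2k`, hence `φ_α`-value above `k`.
theorem conj_mem_subgroupGT [Finite ι] [P.IsCrystallographic] {i : ι} {k : R} {x y : G}
    (hx : x ∈ w.subgroupGE i k) (hy : y ∈ w.subgroupGT i k) :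
    x * y * x⁻¹ ∈ w.subgroupGT i k := by
  have hii : ∀ c : ℝ, c ≤ 0 → P.root i ≠ c • P.root i := by
    intro c hc h
    obtain ⟨v, -, hv⟩ := exists_isRegular_pos (P := P) i
    exact not_root_eq_nonpos_smul hv hv c hc h
  have h1 := w.commutator_mem_iSup (fun _ => w.subgroupGT i k) hii hx.1 hy.1
    fun a b ha hb c r s hr hs hc g hg => by
      have h2 := hx.2
      have h3 := hy.2
      rw [ha, WithTop.coe_le_coe] at h2
      rw [hb, WithTop.coe_lt_coe] at h3
      have hc' : P.root c = ((r + s : ℕ) : ℝ) • P.root i := by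
        rw [hc]; push_cast; module
      have hrs : (1 : ℝ) < ((r + s : ℕ) : ℝ) := by exact_mod_cast (by omega : 1 < r + s)
      have hne : P.root i ≠ 0 := P.ne_zero i
      have hcoef : ∀ d : ℝ, P.root c = d • P.root i → ((r + s : ℕ) : ℝ) = d := fun d hd => by
        rw [hc', ← sub_eq_zero, ← sub_smul, smul_eq_zero] at hd
        exact sub_eq_zero.1 (hd.resolve_right hne)
      rcases SameRay.cases (P := P) ⟨_, zero_lt_one.trans hrs, hc'⟩ with rfl | h | h
      · have := hcoef 1 (by simp)
        linarith
      · have h4 := hcoef 2 h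
        have h5 : r + s = 2 := by exact_mod_cast h4
        obtain ⟨rfl, rfl⟩ : r = 1 ∧ s = 1 := by omega
        have hgi := hd.double_le h hg.1
        refine ⟨hgi, ?_⟩
        by_cases hg1 : g = 1
        · rw [hg1, w.φ_one]; exact WithTop.coe_lt_top k
        obtain ⟨e, he⟩ := w.exists_φ_eq hgi hg1
        have h6 := hg.2
        rw [w.φ_of_double h hg.1 he, WithTop.coe_le_coe, one_smul, one_smul] at h6
        rw [he, WithTop.coe_lt_coe]
        by_contra! h7
        exact absurd (h6.trans (add_le_add h7 h7)) (not_le.2 (add_lt_add_of_le_of_lt h2 h3))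
      · have := hcoef (1 / 2) (by rw [h, smul_smul]; norm_num)
        linarith
  have h2 : x * y * x⁻¹ = x * y * x⁻¹ * y⁻¹ * y := by group
  rw [h2]
  exact mul_mem ((iSup₂_le fun _ _ => le_rfl :
    (⨆ c ∈ posCombs P i i, w.subgroupGT i k) ≤ w.subgroupGT i k) h1) hy

/-- Only `φ_α(u) = k` needs an argument. Then `u = x m y` with `x, y ∈ U_{-α,-k}` and `m ∈ M_{α,k}`:
conjugation by `y` preserves `U'_{-α,-k}`, and `m` carries it to `U'_{α,k}` because it shifts by
`2k`. -/
theorem conj_mem_sup {i : ι} {k : R} {u v : G} (hu : u ∈ w.subgroupGE i k)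
    (hv : v ∈ w.subgroupGT (negIdx P i) (-k)) :
    u * v * u⁻¹ ∈ w.subgroupGT i k ⊔ w.subgroupGE (negIdx P i) (-k) := by
  have hvL : v ∈ w.subgroupGT i k ⊔ w.subgroupGE (negIdx P i) (-k) :=
    Subgroup.mem_sup_right (w.subgroupGT_le_subgroupGE _ _ hv)
  rcases hu.2.lt_or_eq with hlt | heq
  · have huL : u ∈ w.subgroupGT i k ⊔ w.subgroupGE (negIdx P i) (-k) :=
      Subgroup.mem_sup_left ⟨hu.1, hlt⟩
    exact mul_mem (mul_mem huL hvL) (inv_mem huL)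
  · obtain ⟨x, m, y, hx, hy, hxk, hyk, hm, rfl⟩ := w.exists_valuedCoset hd hu.1 heq.symm
    have h1 := w.conj_mem_subgroupGT hd (x := y) ⟨hy, hyk.ge⟩ hv
    obtain ⟨z, hz, hzl⟩ := w.exists_shift hd hν hm.1
    have h2 : m * (y * v * y⁻¹) * m⁻¹ ∈ w.subgroupGT i k := by
      refine ⟨((hd.swaps hm.1).mem_iff' _).2 h1.1, ?_⟩
      have h3 := hz _ _ h1.1
      rw [reflectionPerm_negIdx, show P.reflectionPerm i i = negIdx P i from rfl,
        negIdx_negIdx, rootEval_negIdx, hzl k hm, neg_neg] at h3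
      rw [h3]
      by_cases hone : y * v * y⁻¹ = 1
      · rw [hone, w.φ_one, WithTop.top_add]; exact WithTop.coe_lt_top k
      obtain ⟨b, hb⟩ := w.exists_φ_eq h1.1 hone
      have h4 := h1.2
      rw [hb, WithTop.coe_lt_coe] at h4
      rw [hb, ← WithTop.coe_add, WithTop.coe_lt_coe]
      have := add_lt_add_of_lt_of_le h4 (le_refl (k + k))
      simpa using this
    have hxL : x ∈ w.subgroupGT i k ⊔ w.subgroupGE (negIdx P i) (-k) :=
      Subgroup.mem_sup_right ⟨hx, hxk.ge⟩
    have e : x * m * y * v * (x * m * y)⁻¹ = x * (m * (y * v * y⁻¹) * m⁻¹) * x⁻¹ := by group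
    rw [e]
    exact mul_mem (mul_mem hxL (Subgroup.mem_sup_left h2)) (inv_mem hxL)

theorem exists_eq_of_mem_subgroupGE_sup {i : ι} {k : R} {g : G}
    (hg : g ∈ w.subgroupGE i k ⊔ w.subgroupGT (negIdx P i) (-k)) :
    ∃ a ∈ w.subgroupGE i k, ∃ t ∈ w.fixedTorus T, ∃ b ∈ w.subgroupGT (negIdx P i) (-k),
      g = a * t * b :=
  w.exists_eq_of_mem_sup hd hν (w.isUpper_subgroupGE _ _) (w.isUpper_subgroupGT _ _)
    (w.sumPos_subgroupGE_subgroupGT i k) hg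

theorem exists_eq_of_mem_subgroupGT_sup {i : ι} {k : R} {g : G}
    (hg : g ∈ w.subgroupGT i k ⊔ w.subgroupGE (negIdx P i) (-k)) :
    ∃ a ∈ w.subgroupGT i k, ∃ t ∈ w.fixedTorus T, ∃ b ∈ w.subgroupGE (negIdx P i) (-k),
      g = a * t * b :=
  w.exists_eq_of_mem_sup hd hν (w.isUpper_subgroupGT _ _) (w.isUpper_subgroupGE _ _)
    (w.sumPos_subgroupGT_subgroupGE i k) hg

theorem mem_fixedTorus_of_mem_sup {i : ι} {k : R} {t : G} (ht : t ∈ T)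
    (h : t ∈ w.subgroupGE i k ⊔ w.subgroupGT (negIdx P i) (-k)) : t ∈ w.fixedTorus T := by
  obtain ⟨a, ha, s, hs, b, hb, e⟩ := w.exists_eq_of_mem_subgroupGE_sup hd hν h
  have := (hd.eq_of_mul_mul_eq (a := 1) (b := 1) (t := t) (one_mem _) ha.1 ht
    (w.fixedTorus_le hs) (one_mem _) hb.1 (by rw [← e]; group)).2.1
  rwa [this]

/-- Conjugates of `U'_{-α,-k}` by elements of `U_{α,k}`. -/
theorem exists_conj_eq {i : ι} {k : R} {u v : G} (hu : u ∈ w.subgroupGE i k)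
    (hv : v ∈ w.subgroupGT (negIdx P i) (-k)) :
    ∃ z ∈ w.subgroupGT i k, ∃ t ∈ T ⊓ (w.subgroupGE i k ⊔ w.subgroupGT (negIdx P i) (-k)),
      ∃ b ∈ w.subgroupGT (negIdx P i) (-k), u * v * u⁻¹ = z * t * b := by
  have huL : u ∈ w.subgroupGE i k ⊔ w.subgroupGT (negIdx P i) (-k) := Subgroup.mem_sup_left hu
  have hvL : v ∈ w.subgroupGE i k ⊔ w.subgroupGT (negIdx P i) (-k) := Subgroup.mem_sup_right hv
  have hL := mul_mem (mul_mem huL hvL) (inv_mem huL)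
  obtain ⟨a, ha, t, ht, b, hb, e⟩ := w.exists_eq_of_mem_subgroupGE_sup hd hν hL
  obtain ⟨a', ha', t', ht', b', hb', e'⟩ :=
    w.exists_eq_of_mem_subgroupGT_sup hd hν (w.conj_mem_sup hd hν hu hv)
  -- The conjugate lies in both groups of rank one, hence has two decompositions. Their agreement
  -- makes the factor in `U_α` strict and the factor in `U_{-α}` strict at once.
  have haa := (hd.eq_of_mul_mul_eq ha.1 ha'.1 (w.fixedTorus_le ht) (w.fixedTorus_le ht') hb.1 hb'.1
    (e.symm.trans e')).1
  refine ⟨a, haa ▸ ha', t, Subgroup.mem_inf.2 ⟨w.fixedTorus_le ht, ?_⟩, b, hb, e⟩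
  have e2 : t = a⁻¹ * (u * v * u⁻¹) * b⁻¹ := by rw [e]; group
  rw [e2]
  exact mul_mem (mul_mem (inv_mem (Subgroup.mem_sup_left ha)) hL)
    (inv_mem (Subgroup.mem_sup_right hb))

/-- An element of the torus in the group generated by `U_{α,k}` and `U'_{-α,-k}` lies in the group
generated by `U'_{α,k}` and `U_{-α,-k}` and acts trivially on `U_{α,k} / U'_{α,k}`. -/
theorem torus_mem_sup_and_commutator_mem {i : ι} {k : R} {t : G} (ht : t ∈ T)
    (h : t ∈ w.subgroupGE i k ⊔ w.subgroupGT (negIdx P i) (-k)) :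
    t ∈ w.subgroupGT i k ⊔ w.subgroupGE (negIdx P i) (-k) ∧
      ∀ u ∈ w.subgroupGE i k, t * u * t⁻¹ * u⁻¹ ∈ w.subgroupGT i k := by
  set L' := w.subgroupGT i k ⊔ w.subgroupGE (negIdx P i) (-k) with hL'
  -- The elements all of whose conjugates by `U_{α,k}` lie in `L'`. This group is normalized by
  -- `U_{α,k}` and contains `U'_{-α,-k}`, so that `t ∈ U_{α,k} D`.
  set D : Subgroup G := ⨅ u : w.subgroupGE i k, L'.comap (MulAut.conj (u : G)).toMonoidHom
    with hD
  have hmemD : ∀ g, g ∈ D ↔ ∀ u ∈ w.subgroupGE i k, u * g * u⁻¹ ∈ L' := by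
    intro g
    rw [hD, Subgroup.mem_iInf]
    exact ⟨fun h u hu => h ⟨u, hu⟩, fun h u => h u u.2⟩
  have hGT : w.subgroupGT i k ≤ D := fun g hg => (hmemD g).2 fun u hu =>
    Subgroup.mem_sup_left (w.conj_mem_subgroupGT hd hu hg)
  have hGT' : w.subgroupGT (negIdx P i) (-k) ≤ D := fun g hg => (hmemD g).2 fun u hu =>
    w.conj_mem_sup hd hν hu hg
  have hnorm : w.subgroupGE i k ≤ Subgroup.normalizer (D : Set G) := by
    refine le_normalizer_of_forall_conj_mem fun x hx g hg => (hmemD _).2 fun u hu => ?_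
    have := (hmemD g).1 hg (u * x) (mul_mem hu hx)
    convert this using 1
    group
  have hDL : D ≤ L' := fun g hg => by
    have := (hmemD g).1 hg 1 (one_mem _)
    simpa using this
  have h1 : t ∈ w.subgroupGE i k ⊔ D := sup_le_sup_left hGT' _ h
  rw [← SetLike.mem_coe, Subgroup.coe_mul_of_left_le_normalizer_right _ _ hnorm] at h1
  obtain ⟨a, ha, d, hdD, rfl⟩ := h1
  obtain ⟨z, hz, s, hs, b, hb, rfl⟩ := w.exists_eq_of_mem_subgroupGT_sup hd hν (hDL hdD)
  -- Since `t` has no component in `U_α`, the factor `a` is the inverse of `z ∈ U'_{α,k}`. Hence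
  -- `a`, and with it `t`, lies in `D`.
  have h2 := (hd.eq_of_mul_mul_eq (a := 1) (a' := a * z) (b := 1) (one_mem _)
    ((U i).mul_mem ha.1 hz.1) ht (w.fixedTorus_le hs) (one_mem _) hb.1 (by
      simp only [one_mul, mul_one, mul_assoc])).1
  have haD : a ∈ D := by
    have : a = z⁻¹ := (inv_eq_of_mul_eq_one_left h2.symm).symm
    rw [this]
    exact D.inv_mem (hGT hz)
  have htD : a * (z * s * b) ∈ D := D.mul_mem haD hdD
  set t := a * (z * s * b)
  refine ⟨hDL htD, fun u hu => ?_⟩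
  -- It is the product of `t` and of the conjugate by `u` of `t⁻¹ ∈ D`. As it also lies in `U_α`,
  -- its decomposition in `L'` reduces to the factor in `U'_{α,k}`.
  have h3 : t * u * t⁻¹ * u⁻¹ ∈ L' := by
    have := L'.mul_mem (hDL htD) ((hmemD _).1 (D.inv_mem htD) u hu)
    convert this using 1
    group
  obtain ⟨p, hp, q, hq, r, hr, e⟩ := w.exists_eq_of_mem_subgroupGT_sup hd hν h3
  have h4 := (hd.eq_of_mul_mul_eq (t := 1) (b := 1)
    (mul_mem (hd.torus_conj_mem ht hu.1) (inv_mem hu.1)) hp.1 (one_mem _) (w.fixedTorus_le hq)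
    (one_mem _) hr.1 (by rw [mul_one, mul_one]; exact e)).1
  rw [h4]
  exact hp

end RankOne

end RValuation

end LocalRootDatum

namespace LocalRootDatum

namespace RValuation

/-! ### The local groups -/

section Local

variable {ι E V G R A : Type*} [AddCommGroup E] [Module ℝ E] [AddCommGroup V]
  [Module ℝ V] [Group G] [AddCommGroup R] [LinearOrder R]
  {P : RootPairing ι ℝ E V} [P.IsCrystallographic] {T : Subgroup G} {U : ι → Subgroup G}
  {M : ι → Set G} (w : RValuation P U M R) [AddTorsor (VR P R) A] {o : A} {Ω : Set A}

omit [LinearOrder R] [AddTorsor (VR P R) A] in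
theorem _root_.LocalRootDatum.rootEval_of_nsmul {i j k : ι} {r s : ℕ}
    (h : P.root k = r • P.root i + s • P.root j) (x : VR P R) :
    rootEval P k x = r • rootEval P i x + s • rootEval P j x := by
  have := rootEval_of_root_eq (i := i) (j := j) (k := k) (a := r) (b := s) (by
    rw [h]; push_cast; module) x
  rw [this]; module

omit [LinearOrder R] [AddTorsor (VR P R) A] in
theorem _root_.LocalRootDatum.rootEval_of_two {i j : ι} (h : P.root j = (2 : ℝ) • P.root i)
    (x : VR P R) : rootEval P j x = rootEval P i x + rootEval P i x := by
  have := rootEval_of_root_eq_smul (i := i) (j := j) (a := 2) (by rw [h]; push_cast; rfl) x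
  rw [this, two_zsmul]

theorem mem_rootGroup {i : ι} {g : G} :
    g ∈ w.rootGroup o Ω i ↔ ∀ x ∈ Ω, g ∈ w.subgroupGE i (-rootEval P i (x -ᵥ o)) := by
  simp [rootGroup, Subgroup.mem_iInf]

theorem mem_rootGroupPrime {i : ι} {g : G} :
    g ∈ w.rootGroupPrime o Ω i ↔ ∀ x ∈ Ω, g ∈ w.subgroupGT i (-rootEval P i (x -ᵥ o)) := by
  simp [rootGroupPrime, Subgroup.mem_iInf]

theorem rootGroupPrime_le (i : ι) : w.rootGroupPrime o Ω i ≤ w.rootGroup o Ω i :=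
  iInf₂_mono fun _ _ => w.subgroupGT_le_subgroupGE _ _

theorem rootGroupStar_of_mem {i : ι} (h : i ∈ rootsStar P R o Ω) :
    w.rootGroupStar o Ω i = w.rootGroupPrime o Ω i := if_pos h

theorem rootGroupStar_of_notMem {i : ι} (h : i ∉ rootsStar P R o Ω) :
    w.rootGroupStar o Ω i = w.rootGroup o Ω i := if_neg h

theorem rootGroupStar_le (i : ι) : w.rootGroupStar o Ω i ≤ w.rootGroup o Ω i := by
  by_cases h : i ∈ rootsStar P R o Ω
  · rw [w.rootGroupStar_of_mem h]; exact w.rootGroupPrime_le i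
  · rw [w.rootGroupStar_of_notMem h]

theorem localGroupStar_le : w.localGroupStar o Ω T ≤ w.localGroup o Ω := by
  have h : ∀ i, w.rootGroup o Ω i ≤ w.localGroup o Ω := le_iSup _
  exact sup_le (iSup_le fun i => inf_le_left.trans
    (sup_le (h i) ((w.rootGroupPrime_le _).trans (h _))))
    (iSup_le fun i => (w.rootGroupStar_le i).trans (h i))

theorem rootGroupStar_le_localGroupStar (i : ι) :
    w.rootGroupStar o Ω i ≤ w.localGroupStar o Ω T :=
  le_sup_of_le_right (le_iSup (w.rootGroupStar o Ω) i)

theorem torusPrime_le_localGroupStar (i : ι) : w.torusPrime o Ω T i ≤ w.localGroupStar o Ω T :=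
  le_sup_of_le_left (le_iSup (w.torusPrime o Ω T) i)

variable (hΩ : Ω.Nonempty)

include hΩ in
omit [LinearOrder R] in
theorem mem_rootsStar_iff {i : ι} : i ∈ rootsStar P R o Ω ↔
    ∀ x ∈ Ω, ∀ y ∈ Ω, rootEval P i (x -ᵥ o) = rootEval P i (y -ᵥ o) := by
  constructor
  · rintro ⟨l, hl⟩ x hx y hy
    rw [← neg_inj, hl x hx, hl y hy]
  · intro h
    obtain ⟨x, hx⟩ := hΩ
    exact ⟨_, fun y hy => by rw [h y hy x hx]⟩

include hΩ in
omit [LinearOrder R] in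
theorem negIdx_mem_rootsStar {i : ι} (h : i ∈ rootsStar P R o Ω) :
    negIdx P i ∈ rootsStar P R o Ω := by
  rw [mem_rootsStar_iff hΩ] at h ⊢
  intro x hx y hy
  rw [rootEval_negIdx, rootEval_negIdx, h x hx y hy]

theorem rootGroup_of_const {i : ι} (h : i ∈ rootsStar P R o Ω) {x : A} (hx : x ∈ Ω) :
    w.rootGroup o Ω i = w.subgroupGE i (-rootEval P i (x -ᵥ o)) := by
  ext g
  rw [w.mem_rootGroup]
  refine ⟨fun hg => hg x hx, fun hg y hy => ?_⟩
  rwa [(mem_rootsStar_iff ⟨x, hx⟩).1 h y hy x hx]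

theorem rootGroupPrime_of_const {i : ι} (h : i ∈ rootsStar P R o Ω) {x : A} (hx : x ∈ Ω) :
    w.rootGroupPrime o Ω i = w.subgroupGT i (-rootEval P i (x -ᵥ o)) := by
  ext g
  rw [w.mem_rootGroupPrime]
  refine ⟨fun hg => hg x hx, fun hg y hy => ?_⟩
  rwa [(mem_rootsStar_iff ⟨x, hx⟩).1 h y hy x hx]

include hΩ in
theorem isUpper_rootGroup (i : ι) : w.IsUpper i (w.rootGroup o Ω i) := by
  obtain ⟨x, hx⟩ := hΩ
  refine ⟨fun g hg => (w.mem_rootGroup.1 hg x hx).1, fun g hg g' hg' h => ?_⟩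
  rw [w.mem_rootGroup] at hg ⊢
  exact fun y hy => ⟨hg', (hg y hy).2.trans h⟩

include hΩ in
theorem isUpper_rootGroupPrime (i : ι) : w.IsUpper i (w.rootGroupPrime o Ω i) := by
  obtain ⟨x, hx⟩ := hΩ
  refine ⟨fun g hg => (w.mem_rootGroupPrime.1 hg x hx).1, fun g hg g' hg' h => ?_⟩
  rw [w.mem_rootGroupPrime] at hg ⊢
  exact fun y hy => ⟨hg', (hg y hy).2.trans_le h⟩

include hΩ in
theorem isUpper_rootGroupStar (i : ι) : w.IsUpper i (w.rootGroupStar o Ω i) := by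
  by_cases h : i ∈ rootsStar P R o Ω
  · rw [w.rootGroupStar_of_mem h]; exact w.isUpper_rootGroupPrime hΩ i
  · rw [w.rootGroupStar_of_notMem h]; exact w.isUpper_rootGroup hΩ i

theorem le_of_mem_rootGroup {i : ι} {g : G} (hg : g ∈ w.rootGroup o Ω i) {l : R}
    (hl : w.φ i g = l) {x : A} (hx : x ∈ Ω) : -rootEval P i (x -ᵥ o) ≤ l := by
  have := (w.mem_rootGroup.1 hg x hx).2
  rwa [hl, WithTop.coe_le_coe] at this

include hΩ in
/-- A nontrivial element of `U*_{α,Ω}` whose value is attained by `-α` on `Ω` comes from a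
nonconstant root. -/
theorem lt_of_mem_rootGroupStar {i : ι} {g : G} (hg : g ∈ w.rootGroupStar o Ω i) {l : R}
    (hl : w.φ i g = l) {x : A} (hx : x ∈ Ω)
    (h : ∀ y ∈ Ω, rootEval P i (y -ᵥ o) = rootEval P i (x -ᵥ o)) :
    -rootEval P i (x -ᵥ o) < l := by
  have hi : i ∈ rootsStar P R o Ω :=
    (mem_rootsStar_iff hΩ).2 fun y hy z hz => by rw [h y hy, h z hz]
  rw [w.rootGroupStar_of_mem hi, w.mem_rootGroupPrime] at hg
  have := (hg x hx).2
  rwa [hl, WithTop.coe_lt_coe] at this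

variable [IsOrderedAddMonoid R]

theorem add_self_le_iff {a b : R} : a + a ≤ b + b ↔ a ≤ b := by
  refine ⟨fun h => ?_, fun h => add_le_add h h⟩
  by_contra! h'
  exact absurd h (not_le.2 (add_lt_add h' h'))

theorem add_self_lt_iff {a b : R} : a + a < b + b ↔ a < b :=
  lt_iff_lt_of_le_iff_le add_self_le_iff

theorem add_self_inj {a b : R} : a + a = b + b ↔ a = b := by
  simp only [le_antisymm_iff, add_self_le_iff]

omit [IsOrderedAddMonoid R] [P.IsCrystallographic] in
theorem φ_double_cases {i j : ι} (h : P.root j = (2 : ℝ) • P.root i) (hd : U j ≤ U i) {g : G}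
    (hg : g ∈ U j) : (w.φ i g = ⊤ ∧ w.φ j g = ⊤) ∨
      ∃ k : R, w.φ i g = k ∧ w.φ j g = ((k + k : R) : WithTop R) := by
  by_cases hg1 : g = 1
  · left; rw [hg1, w.φ_one, w.φ_one]; exact ⟨rfl, rfl⟩
  · obtain ⟨k, hk⟩ := w.exists_φ_eq (hd hg) hg1
    exact Or.inr ⟨k, hk, w.φ_of_double h hg hk⟩

omit [P.IsCrystallographic] in
theorem mem_subgroupGE_double {i j : ι} (h : P.root j = (2 : ℝ) • P.root i) (hd : U j ≤ U i)
    {g : G} (hg : g ∈ U j) (l : R) : g ∈ w.subgroupGE j (l + l) ↔ g ∈ w.subgroupGE i l := by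
  rw [w.mem_subgroupGE, w.mem_subgroupGE, and_iff_right hg, and_iff_right (hd hg)]
  rcases w.φ_double_cases h hd hg with ⟨h1, h2⟩ | ⟨k, h1, h2⟩
  · simp [h1, h2]
  · rw [h1, h2, WithTop.coe_le_coe, WithTop.coe_le_coe, add_self_le_iff]

omit [P.IsCrystallographic] in
theorem mem_subgroupGT_double {i j : ι} (h : P.root j = (2 : ℝ) • P.root i) (hd : U j ≤ U i)
    {g : G} (hg : g ∈ U j) (l : R) : g ∈ w.subgroupGT j (l + l) ↔ g ∈ w.subgroupGT i l := by
  rw [w.mem_subgroupGT, w.mem_subgroupGT, and_iff_right hg, and_iff_right (hd hg)]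
  rcases w.φ_double_cases h hd hg with ⟨h1, h2⟩ | ⟨k, h1, h2⟩
  · simp [h1, h2]
  · rw [h1, h2, WithTop.coe_lt_coe, WithTop.coe_lt_coe, add_self_lt_iff]

theorem mem_rootGroup_double {i j : ι} (h : P.root j = (2 : ℝ) • P.root i) (hd : U j ≤ U i)
    {g : G} (hg : g ∈ U j) : g ∈ w.rootGroup o Ω j ↔ g ∈ w.rootGroup o Ω i := by
  rw [w.mem_rootGroup, w.mem_rootGroup]
  refine forall₂_congr fun x _ => ?_
  rw [rootEval_of_two h, neg_add, w.mem_subgroupGE_double h hd hg]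

theorem mem_rootGroupPrime_double {i j : ι} (h : P.root j = (2 : ℝ) • P.root i) (hd : U j ≤ U i)
    {g : G} (hg : g ∈ U j) : g ∈ w.rootGroupPrime o Ω j ↔ g ∈ w.rootGroupPrime o Ω i := by
  rw [w.mem_rootGroupPrime, w.mem_rootGroupPrime]
  refine forall₂_congr fun x _ => ?_
  rw [rootEval_of_two h, neg_add, w.mem_subgroupGT_double h hd hg]

include hΩ

theorem mem_rootsStar_double {i j : ι} (h : P.root j = (2 : ℝ) • P.root i) :
    j ∈ rootsStar P R o Ω ↔ i ∈ rootsStar P R o Ω := by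
  rw [mem_rootsStar_iff hΩ, mem_rootsStar_iff hΩ]
  simp only [rootEval_of_two h, add_self_inj]

theorem mem_rootsStar_of_sameRay [Finite ι] {i j : ι} (h : SameRay P i j)
    (hi : i ∈ rootsStar P R o Ω) : j ∈ rootsStar P R o Ω := by
  rcases h.cases with rfl | h | h
  · exact hi
  · exact (mem_rootsStar_double hΩ h).2 hi
  · exact (mem_rootsStar_double hΩ h).1 hi

theorem mem_rootGroupStar_double {i j : ι} (h : P.root j = (2 : ℝ) • P.root i) (hd : U j ≤ U i)
    {g : G} (hg : g ∈ U j) : g ∈ w.rootGroupStar o Ω j ↔ g ∈ w.rootGroupStar o Ω i := by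
  have hs := mem_rootsStar_double (o := o) hΩ h
  by_cases hi : i ∈ rootsStar P R o Ω
  · rw [w.rootGroupStar_of_mem hi, w.rootGroupStar_of_mem (hs.2 hi),
      w.mem_rootGroupPrime_double h hd hg]
  · rw [w.rootGroupStar_of_notMem hi, w.rootGroupStar_of_notMem fun h => hi (hs.1 h),
      w.mem_rootGroup_double h hd hg]

variable (hd : IsRootGroupDatum P T U M)

include hd in
theorem rootGroup_double_le {i j : ι} (h : P.root j = (2 : ℝ) • P.root i) :
    w.rootGroup o Ω j ≤ w.rootGroup o Ω i := fun _ hg =>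
  (w.mem_rootGroup_double h (hd.double_le h) ((w.isUpper_rootGroup hΩ j).le hg)).1 hg

include hd in
theorem rootGroupStar_double_le {i j : ι} (h : P.root j = (2 : ℝ) • P.root i) :
    w.rootGroupStar o Ω j ≤ w.rootGroupStar o Ω i := fun _ hg =>
  (w.mem_rootGroupStar_double hΩ h (hd.double_le h) ((w.isUpper_rootGroupStar hΩ j).le hg)).1 hg

/-- The commutator relations between `U_{α,Ω}` and `U_{β,Ω}`. -/
theorem isCommClosed_rootGroup : IsCommClosed P U (w.rootGroup o Ω) where
  le i := (w.isUpper_rootGroup hΩ i).le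
  commutator_mem i j hij x hx y hy := by
    refine w.commutator_mem_iSup _ hij ((w.isUpper_rootGroup hΩ i).le hx)
      ((w.isUpper_rootGroup hΩ j).le hy) fun l m hl hm k r s hr hs hk g hg => ?_
    rw [w.mem_rootGroup]
    refine fun z hz => ⟨hg.1, le_trans (WithTop.coe_le_coe.2 ?_) hg.2⟩
    rw [rootEval_of_nsmul hk, neg_add, ← smul_neg, ← smul_neg]
    exact nsmul_add_nsmul_le r s (w.le_of_mem_rootGroup hx hl hz) (w.le_of_mem_rootGroup hy hm hz)

/-- The commutator relations between `U_{α,Ω}` and `U*_{β,Ω}`. -/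
theorem commutator_mem_rootGroupStar {i j : ι} (hij : ∀ c : ℝ, c ≤ 0 → P.root j ≠ c • P.root i)
    {x y : G} (hx : x ∈ w.rootGroup o Ω i)
    (hy : y ∈ w.rootGroupStar o Ω j) :
    x * y * x⁻¹ * y⁻¹ ∈ ⨆ k ∈ posCombs P i j, w.rootGroupStar o Ω k := by
  refine w.commutator_mem_iSup _ hij ((w.isUpper_rootGroup hΩ i).le hx)
    ((w.isUpper_rootGroupStar hΩ j).le hy) fun l m hl hm k r s hr hs hk g hg => ?_
  have hle : ∀ z ∈ Ω, -rootEval P i (z -ᵥ o) ≤ l := fun z hz => w.le_of_mem_rootGroup hx hl hz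
  have hle' : ∀ z ∈ Ω, -rootEval P j (z -ᵥ o) ≤ m := fun z hz =>
    w.le_of_mem_rootGroup (w.rootGroupStar_le j hy) hm hz
  by_cases hkc : k ∈ rootsStar P R o Ω
  · rw [w.rootGroupStar_of_mem hkc, w.mem_rootGroupPrime]
    refine fun z hz => ⟨hg.1, lt_of_lt_of_le (WithTop.coe_lt_coe.2 ?_) hg.2⟩
    rw [rootEval_of_nsmul hk, neg_add, ← smul_neg, ← smul_neg]
    -- Without strictness, equality holds for both roots at `z`. As `rα + sβ` is constant on `Ω`, it
    -- then holds on all of `Ω`, so `β` is constant with value attained by `y`, which contradicts `y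
    -- ∈ U*_{β,Ω}`.
    by_contra! hcon
    have e1 : -rootEval P i (z -ᵥ o) = l := by
      refine (hle z hz).eq_of_not_lt fun h => ?_
      exact absurd hcon (not_le.2 (nsmul_add_nsmul_lt_left s hr h (hle' z hz)))
    have e2 : -rootEval P j (z -ᵥ o) = m := by
      refine (hle' z hz).eq_of_not_lt fun h => ?_
      exact absurd hcon (not_le.2 (nsmul_add_nsmul_lt_right r hs (hle z hz) h))
    have hsum : ∀ a ∈ Ω, r • -rootEval P i (a -ᵥ o) + s • -rootEval P j (a -ᵥ o) =
        r • l + s • m := fun a ha => by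
      rw [← e1, ← e2]
      have := (mem_rootsStar_iff hΩ).1 hkc a ha z hz
      rw [rootEval_of_nsmul hk, rootEval_of_nsmul hk] at this
      rw [smul_neg, smul_neg, smul_neg, smul_neg, ← neg_add, ← neg_add, this]
    have hj : ∀ a ∈ Ω, -rootEval P j (a -ᵥ o) = m := fun a ha =>
      (hle' a ha).eq_of_not_lt fun h =>
        absurd (hsum a ha) (nsmul_add_nsmul_lt_right r hs (hle a ha) h).ne
    have := w.lt_of_mem_rootGroupStar hΩ hy hm hz fun a ha => by
      rw [← neg_inj, hj a ha, hj z hz]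
    exact absurd (hj z hz) this.ne
  · rw [w.rootGroupStar_of_notMem hkc, w.mem_rootGroup]
    refine fun z hz => ⟨hg.1, le_trans (WithTop.coe_le_coe.2 ?_) hg.2⟩
    rw [rootEval_of_nsmul hk, neg_add, ← smul_neg, ← smul_neg]
    exact nsmul_add_nsmul_le r s (hle z hz) (hle' z hz)

theorem isCommClosed_rootGroupStar : IsCommClosed P U (w.rootGroupStar o Ω) where
  le i := (w.isUpper_rootGroupStar hΩ i).le
  commutator_mem _ _ hij _ hx _ hy :=
    w.commutator_mem_rootGroupStar hΩ hij (w.rootGroupStar_le _ hx) hy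

/-- A sum `≤ 0` would force `-α` to equal the value of `a` throughout `Ω`. But then `α` is constant
and the value of `a` is strictly larger. -/
theorem sumPos_rootGroupStar (i : ι) :
    w.SumPos i (w.rootGroupStar o Ω i) (w.rootGroupStar o Ω (negIdx P i)) := by
  intro a ha b hb k l hk hl
  have h1 : ∀ x ∈ Ω, -rootEval P i (x -ᵥ o) ≤ k := fun x hx =>
    w.le_of_mem_rootGroup (w.rootGroupStar_le _ ha) hk hx
  have h2 : ∀ x ∈ Ω, rootEval P i (x -ᵥ o) ≤ l := fun x hx => by
    have := w.le_of_mem_rootGroup (w.rootGroupStar_le _ hb) hl hx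
    rwa [rootEval_negIdx, neg_neg] at this
  by_contra! hcon
  have h3 : ∀ x ∈ Ω, -rootEval P i (x -ᵥ o) = k := fun x hx => by
    refine (h1 x hx).eq_of_not_lt fun h => ?_
    have := add_lt_add_of_lt_of_le h (h2 x hx)
    rw [neg_add_cancel] at this
    exact absurd hcon (not_le.2 this)
  obtain ⟨x, hx⟩ := id hΩ
  have := w.lt_of_mem_rootGroupStar hΩ ha hk hx fun y hy => by rw [← neg_inj, h3 y hy, h3 x hx]
  exact absurd (h3 x hx) this.ne

omit hΩ [IsOrderedAddMonoid R] [P.IsCrystallographic] [AddTorsor (VR P R) A] [LinearOrder R]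
  [AddCommGroup R] in
-- The group of a ray is the member at its shortest root `c`, because the member at `2c` is
-- contained in it.
theorem _root_.LocalRootDatum.exists_rayGroup_eq [Finite ι] [P.IsCrystallographic]
    {X : ι → Subgroup G} (hX : ∀ i j, P.root j = (2 : ℝ) • P.root i → X j ≤ X i) (i : ι) :
    ∃ c, SameRay P i c ∧ (∀ k, SameRay P i k → k = c ∨ P.root k = (2 : ℝ) • P.root c) ∧
      rayGroup P X i = X c ∧ rayGroup P X (negIdx P i) = X (negIdx P c) := by
  obtain ⟨c, hc, h⟩ := exists_sameRay_forall (P := P) i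
  refine ⟨c, hc, h, le_antisymm (iSup₂_le fun k hk => ?_) fun g hg => mem_rayGroup hc hg,
    le_antisymm (iSup₂_le fun k hk => ?_) fun g hg => mem_rayGroup hc.negIdx hg⟩
  · rcases h k hk with rfl | h
    exacts [le_rfl, hX _ _ h]
  · have hk' := hk.negIdx
    rw [negIdx_negIdx] at hk'
    rcases h _ hk' with h | h
    · rw [← h, negIdx_negIdx]
    · apply hX
      rw [root_negIdx] at h
      rw [root_negIdx, smul_neg, ← h, neg_neg]

end Local

/-! ### Decomposition and normality of `U*_Ω` -/

section Kernel

variable {ι E V G R A : Type*} [Finite ι] [AddCommGroup E] [Module ℝ E] [AddCommGroup V]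
  [Module ℝ V] [Group G] [AddCommGroup R] [LinearOrder R] [IsOrderedAddMonoid R]
  {P : RootPairing ι ℝ E V} [P.IsCrystallographic] {T : Subgroup G} {U : ι → Subgroup G}
  {M : ι → Set G} (w : RValuation P U M R) [AddTorsor (VR P R) A] {o : A} {Ω : Set A}
  (hd : IsRootGroupDatum P T U M)
  {ν : groupN M →* affGroup P R A} (hν : IsCompatibleAction w o ν) (hΩ : Ω.Nonempty)

omit [Finite ι] [IsOrderedAddMonoid R] in
theorem mem_sup_of_mem_torusPrime {i : ι} {t : G} (ht : t ∈ w.torusPrime o Ω T i) {x : A}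
    (hx : x ∈ Ω) : t ∈ w.subgroupGE i (-rootEval P i (x -ᵥ o)) ⊔
      w.subgroupGT (negIdx P i) (-(-rootEval P i (x -ᵥ o))) := by
  refine SetLike.le_def.1 (sup_le_sup ?_ ?_) ht.1 <;> intro g hg
  · exact w.mem_rootGroup.1 hg x hx
  have := w.mem_rootGroupPrime.1 hg x hx
  rwa [rootEval_negIdx] at this

include hd hν hΩ

theorem torusStar_le_fixedTorus : w.torusStar o Ω T ≤ w.fixedTorus T := by
  obtain ⟨x, hx⟩ := hΩ
  exact iSup_le fun i t ht =>
    w.mem_fixedTorus_of_mem_sup hd hν ht.2 (w.mem_sup_of_mem_torusPrime ht hx)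

/-- The decomposition of the elements of `U*_Ω` for a system of positive roots. -/
theorem mem_bigCell_of_mem_localGroupStar {v : V} (hv : IsRegular P v) {g : G}
    (hg : g ∈ w.localGroupStar o Ω T) :
    g ∈ bigCell P (w.rootGroupStar o Ω) (w.fixedTorus T) v := by
  refine mem_bigCell (w.isCommClosed_rootGroupStar hΩ)
    (fun s hs i x hx => (w.isUpper_rootGroupStar hΩ i).conj_mem hs hx) (fun i a ha b hb => ?_) hv
    (sup_le_sup_right (w.torusStar_le_fixedTorus hd hν hΩ) _ hg)
  obtain ⟨c, -, -, h1, h2⟩ := exists_rayGroup_eq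
    (fun i j h => w.rootGroupStar_double_le (o := o) hΩ hd h) i
  rw [h1] at ha ⊢
  rw [h2] at hb ⊢
  -- The rule is applied to `-c` in place of `c`, because the order of the factors is reversed.
  have h := w.exists_mul_eq_of_isUpper hd hν (i := negIdx P c)
    (w.isUpper_rootGroupStar (o := o) hΩ _) (w.isUpper_rootGroupStar (o := o) hΩ _)
    (w.sumPos_rootGroupStar hΩ _) hb (b := a) (by rwa [negIdx_negIdx])
  rwa [negIdx_negIdx] at h

/-- The intersection of `U*_Ω` with `U_α` is `U*_{α,Ω}`. -/
theorem mem_rootGroupStar_of_mem {i : ι} {g : G} (hg : g ∈ w.localGroupStar o Ω T)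
    (hgi : g ∈ U i) : g ∈ w.rootGroupStar o Ω i := by
  obtain ⟨v, hv, hi⟩ := exists_isRegular_pos (P := P) i
  obtain ⟨a, ha, t, ht, b, hb, rfl⟩ := w.mem_bigCell_of_mem_localGroupStar hd hν hΩ hv hg
  have hle := fun i => (w.isUpper_rootGroupStar (o := o) hΩ i).le
  have ha' := chamberGroup_mono hle v ha
  have hb' := chamberGroup_mono hle _ hb
  have hag : a⁻¹ * (a * t * b) ∈ chamberGroup P U v :=
    mul_mem (inv_mem ha') (mem_chamberGroup hi hgi)
  -- As `a t b` lies in `U_α`, with `α` positive on `v`, its negative and torus factors are trivial.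
  have hb1 := hd.eq_one_of_torus_mul_eq hv (T.inv_mem (w.fixedTorus_le ht)) hag hb' (by group)
  subst hb1
  rw [mul_one] at hgi hag
  rw [inv_mul_cancel_left] at hag
  have ht1 := hd.eq_one_of_mem_torus hv (w.fixedTorus_le ht) hag
  subst ht1
  rw [mul_one] at hgi ⊢
  rw [mul_one]
  have h := hd.mem_rayGroup_of_mem_chamberGroup (w.isCommClosed_rootGroupStar hΩ) hv hi ha hgi
  obtain ⟨c, -, hc, h1, -⟩ := exists_rayGroup_eq
    (fun i j h => w.rootGroupStar_double_le (o := o) hΩ hd h) i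
  rw [h1] at h
  rcases hc i (SameRay.refl i) with rfl | h2
  · exact h
  · exact (w.mem_rootGroupStar_double hΩ h2 (hd.double_le h2) hgi).2 h

/-- The argument with strings of roots covers the roots not proportional to `j`; the others are a
matter of rank one. -/
theorem conj_torusPrime_mem {i j : ι} {t u : G} (ht : t ∈ w.torusPrime o Ω T j)
    (hi : i ∈ rootsStar P R o Ω) (hu : u ∈ w.rootGroup o Ω i) :
    t * u * t⁻¹ * u⁻¹ ∈ w.localGroupStar o Ω T := by
  obtain ⟨x, hx⟩ := id hΩ
  have hX := fun i j h => w.rootGroup_double_le (o := o) hΩ hd (i := i) (j := j) h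
  by_cases hij : ∀ c : ℝ, P.root i ≠ c • P.root j
  · have h1 := (w.rootGroup_of_const hi hx) ▸ hu
    have h2 := w.commutator_mem_subgroupGT hd hij (w.mem_sup_of_mem_torusPrime ht hx) h1
      (hd.torus_conj_mem ht.2 h1.1)
    apply w.rootGroupStar_le_localGroupStar i
    rwa [w.rootGroupStar_of_mem hi, w.rootGroupPrime_of_const hi hx]
  · push Not at hij
    obtain ⟨c, hc⟩ := hij
    have hc0 : c ≠ 0 := by
      rintro rfl
      exact P.ne_zero i (by rw [hc, zero_smul])
    have hray : SameRay P j i ∨ SameRay P (negIdx P j) i := by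
      rcases lt_or_gt_of_ne hc0 with h | h
      · exact Or.inr ⟨-c, by linarith, by rw [hc, root_negIdx, smul_neg, neg_smul, neg_neg]⟩
      · exact Or.inl ⟨c, h, hc⟩
    -- Replace `j` by the shortest root `d` of its ray, whose groups contain those of `2d`, in order
    -- to treat both roots of the ray at once.
    obtain ⟨d, hjd, hdd, h1, h2⟩ := exists_rayGroup_eq hX j
    have hstar : d ∈ rootsStar P R o Ω := by
      rcases hray with h | h
      · exact mem_rootsStar_of_sameRay hΩ (h.symm.trans hjd) hi
      · have := mem_rootsStar_of_sameRay hΩ (h.symm.trans hjd.negIdx) hi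
        have := negIdx_mem_rootsStar hΩ this
        rwa [negIdx_negIdx] at this
    have htd : t ∈ w.subgroupGE d (-rootEval P d (x -ᵥ o)) ⊔
        w.subgroupGT (negIdx P d) (-(-rootEval P d (x -ᵥ o))) := by
      rcases hdd j (SameRay.refl j) with rfl | h
      · exact w.mem_sup_of_mem_torusPrime ht hx
      · have hn : P.root (negIdx P j) = (2 : ℝ) • P.root (negIdx P d) := by
          rw [root_negIdx, root_negIdx, h, smul_neg]
        refine SetLike.le_def.1 (sup_le_sup ?_ ?_) (w.mem_sup_of_mem_torusPrime ht hx) <;>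
          intro g hg
        · rw [rootEval_of_two h, neg_add] at hg
          exact (w.mem_subgroupGE_double h (hd.double_le h) hg.1 _).1 hg
        · rw [rootEval_of_two h, neg_add, neg_add] at hg
          exact (w.mem_subgroupGT_double hn (hd.double_le hn) hg.1 _).1 hg
    obtain ⟨h3, h4⟩ := w.torus_mem_sup_and_commutator_mem hd hν ht.2 htd
    rcases hray with h | h
    · apply w.rootGroupStar_le_localGroupStar d
      rw [w.rootGroupStar_of_mem hstar, w.rootGroupPrime_of_const hstar hx]
      apply h4
      rw [← w.rootGroup_of_const hstar hx, ← h1]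
      exact mem_rayGroup h hu
    · have hstar' := negIdx_mem_rootsStar hΩ hstar
      -- Membership in the opposite group is the hypothesis of the same lemma for `-d`.
      rw [sup_comm] at h3
      obtain ⟨-, h5⟩ := w.torus_mem_sup_and_commutator_mem hd hν (i := negIdx P d)
        (k := -(-rootEval P d (x -ᵥ o))) ht.2 (by rwa [negIdx_negIdx, neg_neg (-rootEval P d _)])
      apply w.rootGroupStar_le_localGroupStar (negIdx P d)
      rw [w.rootGroupStar_of_mem hstar', w.rootGroupPrime_of_const hstar' hx, rootEval_negIdx]
      apply h5
      rw [← rootEval_negIdx, ← w.rootGroup_of_const hstar' hx, ← h2]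
      exact mem_rayGroup h hu

/-- The commutator relations suffice unless `j` is on the ray opposite to `i`. There
`exists_conj_eq` applies, and its torus factor lies in `T'_{d,Ω}`: this is why `T*_Ω` has to be part
of `U*_Ω`. -/
theorem conj_rootGroupStar_mem {i j : ι} {u y : G} (hi : i ∈ rootsStar P R o Ω)
    (hu : u ∈ w.rootGroup o Ω i) (hy : y ∈ w.rootGroupStar o Ω j) :
    u * y * u⁻¹ ∈ w.localGroupStar o Ω T := by
  have hyU := w.rootGroupStar_le_localGroupStar (T := T) j hy
  by_cases hij : ∀ c : ℝ, c ≤ 0 → P.root j ≠ c • P.root i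
  · have h1 := w.commutator_mem_rootGroupStar hΩ hij hu hy
    have e : u * y * u⁻¹ = u * y * u⁻¹ * y⁻¹ * y := by group
    rw [e]
    exact mul_mem ((iSup₂_le fun k _ => w.rootGroupStar_le_localGroupStar k :
      (⨆ k ∈ posCombs P i j, w.rootGroupStar o Ω k) ≤ w.localGroupStar o Ω T) h1) hyU
  · push Not at hij
    obtain ⟨c, hc, hji⟩ := hij
    have hray : SameRay P (negIdx P i) j := by
      refine ⟨-c, ?_, by rw [hji, root_negIdx, smul_neg, neg_smul, neg_neg]⟩
      rcases hc.lt_or_eq with h | rfl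
      · linarith
      · exact absurd (by rw [hji, zero_smul]) (P.ne_zero j)
    obtain ⟨x, hx⟩ := id hΩ
    obtain ⟨d, hid, hdd, -, h2⟩ := exists_rayGroup_eq
      (fun i j h => w.rootGroupStar_double_le (o := o) hΩ hd h) i
    have hud : u ∈ w.rootGroup o Ω d := by
      rcases hdd i (SameRay.refl i) with rfl | h
      · exact hu
      · exact w.rootGroup_double_le hΩ hd h hu
    have hyd : y ∈ w.rootGroupStar o Ω (negIdx P d) := h2 ▸ mem_rayGroup hray hy
    have hstar := mem_rootsStar_of_sameRay hΩ hid hi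
    have hstar' := negIdx_mem_rootsStar hΩ hstar
    rw [w.rootGroup_of_const hstar hx] at hud
    rw [w.rootGroupStar_of_mem hstar', w.rootGroupPrime_of_const hstar' hx, rootEval_negIdx] at hyd
    obtain ⟨z, hz, t, ht, b, hb, e⟩ := w.exists_conj_eq hd hν hud hyd
    rw [e]
    refine mul_mem (mul_mem (w.rootGroupStar_le_localGroupStar d ?_)
      (w.torusPrime_le_localGroupStar d ?_)) (w.rootGroupStar_le_localGroupStar (negIdx P d) ?_)
    · rwa [w.rootGroupStar_of_mem hstar, w.rootGroupPrime_of_const hstar hx]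
    · rw [torusPrime, w.rootGroup_of_const hstar hx, w.rootGroupPrime_of_const hstar' hx,
        rootEval_negIdx, inf_comm]
      exact ht
    · rwa [w.rootGroupStar_of_mem hstar', w.rootGroupPrime_of_const hstar' hx, rootEval_negIdx]

/-- For a root not constant on `Ω` there is nothing to prove, since then `U_{α,Ω} = U*_{α,Ω}`. -/
theorem localGroup_le_normalizer :
    w.localGroup o Ω ≤ Subgroup.normalizer (w.localGroupStar o Ω T : Set G) := by
  refine iSup_le fun i => ?_
  by_cases hi : i ∈ rootsStar P R o Ω
  · refine le_normalizer_of_forall_conj_mem fun u hu g hg => ?_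
    have hle : w.localGroupStar o Ω T ≤
        (w.localGroupStar o Ω T).comap (MulAut.conj u).toMonoidHom := by
      refine sup_le (iSup_le fun j t ht => ?_) (iSup_le fun j y hy =>
        w.conj_rootGroupStar_mem hd hν hΩ hi hu hy)
      have h1 := w.conj_torusPrime_mem hd hν hΩ ht hi hu
      have h2 := w.torusPrime_le_localGroupStar j ht
      have e : u * t * u⁻¹ = (t * u * t⁻¹ * u⁻¹)⁻¹ * t := by group
      change u * t * u⁻¹ ∈ w.localGroupStar o Ω T
      rw [e]
      exact mul_mem (inv_mem h1) h2
    exact hle hg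
  · rw [← w.rootGroupStar_of_notMem hi]
    exact (w.rootGroupStar_le_localGroupStar i).trans Subgroup.le_normalizer

theorem conj_mem_localGroupStar {g x : G} (hg : g ∈ w.localGroup o Ω)
    (hx : x ∈ w.localGroupStar o Ω T) : g * x * g⁻¹ ∈ w.localGroupStar o Ω T :=
  conj_mem_of_le_normalizer (w.localGroup_le_normalizer hd hν hΩ) hg hx

theorem normal_localKernel : (w.localKernel o Ω T).Normal :=
  Subgroup.normal_subgroupOf_of_le_normalizer (w.localGroup_le_normalizer hd hν hΩ)

end Kernel

end RValuation

end LocalRootDatum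

namespace LocalRootDatum

/-! ### Sub-root systems -/

section SubRootSystem

variable {ι E V : Type*} [Finite ι] [AddCommGroup E] [Module ℝ E] [AddCommGroup V] [Module ℝ V]

/-- A set of roots of a root system that is stable under its own reflections is a root system in
its span. -/
theorem exists_subRootPairing (P : RootPairing ι ℝ E V) [P.IsRootSystem] [P.IsCrystallographic]
    (Φ : Set ι) (hΦ : ∀ i ∈ Φ, ∀ j ∈ Φ, P.reflectionPerm i j ∈ Φ) :
    ∃ Q : RootPairing Φ ℝ (Submodule.span ℝ (P.root '' Φ))
        (Module.Dual ℝ (Submodule.span ℝ (P.root '' Φ))),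
      (∀ a, (Q.root a : E) = P.root a) ∧ Q.IsRootSystem ∧ Q.IsCrystallographic ∧
      (∀ a b, (Q.reflectionPerm a b : ι) = P.reflectionPerm a b) ∧
      ∀ v, ∃ v' : V, ∀ a : Φ, P.root' a v' = Q.root' a v := by
  have : Module.Finite ℝ E := by
    refine ⟨?_⟩
    rw [← RootPairing.IsRootSystem.span_root_eq_top (P := P)]
    exact Submodule.fg_span (Set.finite_range P.root)
  set S := Submodule.span ℝ (P.root '' Φ)
  let root : Φ ↪ S :=
    ⟨fun a => ⟨P.root a, Submodule.subset_span ⟨a, a.2, rfl⟩⟩, fun a b h =>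
      Subtype.ext (P.root.injective (congrArg Subtype.val h))⟩
  -- Coroots with equal restrictions give pairings `2` and `2` between their roots, which forces the
  -- roots to be equal.
  have hcor : Function.Injective fun a : Φ => (P.coroot' a).comp S.subtype := by
    intro a b h
    have h1 := LinearMap.congr_fun h (root a)
    have h2 := LinearMap.congr_fun h (root b)
    apply Subtype.ext
    change P.pairing a a = P.pairing a b at h1
    change P.pairing b a = P.pairing b b at h2
    rw [RootPairing.pairing_same] at h1 h2
    exact (P.pairing_two_two_iff a b).1 ⟨h1.symm, h2⟩
  let coroot : Φ ↪ Module.Dual ℝ S := ⟨_, hcor⟩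
  have hpair : ∀ a b : Φ, Module.Dual.eval ℝ S (root a) (coroot b) = P.pairing a b :=
    fun a b => rfl
  have hrefl : ∀ a b : Φ, Module.preReflection (root a)
      ((Module.Dual.eval ℝ S).flip (coroot a)) (root b) = root ⟨_, hΦ a a.2 b b.2⟩ := fun a b => by
    apply Subtype.ext
    change P.root b - P.pairing b a • P.root a = P.root (P.reflectionPerm a b)
    rw [RootPairing.root_reflectionPerm, RootPairing.reflection_apply]
    rfl
  have hs : ∀ a : Φ, Set.MapsTo (Module.preReflection (root a)
      ((Module.Dual.eval ℝ S).flip (coroot a))) (Set.range root) (Set.range root) := by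
    rintro a - ⟨b, rfl⟩
    exact ⟨_, (hrefl a b).symm⟩
  have hsp : Submodule.span ℝ (Set.range root) = ⊤ := by
    have : Set.range root = ((↑) : S → E) ⁻¹' (P.root '' Φ) := by
      ext x
      constructor
      · rintro ⟨a, rfl⟩
        exact ⟨a, a.2, rfl⟩
      · rintro ⟨i, hi, h⟩
        exact ⟨⟨i, hi⟩, Subtype.ext h⟩
    rw [this, Submodule.span_span_coe_preimage]
  have hint : ∀ a b : Φ, ∃ z : ℤ, z = Module.Dual.eval ℝ S (root a) (coroot b) := fun a b => by
    obtain ⟨z, hz⟩ := P.exists_value (S := ℤ) a b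
    exact ⟨z, by rw [hpair, ← hz]; rfl⟩
  refine ⟨RootPairing.mk'' (Module.Dual.eval ℝ S) root coroot
    (fun a => by rw [hpair, RootPairing.pairing_same]) hs hsp, fun a => rfl,
    RootPairing.isRootSystem_mk'' hint, ⟨hint⟩, fun a b => ?_, fun v => ?_⟩
  · set Q := RootPairing.mk'' (Module.Dual.eval ℝ S) root coroot
      (fun a => by rw [hpair, RootPairing.pairing_same]) hs hsp
    have h1 : Q.root (Q.reflectionPerm a b) = Q.root ⟨_, hΦ a a.2 b b.2⟩ := by
      rw [RootPairing.root_reflectionPerm, RootPairing.reflection_apply]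
      exact hrefl a b
    exact congrArg Subtype.val (Q.root.injective h1)
  -- A functional on the span extends to `E`, and by the perfect pairing it comes from a vector of
  -- `V`.
  · obtain ⟨f, hf⟩ := LinearMap.exists_extend v
    refine ⟨P.flip.toPerfPair.symm f, fun a => ?_⟩
    have h1 : P.root' a (P.flip.toPerfPair.symm f) = f (P.root a) := by
      have := P.flip.toPerfPair.apply_symm_apply f
      exact LinearMap.congr_fun this (P.root a)
    rw [h1]
    exact LinearMap.congr_fun hf (root a)

end SubRootSystem

end LocalRootDatum

namespace LocalRootDatum

namespace RValuation

/-! ### Roots that are constant on a subset of the apartment -/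

section Level

variable {ι E V G R A : Type*} [AddCommGroup E] [Module ℝ E] [AddCommGroup V]
  [Module ℝ V] [Group G] [AddCommGroup R]
  {P : RootPairing ι ℝ E V} [P.IsCrystallographic]
  [AddTorsor (VR P R) A] {o : A} {Ω : Set A}

variable (P o Ω) in
/-- The root `-α` takes the constant value `l` on `Ω`. -/
def HasLevel (i : ι) (l : R) : Prop := ∀ x ∈ Ω, -rootEval P i (x -ᵥ o) = l

namespace HasLevel

theorem mem_rootsStar {i : ι} {l : R} (h : HasLevel P o Ω i l) : i ∈ rootsStar P R o Ω := ⟨l, h⟩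

theorem unique (hΩ : Ω.Nonempty) {i : ι} {l m : R} (h : HasLevel P o Ω i l)
    (h' : HasLevel P o Ω i m) : l = m := by
  obtain ⟨x, hx⟩ := hΩ
  rw [← h x hx, h' x hx]

theorem negIdx {i : ι} {l : R} (h : HasLevel P o Ω i l) :
    HasLevel P o Ω (negIdx P i) (-l) := fun x hx => by
  rw [rootEval_negIdx, h x hx]

theorem double {i j : ι} (hij : P.root j = (2 : ℝ) • P.root i) {l : R}
    (h : HasLevel P o Ω i l) : HasLevel P o Ω j (l + l) := fun x hx => by
  rw [rootEval_of_two hij, neg_add, h x hx]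

theorem exists_reflectionPerm {i j : ι} {l m : R} (h : HasLevel P o Ω i l)
    (h' : HasLevel P o Ω j m) : ∃ k, HasLevel P o Ω (P.reflectionPerm i j) k :=
  ⟨m - P.pairingIn ℤ j i • l, fun x hx => by
    rw [rootEval_reflectionPerm, ← h x hx, ← h' x hx, smul_neg]; abel⟩

variable [LinearOrder R] {U : ι → Subgroup G} {M : ι → Set G} (w : RValuation P U M R)

theorem rootGroup_eq (hΩ : Ω.Nonempty) {i : ι} {l : R} (h : HasLevel P o Ω i l) :
    w.rootGroup o Ω i = w.subgroupGE i l := by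
  obtain ⟨x, hx⟩ := hΩ
  rw [w.rootGroup_of_const h.mem_rootsStar hx, h x hx]

theorem rootGroupStar_eq (hΩ : Ω.Nonempty) {i : ι} {l : R} (h : HasLevel P o Ω i l) :
    w.rootGroupStar o Ω i = w.subgroupGT i l := by
  obtain ⟨x, hx⟩ := hΩ
  rw [w.rootGroupStar_of_mem h.mem_rootsStar, w.rootGroupPrime_of_const h.mem_rootsStar hx, h x hx]

end HasLevel

end Level

/-! ### The local roots -/

section LocalRoots

variable {ι E V G R : Type*} [AddCommGroup E] [Module ℝ E] [AddCommGroup V]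
  [Module ℝ V] [Group G]
  {P : RootPairing ι ℝ E V} {U : ι → Subgroup G}

theorem _root_.LocalRootDatum.mem_doubleGroup_iff {i : ι} {g : G} :
    g ∈ doubleGroup P U i ↔ g = 1 ∨ ∃ j, P.root j = (2 : ℝ) • P.root i ∧ g ∈ U j := by
  constructor
  · intro hg
    by_cases h : ∃ j, P.root j = (2 : ℝ) • P.root i
    · obtain ⟨j, hj⟩ := h
      refine Or.inr ⟨j, hj, ?_⟩
      have hle : doubleGroup P U i ≤ U j := iSup₂_le fun k hk => by
        rw [P.root.injective (hk.trans hj.symm)]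
      exact hle hg
    · push Not at h
      have hle : doubleGroup P U i ≤ ⊥ := iSup₂_le fun k hk => absurd hk (h k)
      exact Or.inl (Subgroup.mem_bot.1 (hle hg))
  · rintro (rfl | ⟨j, hj, hg⟩)
    · exact one_mem _
    · exact (le_iSup₂ (f := fun j (_ : P.root j = (2 : ℝ) • P.root i) => U j) j hj) hg

variable [AddCommGroup R] [LinearOrder R] {M : ι → Set G} (w : RValuation P U M R)

/-- The `U_{α,λ}` are nested, so the equality with the intersection says that `u` has the largest
value in its coset `u U_{2α}`. -/
theorem mem_valuesPrime_iff {i : ι} {l : R} : l ∈ w.valuesPrime i ↔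
    ∃ u ∈ U i, w.φ i u = l ∧ ∀ v ∈ doubleGroup P U i, w.φ i (u * v) ≤ l := by
  constructor
  · rintro ⟨u, hu, -, hl, h⟩
    refine ⟨u, hu, hl, fun v hv => ?_⟩
    have h1 : u ∈ valSet U w.φ i (w.φ i u) := ⟨hu, le_rfl⟩
    rw [h, Set.mem_iInter₂] at h1
    exact hl ▸ (h1 v hv).2
  · rintro ⟨u, hu, hl, h⟩
    refine ⟨u, hu, w.ne_one_of_φ_eq hl, hl, Set.Subset.antisymm ?_ ?_⟩
    · exact fun g hg => Set.mem_iInter₂.2 fun v hv => ⟨hg.1, (h v hv).trans (hl ▸ hg.2)⟩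
    · intro g hg
      have := Set.mem_iInter₂.1 hg 1 (one_mem _)
      rwa [mul_one] at this

variable {A : Type*} [P.IsCrystallographic] [AddTorsor (VR P R) A] {o : A} {Ω : Set A}

theorem mem_localRoots {i : ι} :
    i ∈ w.localRoots o Ω ↔ ∃ l ∈ w.valuesPrime i, HasLevel P o Ω i l := Iff.rfl

variable [IsOrderedAddMonoid R] {T : Subgroup G} (hd : IsRootGroupDatum P T U M)
  {ν : groupN M →* affGroup P R A} (hν : IsCompatibleAction w o ν) (hΩ : Ω.Nonempty)

omit [AddTorsor (VR P R) A] [P.IsCrystallographic] in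
theorem coe_le_iff_coe_add_le {a c : R} {x : WithTop R} :
    ((a + c : R) : WithTop R) ≤ x + c ↔ (a : WithTop R) ≤ x := by
  induction x using WithTop.recTopCoe with
  | top => simp
  | coe b => rw [← WithTop.coe_add, WithTop.coe_le_coe, WithTop.coe_le_coe, add_le_add_iff_right]

include hd in
omit [P.IsCrystallographic] in
-- Conjugation by `m` respects the cosets of the groups `U_{2β}` and shifts the values, so it
-- preserves maxima.
theorem valuesPrime_of_conj {i j : ι} {m : G} (hm : m ∈ M i) {c a : R}
    (h : ∀ u ∈ U j, w.φ (P.reflectionPerm i j) (m * u * m⁻¹) = w.φ j u + c)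
    (ha : a ∈ w.valuesPrime j) : a + c ∈ w.valuesPrime (P.reflectionPerm i j) := by
  rw [mem_valuesPrime_iff] at ha ⊢
  obtain ⟨u, hu, hua, hmax⟩ := ha
  refine ⟨m * u * m⁻¹, hd.conj_mem hm hu, by rw [h u hu, hua, WithTop.coe_add], fun v hv => ?_⟩
  have hv' : m⁻¹ * v * m ∈ doubleGroup P U j := by
    rw [mem_doubleGroup_iff] at hv ⊢
    rcases hv with rfl | ⟨k, hk, hv⟩
    · left; group
    · refine Or.inr ⟨P.reflectionPerm i k, ?_, ?_⟩
      · rw [RootPairing.root_reflectionPerm, hk, map_smul, RootPairing.root_reflectionPerm]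
        simp
      · rw [← hd.conj_mem_iff hm]
        convert hv using 1
        · simp
        · group
  have e : m * u * m⁻¹ * v = m * (u * (m⁻¹ * v * m)) * m⁻¹ := by group
  have huv : u * (m⁻¹ * v * m) ∈ U j := by
    refine mul_mem hu ?_
    rcases mem_doubleGroup_iff.1 hv' with h1 | ⟨k, hk, h1⟩
    · rw [h1]; exact one_mem _
    · exact hd.double_le hk h1
  rw [e, h _ huv, WithTop.coe_add]
  gcongr
  exact hmax _ hv'

include hd hΩ in
omit [IsOrderedAddMonoid R] in
theorem mem_localGroup_of_mem_valuedCoset [Finite ι] {i : ι} {l : R} (h : HasLevel P o Ω i l)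
    {m : G} (hm : m ∈ w.valuedCoset i l) : m ∈ w.localGroup o Ω := by
  obtain ⟨hm, -, ⟨a, ha, u, ⟨hu, hl⟩, rfl⟩, b, hb, rfl⟩ := hm
  have hle : ∀ j, w.rootGroup o Ω j ≤ w.localGroup o Ω := le_iSup _
  refine mul_mem (mul_mem (hle (negIdx P i) ?_) (hle i ?_)) (hle (negIdx P i) ?_)
  · rw [h.negIdx.rootGroup_eq w hΩ]
    exact ⟨ha, (w.φ_opposite hl hu ha hb hm).ge⟩
  · rw [h.rootGroup_eq w hΩ]
    exact ⟨hu, hl.ge⟩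
  · rw [h.negIdx.rootGroup_eq w hΩ]
    exact ⟨hb, (w.φ_opposite' hd hl hu ha hb hm).ge⟩

variable [Finite ι]

include hd

omit [P.IsCrystallographic] [IsOrderedAddMonoid R] in
theorem exists_mem_valuedCoset {i : ι} {l : R} (h : l ∈ w.valuesPrime i) :
    ∃ m, m ∈ w.valuedCoset i l := by
  obtain ⟨u, hu, hl, -⟩ := w.mem_valuesPrime_iff.1 h
  obtain ⟨-, m, -, -, -, -, -, hm, -⟩ := w.exists_valuedCoset hd hu hl
  exact ⟨m, hm⟩

include hν hΩ

/-- If the conjugate of `u` had a value above `b`, it would lie in `U*_Ω`. By normality so would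
`u`, whose value `a` is too small for `U*_Ω ∩ U_β = U'_{β,a}`. -/
theorem add_le_of_conj {j k : ι} {g : G} (hg : g ∈ w.localGroup o Ω) {a b c : R}
    (hconj : ∀ u ∈ U j, g * u * g⁻¹ ∈ U k ∧ w.φ k (g * u * g⁻¹) = w.φ j u + c)
    (hj : HasLevel P o Ω j a) (hk : HasLevel P o Ω k b) {u : G} (hu : u ∈ U j)
    (hua : w.φ j u = a) : a + c ≤ b := by
  by_contra! hlt
  obtain ⟨h1, h2⟩ := hconj u hu
  have h3 : g * u * g⁻¹ ∈ w.localGroupStar o Ω T := by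
    apply w.rootGroupStar_le_localGroupStar k
    rw [hk.rootGroupStar_eq w hΩ]
    refine ⟨h1, ?_⟩
    rw [h2, hua]
    exact WithTop.coe_lt_coe.2 hlt
  have h4 := w.conj_mem_localGroupStar hd hν hΩ (inv_mem hg) h3
  have e : g⁻¹ * (g * u * g⁻¹) * g⁻¹⁻¹ = u := by group
  rw [e] at h4
  have h5 := w.mem_rootGroupStar_of_mem hd hν hΩ h4 hu
  rw [hj.rootGroupStar_eq w hΩ] at h5
  exact absurd (hua ▸ h5.2) (lt_irrefl _)

/-- The elements of `M_{α,l}`, where `l` is the value of `-α` on `Ω`, shift the values of the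
elements of `U_β` as the reflection of `α` shifts the value of `β` on `Ω`. -/
theorem exists_shift_hasLevel {i j : ι} {m : G} {l a : R} (hi : HasLevel P o Ω i l)
    (hm : m ∈ w.valuedCoset i l) (hj : HasLevel P o Ω j a) {u : G} (hu : u ∈ U j)
    (hua : w.φ j u = a) : ∃ c : R, HasLevel P o Ω (P.reflectionPerm i j) (a + c) ∧
      ∀ u ∈ U j, w.φ (P.reflectionPerm i j) (m * u * m⁻¹) = w.φ j u + c := by
  obtain ⟨y, hy, -⟩ := w.exists_shift hd hν hm.1
  obtain ⟨b, hb⟩ := hi.exists_reflectionPerm hj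
  have hml := w.mem_localGroup_of_mem_valuedCoset hd hΩ hi hm
  have h1 := w.add_le_of_conj hd hν hΩ hml (fun u hu => ⟨hd.conj_mem hm.1 hu, hy j u hu⟩) hj hb
    hu hua
  -- An element of `U_{-β}` of value `-a`. The bound for `-β` is the reverse of the bound for `β`,
  -- so equality holds.
  obtain ⟨p, -, -, hp, -, hpa, -⟩ := w.exists_valuedCoset hd hu hua
  have hb' := hb.negIdx
  rw [← reflectionPerm_negIdx] at hb'
  have h2 := w.add_le_of_conj hd hν hΩ hml
    (fun u hu => ⟨hd.conj_mem hm.1 hu, hy (negIdx P j) u hu⟩) hj.negIdx hb' hp hpa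
  rw [rootEval_negIdx, ← neg_add, neg_le_neg_iff] at h2
  rw [le_antisymm h2 h1] at hb
  exact ⟨_, hb, hy j⟩

theorem reflectionPerm_mem_localRoots {i j : ι} (hi : i ∈ w.localRoots o Ω)
    (hj : j ∈ w.localRoots o Ω) : P.reflectionPerm i j ∈ w.localRoots o Ω := by
  obtain ⟨l, hl, hil⟩ := w.mem_localRoots.1 hi
  obtain ⟨a, ha, hja⟩ := w.mem_localRoots.1 hj
  obtain ⟨m, hm⟩ := w.exists_mem_valuedCoset hd hl
  obtain ⟨u, hu, hua, -⟩ := w.mem_valuesPrime_iff.1 ha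
  obtain ⟨c, hc, h⟩ := w.exists_shift_hasLevel hd hν hΩ hil hm hja hu hua
  exact ⟨a + c, w.valuesPrime_of_conj hd hm.1 h ha, hc⟩

theorem conj_mem_rootGroup_iff {i j : ι} {l : R} (hi : HasLevel P o Ω i l) {m : G}
    (hm : m ∈ w.valuedCoset i l) (hj : j ∈ w.localRoots o Ω) {g : G} :
    m * g * m⁻¹ ∈ w.rootGroup o Ω (P.reflectionPerm i j) ↔ g ∈ w.rootGroup o Ω j := by
  obtain ⟨a, ha, hja⟩ := w.mem_localRoots.1 hj
  obtain ⟨u, hu, hua, -⟩ := w.mem_valuesPrime_iff.1 ha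
  obtain ⟨c, hc, h⟩ := w.exists_shift_hasLevel hd hν hΩ hi hm hja hu hua
  rw [hc.rootGroup_eq w hΩ, hja.rootGroup_eq w hΩ, mem_subgroupGE, mem_subgroupGE,
    hd.conj_mem_iff hm.1]
  refine and_congr_right fun hg => ?_
  rw [h g hg, coe_le_iff_coe_add_le]

/-- The bound of `add_le_of_conj` for `t⁻¹` says that its shift is at most `0`, so conjugation by
`t` does not lower the values. -/
theorem torus_conj_mem_rootGroup {j : ι} {t : G} (ht : t ∈ w.localTorus o Ω T)
    (hj : j ∈ w.localRoots o Ω) {g : G} (hg : g ∈ w.rootGroup o Ω j) :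
    t * g * t⁻¹ ∈ w.rootGroup o Ω j := by
  obtain ⟨a, ha, hja⟩ := w.mem_localRoots.1 hj
  obtain ⟨u, hu, hua, -⟩ := w.mem_valuesPrime_iff.1 ha
  obtain ⟨c, hc⟩ := w.exists_torus_shift hd hν (T.inv_mem ht.2) j
  have h1 := w.add_le_of_conj hd hν hΩ (inv_mem ht.1)
    (fun u hu => ⟨hd.torus_conj_mem (T.inv_mem ht.2) hu, hc u hu⟩) hja hja hu hua
  rw [add_le_iff_nonpos_right] at h1
  rw [hja.rootGroup_eq w hΩ] at hg ⊢
  have h2 := hd.torus_conj_mem ht.2 hg.1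
  refine ⟨h2, hg.2.trans ?_⟩
  have h3 := hc _ h2
  have e : t⁻¹ * (t * g * t⁻¹) * t⁻¹⁻¹ = g := by group
  rw [e] at h3
  rw [h3]
  calc w.φ j (t * g * t⁻¹) + (c : WithTop R) ≤ w.φ j (t * g * t⁻¹) + ((0 : R) : WithTop R) := by
        gcongr
        exact WithTop.coe_le_coe.2 h1
    _ = _ := by rw [WithTop.coe_zero, add_zero]

omit [IsOrderedAddMonoid R] hν in
/-- Modulo `U*_Ω`, the group `U_{α,Ω}` of a root `α` that is not a local root is trivial or
contained in `U_{2α,Ω}`. -/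
theorem mem_localGroupStar_or_exists_double {k : ι} (hk : k ∉ w.localRoots o Ω) {u : G}
    (hu : u ∈ w.rootGroup o Ω k) : u ∈ w.localGroupStar o Ω T ∨
      ∃ j ∈ w.localRoots o Ω, P.root j = (2 : ℝ) • P.root k ∧
        ∃ v ∈ w.rootGroup o Ω j, v⁻¹ * u ∈ w.localGroupStar o Ω T := by
  have hstar := w.rootGroupStar_le_localGroupStar (o := o) (Ω := Ω) (T := T) k
  by_cases hc : k ∈ rootsStar P R o Ω
  swap
  · rw [w.rootGroupStar_of_notMem hc] at hstar
    exact Or.inl (hstar hu)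
  obtain ⟨a, ha : HasLevel P o Ω k a⟩ := hc
  rw [ha.rootGroup_eq w hΩ] at hu
  rw [ha.rootGroupStar_eq w hΩ] at hstar
  rcases hu.2.lt_or_eq with h | hua
  · exact Or.inl (hstar ⟨hu.1, h⟩)
  -- As `k` is not a local root, `u⁻¹` is not maximal in its coset: some `v ∈ U_{2α}` agrees with
  -- `u` modulo `U'_{α,a}`.
  have hmax : ¬ ∀ v ∈ doubleGroup P U k, w.φ k (u⁻¹ * v) ≤ a := fun h =>
    hk ⟨a, w.mem_valuesPrime_iff.2 ⟨u⁻¹, inv_mem hu.1, by rw [w.φ_inv hu.1, hua], h⟩, ha⟩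
  push Not at hmax
  obtain ⟨v, hv, hlt⟩ := hmax
  rcases mem_doubleGroup_iff.1 hv with rfl | ⟨j, hj, hvj⟩
  · rw [mul_one, w.φ_inv hu.1, hua] at hlt
    exact absurd hlt (lt_irrefl _)
  have hvk := hd.double_le hj hvj
  have huv : u⁻¹ * v ∈ w.subgroupGT k a := ⟨mul_mem (inv_mem hu.1) hvk, hlt⟩
  have hφ : w.φ k v = a := by
    have := w.φ_mul_of_lt hu.1 huv.1 (by rw [← hua]; exact hlt)
    rwa [mul_inv_cancel_left, ← hua] at this
  have hφj := w.φ_of_double hj hvj hφ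
  have hja := ha.double hj
  -- Maximality of `v` is automatic because `4α` is not a root.
  refine Or.inr ⟨j, ⟨a + a, w.mem_valuesPrime_iff.2 ⟨v, hvj, hφj, fun x hx => ?_⟩, hja⟩, hj, v, ?_,
    ?_⟩
  · rcases mem_doubleGroup_iff.1 hx with rfl | ⟨k', hk', -⟩
    · rw [mul_one, hφj]
    · exact absurd hk' (root_ne_two_smul_of_eq_two_smul hj)
  · rw [hja.rootGroup_eq w hΩ]
    exact ⟨hvj, hφj.ge⟩
  · have := inv_mem (hstar huv)
    rwa [mul_inv_rev, inv_inv] at this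

end LocalRoots

end RValuation

end LocalRootDatum

namespace LocalRootDatum

namespace RValuation

/-! ### The quotient of a local group -/

section Quotient

variable {ι E V G R A : Type*} [AddCommGroup E] [Module ℝ E] [AddCommGroup V]
  [Module ℝ V] [Group G] [AddCommGroup R] [LinearOrder R]
  {P : RootPairing ι ℝ E V} [P.IsCrystallographic] {U : ι → Subgroup G} {M : ι → Set G}
  (w : RValuation P U M R) [AddTorsor (VR P R) A] {o : A} {Ω : Set A} {T : Subgroup G}
  [hN : (w.localKernel o Ω T).Normal]

theorem rootGroup_le_localGroup (i : ι) : w.rootGroup o Ω i ≤ w.localGroup o Ω :=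
  le_iSup (w.rootGroup o Ω) i

variable (o Ω T) in
/-- The projection of `U_Ω` onto `U_Ω / U*_Ω`. -/
noncomputable abbrev proj : w.localGroup o Ω →* w.localGroup o Ω ⧸ w.localKernel o Ω T :=
  QuotientGroup.mk' _

theorem proj_eq_one_iff {g : w.localGroup o Ω} :
    w.proj o Ω T g = 1 ↔ (g : G) ∈ w.localGroupStar o Ω T := by
  rw [QuotientGroup.mk'_apply, QuotientGroup.eq_one_iff, Subgroup.mem_subgroupOf]

theorem proj_eq_iff {g h : w.localGroup o Ω} :
    w.proj o Ω T g = w.proj o Ω T h ↔ (g : G) * (h : G)⁻¹ ∈ w.localGroupStar o Ω T := by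
  rw [← mul_inv_eq_one, ← map_inv, ← map_mul, proj_eq_one_iff]
  rfl

theorem mem_rootGroupBar {i : ι} {x : w.localGroup o Ω ⧸ w.localKernel o Ω T} :
    x ∈ w.rootGroupBar o Ω T i ↔
      ∃ u : w.localGroup o Ω, (u : G) ∈ w.rootGroup o Ω i ∧ w.proj o Ω T u = x := Iff.rfl

theorem mem_torusBar {x : w.localGroup o Ω ⧸ w.localKernel o Ω T} :
    x ∈ w.torusBar o Ω T ↔ ∃ t : w.localGroup o Ω, (t : G) ∈ T ∧ w.proj o Ω T t = x :=
  ⟨fun ⟨t, ht, h⟩ => ⟨t, (Subgroup.mem_subgroupOf.1 ht).2, h⟩,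
    fun ⟨t, ht, h⟩ => ⟨t, Subgroup.mem_subgroupOf.2 ⟨t.2, ht⟩, h⟩⟩

theorem mem_cosetBar (hΩ : Ω.Nonempty) {i : ι} {l : R} (h : HasLevel P o Ω i l)
    {x : w.localGroup o Ω ⧸ w.localKernel o Ω T} :
    x ∈ w.cosetBar o Ω T i ↔ ∃ t m : w.localGroup o Ω, (t : G) ∈ T ∧
      (m : G) ∈ w.valuedCoset i l ∧ w.proj o Ω T (t * m) = x := by
  constructor
  · rintro ⟨y, hy, -, ⟨m, ⟨l', hl', hm⟩, rfl⟩, rfl⟩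
    obtain ⟨t, ht, rfl⟩ := w.mem_torusBar.1 hy
    rw [HasLevel.unique hΩ hl' h] at hm
    exact ⟨t, m, ht, hm, map_mul _ _ _⟩
  · rintro ⟨t, m, ht, hm, rfl⟩
    exact ⟨_, w.mem_torusBar.2 ⟨t, ht, rfl⟩, _, ⟨m, ⟨l, h, hm⟩, rfl⟩, (map_mul _ _ _).symm⟩

/-- The elements of `U_Ω` with image in `S`. -/
noncomputable def pullback (S : Subgroup (w.localGroup o Ω ⧸ w.localKernel o Ω T)) : Subgroup G :=
  (S.comap (w.proj o Ω T)).map (w.localGroup o Ω).subtype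

theorem mem_pullback {S : Subgroup (w.localGroup o Ω ⧸ w.localKernel o Ω T)}
    {g : w.localGroup o Ω} : (g : G) ∈ w.pullback S ↔ w.proj o Ω T g ∈ S := by
  constructor
  · rintro ⟨h, hh, e⟩
    rwa [Subtype.ext e] at hh
  · exact fun h => ⟨g, h, rfl⟩

theorem localGroupStar_le_pullback (S : Subgroup (w.localGroup o Ω ⧸ w.localKernel o Ω T)) :
    w.localGroupStar o Ω T ≤ w.pullback S := fun g hg => by
  refine (w.mem_pullback (g := ⟨g, w.localGroupStar_le hg⟩)).2 ?_
  rw [w.proj_eq_one_iff.2 hg]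
  exact one_mem S

theorem rootGroup_le_pullback {S : Subgroup (w.localGroup o Ω ⧸ w.localKernel o Ω T)} {i : ι}
    (h : w.rootGroupBar o Ω T i ≤ S) : w.rootGroup o Ω i ≤ w.pullback S := fun u hu =>
  (w.mem_pullback (g := ⟨u, w.rootGroup_le_localGroup i hu⟩)).2
    (h (w.mem_rootGroupBar.2 ⟨_, hu, rfl⟩))

omit hN in
theorem exists_mem_rootGroup_lift (hΩ : Ω.Nonempty) {i : ι} {l : R} (hl : l ∈ w.valuesPrime i)
    (hi : HasLevel P o Ω i l) : ∃ u : w.localGroup o Ω, (u : G) ∈ w.rootGroup o Ω i ∧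
      w.φ i u = l ∧ ∀ v ∈ doubleGroup P U i, w.φ i (u * v) ≤ l := by
  obtain ⟨u, hu, hul, hmax⟩ := w.mem_valuesPrime_iff.1 hl
  have hug : u ∈ w.rootGroup o Ω i := by
    rw [hi.rootGroup_eq w hΩ]
    exact ⟨hu, hul.ge⟩
  exact ⟨⟨u, w.rootGroup_le_localGroup i hug⟩, hug, hul, hmax⟩

variable [Finite ι] [IsOrderedAddMonoid R] (hd : IsRootGroupDatum P T U M)
  {ν : groupN M →* affGroup P R A} (hν : IsCompatibleAction w o ν) (hΩ : Ω.Nonempty)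

include hd hΩ in
omit [IsOrderedAddMonoid R] in
/-- To bound the image of `U_{α,Ω}`, it suffices to bound the images of the `U_{β,Ω}` for the
local roots `β` among `α` and `2α`. -/
theorem rootGroup_le_pullback_of_localRoots
    {S : Subgroup (w.localGroup o Ω ⧸ w.localKernel o Ω T)} {k : ι}
    (h1 : k ∈ w.localRoots o Ω → w.rootGroupBar o Ω T k ≤ S)
    (h2 : ∀ j ∈ w.localRoots o Ω, P.root j = (2 : ℝ) • P.root k → w.rootGroupBar o Ω T j ≤ S) :
    w.rootGroup o Ω k ≤ w.pullback S := by
  by_cases hk : k ∈ w.localRoots o Ω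
  · exact w.rootGroup_le_pullback (h1 hk)
  intro u hu
  rcases w.mem_localGroupStar_or_exists_double hd hΩ hk hu (T := T) with h | ⟨j, hj, hjk, v, hv, h⟩
  · exact w.localGroupStar_le_pullback S h
  · have := mul_mem (w.rootGroup_le_pullback (h2 j hj hjk) hv) (w.localGroupStar_le_pullback S h)
    rwa [mul_inv_cancel_left] at this

include hd hΩ in
omit [IsOrderedAddMonoid R] in
theorem isGeneratingDatum_bar : IsGeneratingDatum (w.torusBar o Ω T)
    (fun a : w.localRoots o Ω => w.rootGroupBar o Ω T a) := by
  rw [IsGeneratingDatum, eq_top_iff]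
  intro x _
  obtain ⟨g, rfl⟩ := QuotientGroup.mk'_surjective _ x
  refine w.mem_pullback.1 ((iSup_le fun k => ?_ : w.localGroup o Ω ≤ w.pullback _) g.2)
  have h : ∀ j ∈ w.localRoots o Ω, w.rootGroupBar o Ω T j ≤
      w.torusBar o Ω T ⊔ ⨆ a : w.localRoots o Ω, w.rootGroupBar o Ω T a := fun j hj =>
    le_sup_of_le_right (le_iSup (fun a : w.localRoots o Ω => w.rootGroupBar o Ω T a) ⟨j, hj⟩)
  exact w.rootGroup_le_pullback_of_localRoots hd hΩ (h k) fun j hj _ => h j hj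

include hd hν hΩ

theorem mem_subgroupGT_of_proj_eq {i j : ι} (hij : i = j ∨ P.root j = (2 : ℝ) • P.root i) {l : R}
    (hi : HasLevel P o Ω i l) {u v : w.localGroup o Ω} (hu : (u : G) ∈ U i) (hv : (v : G) ∈ U j)
    (h : w.proj o Ω T u = w.proj o Ω T v) : (u : G) * (v : G)⁻¹ ∈ w.subgroupGT i l := by
  rw [← hi.rootGroupStar_eq w hΩ]
  refine w.mem_rootGroupStar_of_mem hd hν hΩ (w.proj_eq_iff.1 h) (mul_mem hu (inv_mem ?_))
  rcases hij with rfl | hij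
  · exact hv
  · exact hd.double_le hij hv

theorem rootGroupBar_ne_bot {i : ι} (hi : i ∈ w.localRoots o Ω) : w.rootGroupBar o Ω T i ≠ ⊥ := by
  obtain ⟨l, hl, hil⟩ := w.mem_localRoots.1 hi
  obtain ⟨u, hu, hul, -⟩ := w.exists_mem_rootGroup_lift hΩ hl hil
  intro hbot
  have h1 : w.proj o Ω T u ∈ w.rootGroupBar o Ω T i := w.mem_rootGroupBar.2 ⟨u, hu, rfl⟩
  rw [hbot, Subgroup.mem_bot, ← map_one (w.proj o Ω T)] at h1
  have h2 := w.mem_subgroupGT_of_proj_eq hd hν hΩ (Or.inl rfl) hil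
    ((w.isUpper_rootGroup hΩ i).le hu) (one_mem _) h1
  rw [Subgroup.coe_one, inv_one, mul_one] at h2
  exact absurd (hul ▸ h2.2) (lt_irrefl _)

/-- A `u` of maximal value `l` in its coset of `U_{2α}` is not congruent to any `v ∈ U_{2α,Ω}`,
since `u v⁻¹` would have value above `l`. -/
theorem rootGroupBar_double_lt {i j : ι} (h : P.root j = (2 : ℝ) • P.root i)
    (hi : i ∈ w.localRoots o Ω) : w.rootGroupBar o Ω T j < w.rootGroupBar o Ω T i := by
  obtain ⟨l, hl, hil⟩ := w.mem_localRoots.1 hi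
  obtain ⟨u, hu, hul, hmax⟩ := w.exists_mem_rootGroup_lift hΩ hl hil
  refine SetLike.lt_iff_le_and_exists.2 ⟨?_, _, w.mem_rootGroupBar.2 ⟨u, hu, rfl⟩, fun hu' => ?_⟩
  · rintro _ ⟨v, hv, rfl⟩
    exact w.mem_rootGroupBar.2 ⟨v, w.rootGroup_double_le hΩ hd h hv, rfl⟩
  · obtain ⟨v, hv, hvu⟩ := w.mem_rootGroupBar.1 hu'
    have hvU := (w.isUpper_rootGroup hΩ j).le hv
    have h2 := w.mem_subgroupGT_of_proj_eq hd hν hΩ (Or.inr h) hil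
      ((w.isUpper_rootGroup hΩ i).le hu) hvU hvu.symm
    exact absurd h2.2 (not_lt.2 (hmax _ (mem_doubleGroup_iff.2 (Or.inr ⟨j, h, inv_mem hvU⟩))))

omit [IsOrderedAddMonoid R] hν in
theorem isCoset_cosetBar {i : ι} (hi : i ∈ w.localRoots o Ω) :
    ∃ m, w.cosetBar o Ω T i = {g | ∃ t ∈ w.torusBar o Ω T, g = t * m} := by
  obtain ⟨l, hl, hil⟩ := w.mem_localRoots.1 hi
  obtain ⟨m, hm⟩ := w.exists_mem_valuedCoset hd hl
  lift m to w.localGroup o Ω using w.mem_localGroup_of_mem_valuedCoset hd hΩ hil hm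
  refine ⟨w.proj o Ω T m, Set.ext fun x => ?_⟩
  rw [w.mem_cosetBar hΩ hil]
  constructor
  · rintro ⟨t, n, ht, hn, rfl⟩
    refine ⟨_, w.mem_torusBar.2 ⟨t * (n * m⁻¹), mul_mem ht (hd.mul_inv_mem_torus hn.1 hm.1), rfl⟩,
      ?_⟩
    rw [← map_mul]
    congr 1
    group
  · rintro ⟨y, hy, rfl⟩
    obtain ⟨t, ht, rfl⟩ := w.mem_torusBar.1 hy
    exact ⟨t, m, ht, hm, map_mul _ _ _⟩

omit [IsOrderedAddMonoid R] hν in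
-- A nontrivial image means that the lift has value exactly `-l`. Then its decomposition through
-- `M_{α,l}` has outer factors of value `l`, and all three factors lie in `U_Ω`.
theorem mem_mul_cosetBar_mul {i : ι} (hi : i ∈ w.localRoots o Ω)
    {x : w.localGroup o Ω ⧸ w.localKernel o Ω T} (hx : x ∈ w.rootGroupBar o Ω T (negIdx P i))
    (hx1 : x ≠ 1) : x ∈ (w.rootGroupBar o Ω T i : Set (w.localGroup o Ω ⧸ w.localKernel o Ω T)) *
      w.cosetBar o Ω T i * (w.rootGroupBar o Ω T i : Set _) := by
  obtain ⟨l, hl, hil⟩ := w.mem_localRoots.1 hi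
  obtain ⟨u, hu, rfl⟩ := w.mem_rootGroupBar.1 hx
  rw [hil.negIdx.rootGroup_eq w hΩ] at hu
  have hul : w.φ (negIdx P i) u = ((-l : R) : WithTop R) := by
    refine (hu.2.eq_of_not_lt fun hlt => hx1 (w.proj_eq_one_iff.2 ?_)).symm
    apply w.rootGroupStar_le_localGroupStar (negIdx P i)
    rw [hil.negIdx.rootGroupStar_eq w hΩ]
    exact ⟨hu.1, hlt⟩
  obtain ⟨a, m, b, ha, hb, hal, hbl, hm, hamb⟩ := w.exists_valuedCoset hd hu.1 hul
  rw [negIdx_negIdx] at ha hb hal hbl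
  rw [w.valuedCoset_negIdx hd] at hm
  rw [neg_neg] at hal hbl
  have hag : a ∈ w.rootGroup o Ω i := by
    rw [hil.rootGroup_eq w hΩ]
    exact ⟨ha, hal.ge⟩
  have hbg : b ∈ w.rootGroup o Ω i := by
    rw [hil.rootGroup_eq w hΩ]
    exact ⟨hb, hbl.ge⟩
  lift a to w.localGroup o Ω using w.rootGroup_le_localGroup i hag
  lift b to w.localGroup o Ω using w.rootGroup_le_localGroup i hbg
  lift m to w.localGroup o Ω using w.mem_localGroup_of_mem_valuedCoset hd hΩ hil hm
  have e : u = a * (1 * m) * b := Subtype.ext (by rw [hamb]; simp)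
  rw [e, map_mul, map_mul]
  exact Set.mul_mem_mul (Set.mul_mem_mul (w.mem_rootGroupBar.2 ⟨a, hag, rfl⟩)
    ((w.mem_cosetBar hΩ hil).2 ⟨1, m, one_mem _, hm, rfl⟩)) (w.mem_rootGroupBar.2 ⟨b, hbg, rfl⟩)

theorem map_conj_rootGroupBar {i j : ι} (hi : i ∈ w.localRoots o Ω) (hj : j ∈ w.localRoots o Ω)
    {x : w.localGroup o Ω ⧸ w.localKernel o Ω T} (hx : x ∈ w.cosetBar o Ω T i) :
    (w.rootGroupBar o Ω T j).map (MulAut.conj x).toMonoidHom =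
      w.rootGroupBar o Ω T (P.reflectionPerm i j) := by
  obtain ⟨l, hl, hil⟩ := w.mem_localRoots.1 hi
  obtain ⟨t, m, ht, hm, rfl⟩ := (w.mem_cosetBar hΩ hil).1 hx
  have hij := w.reflectionPerm_mem_localRoots hd hν hΩ hi hj
  ext y
  constructor
  · rintro ⟨_, ⟨g, hg, rfl⟩, rfl⟩
    refine w.mem_rootGroupBar.2 ⟨t * (m * g * m⁻¹) * t⁻¹, w.torus_conj_mem_rootGroup hd hν hΩ
      ⟨t.2, ht⟩ hij ((w.conj_mem_rootGroup_iff hd hν hΩ hil hm hj).2 hg), ?_⟩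
    simp [mul_assoc]
  · intro hy
    obtain ⟨g, hg, rfl⟩ := w.mem_rootGroupBar.1 hy
    have h1 := w.torus_conj_mem_rootGroup hd hν hΩ (inv_mem ⟨t.2, ht⟩) hij hg
    refine ⟨w.proj o Ω T (m⁻¹ * (t⁻¹ * g * t) * m), w.mem_rootGroupBar.2 ⟨_, ?_, rfl⟩, ?_⟩
    · rw [← w.conj_mem_rootGroup_iff hd hν hΩ hil hm hj]
      convert h1 using 1
      simp [mul_assoc]
    · simp [mul_assoc]

/-- By hypothesis `p⁻¹ t⁻¹ n` lies in `U*_Ω`, hence equals `a s b` in the big cell. Then `n b⁻¹`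
lies in `T U⁺ ∩ U⁻ = 1`, so `n = b ∈ U*_Ω`. -/
theorem chamberGroup_inter {v : V} (hv : IsRegular P v) {t p n : w.localGroup o Ω}
    (ht : (t : G) ∈ T) (hp : (p : G) ∈ chamberGroup P (w.rootGroup o Ω) v)
    (hn : (n : G) ∈ chamberGroup P (w.rootGroup o Ω) (-v))
    (h : w.proj o Ω T n = w.proj o Ω T (t * p)) : w.proj o Ω T n = 1 := by
  have h' : (p : G)⁻¹ * (t : G)⁻¹ * n ∈ w.localGroupStar o Ω T := by
    have : w.proj o Ω T (p⁻¹ * t⁻¹ * n) = 1 := by rw [map_mul, h]; simp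
    exact w.proj_eq_one_iff.1 this
  obtain ⟨a, ha, s, hs, b, hb, e⟩ := w.mem_bigCell_of_mem_localGroupStar hd hν hΩ hv h'
  have hle := fun i => (w.isUpper_rootGroup (o := o) hΩ i).le
  have hle' := fun i => (w.isUpper_rootGroupStar (o := o) hΩ i).le
  have hsT := w.fixedTorus_le hs
  have h1 : s⁻¹ * (p * a) * s ∈ chamberGroup P U v := by
    have h2 : (p : G) * a ∈ chamberGroup P U v :=
      mul_mem (chamberGroup_mono hle v hp) (chamberGroup_mono hle' v ha)
    have := forall_conj_mem_iSup (H := chamberGroup P U v) (x := s⁻¹) (fun j hj y hy =>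
      mem_chamberGroup hj (hd.torus_conj_mem (inv_mem hsT) hy)) h2
    rwa [inv_inv] at this
  have h2 : (n : G) * b⁻¹ ∈ chamberGroup P U (-v) :=
    mul_mem (chamberGroup_mono hle _ hn) (inv_mem (chamberGroup_mono hle' _ hb))
  have h3 := hd.eq_one_of_torus_mul_eq hv (mul_mem ht hsT) h1 h2 (by
    have : (n : G) = t * p * (a * s * b) := by rw [← e]; group
    rw [this]; group)
  rw [mul_inv_eq_one] at h3
  rw [proj_eq_one_iff, h3]
  have hsub : chamberGroup P (w.rootGroupStar o Ω) (-v) ≤ w.localGroupStar o Ω T :=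
    iSup₂_le fun i _ => w.rootGroupStar_le_localGroupStar i
  exact hsub hb

omit [Finite ι] [IsOrderedAddMonoid R] hd hν hΩ in
theorem exists_lift_of_mem_chamberGroup {q : w.localRoots o Ω → Prop} {v : V}
    (hq : ∀ a, q a → 0 < P.root' a v) {x : w.localGroup o Ω ⧸ w.localKernel o Ω T}
    (hx : x ∈ ⨆ (a) (_ : q a), w.rootGroupBar o Ω T a) : ∃ g : w.localGroup o Ω,
      (g : G) ∈ chamberGroup P (w.rootGroup o Ω) v ∧ w.proj o Ω T g = x := by
  have hle : (⨆ (a) (_ : q a), w.rootGroupBar o Ω T a) ≤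
      ((chamberGroup P (w.rootGroup o Ω) v).subgroupOf (w.localGroup o Ω)).map
        (w.proj o Ω T) := by
    refine iSup₂_le fun a ha => ?_
    rintro _ ⟨u, hu, rfl⟩
    exact ⟨u, mem_chamberGroup (hq a ha) hu, rfl⟩
  exact hle hx

theorem isRootGroupDatum_bar {E' V' : Type*} [AddCommGroup E'] [Module ℝ E'] [AddCommGroup V']
    [Module ℝ V'] (Q : RootPairing (w.localRoots o Ω) ℝ E' V') (f : E' →ₗ[ℝ] E)
    (hf : Function.Injective f) (hroot : ∀ a, f (Q.root a) = P.root a)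
    (hperm : ∀ a b, (Q.reflectionPerm a b : ι) = P.reflectionPerm a b)
    (hval : ∀ v, ∃ v' : V, ∀ a : w.localRoots o Ω, P.root' a v' = Q.root' a v) :
    IsRootGroupDatum Q (w.torusBar o Ω T) (fun a => w.rootGroupBar o Ω T a)
      (fun a => w.cosetBar o Ω T a) where
  nontrivial a := w.rootGroupBar_ne_bot hd hν hΩ a.2
  commutator_le a b hab := by
    rw [Subgroup.commutator_le]
    intro x hx y hy
    obtain ⟨u, hu, rfl⟩ := w.mem_rootGroupBar.1 hx
    obtain ⟨u', hu', rfl⟩ := w.mem_rootGroupBar.1 hy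
    rw [← map_commutatorElement, ← w.mem_pullback]
    have hab' : ∀ c : ℝ, c ≤ 0 → P.root b ≠ c • P.root a := fun c hc h => by
      rcases hc.lt_or_eq with hc | rfl
      · refine hab c hc (hf ?_)
        rw [map_smul, hroot, hroot, h]
      · exact P.ne_zero _ (h.trans (zero_smul _ _))
    have hmem : ∀ k : ι, ∀ hk : k ∈ w.localRoots o Ω, k ∈ posCombs P a b →
        w.rootGroupBar o Ω T k ≤ ⨆ c ∈ posCombs Q a b, w.rootGroupBar o Ω T c := by
      rintro k hk ⟨r, s, hr, hs, hrs⟩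
      refine le_iSup₂ (f := fun (c : w.localRoots o Ω) (_ : c ∈ posCombs Q a b) =>
        w.rootGroupBar o Ω T c) ⟨k, hk⟩ ⟨r, s, hr, hs, hf ?_⟩
      rw [map_add, map_nsmul, map_nsmul, hroot, hroot, hroot, hrs]
    refine (iSup₂_le fun k hk => w.rootGroup_le_pullback_of_localRoots hd hΩ
      (fun hk' => hmem k hk' hk) fun j hj hjk => hmem j hj ?_ :
      (⨆ k ∈ posCombs P a b, w.rootGroup o Ω k) ≤ w.pullback _)
      ((w.isCommClosed_rootGroup hΩ).commutator_mem a b hab' u hu u' hu')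
    -- When only the double of `rα + sβ` is local, it is still a positive combination of `α` and
    -- `β`.
    obtain ⟨r, s, hr, hs, hrs⟩ := hk
    refine ⟨2 * r, 2 * s, by omega, by omega, ?_⟩
    rw [hjk, hrs, ofNat_smul_eq_nsmul ℝ, smul_add, mul_smul, mul_smul]
  double_lt a b hab := w.rootGroupBar_double_lt hd hν hΩ
    (by rw [← hroot, ← hroot, hab, map_smul]) a.2
  isCoset a := w.isCoset_cosetBar hd hΩ a.2
  opposite_subset a x hx := by
    refine w.mem_mul_cosetBar_mul hd hΩ a.2 ?_ hx.2
    have := hx.1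
    rw [negIdx, ← hperm a a]
    exact this
  conj_eq a b x hx := by
    rw [w.map_conj_rootGroupBar hd hν hΩ a.2 b.2 hx, hperm]
  inter_eq v hv := by
    obtain ⟨v₀, hv₀⟩ := hval v
    -- A chamber of the local root system is refined to a chamber of the whole system.
    obtain ⟨v', hv', hpos⟩ := exists_isRegular_near (P := P) v₀
    have h1 : ∀ a : w.localRoots o Ω, 0 < Q.root' a v → 0 < P.root' a v' := fun a ha =>
      hpos a (by rwa [hv₀])
    have h2 : ∀ a : w.localRoots o Ω, Q.root' a v < 0 → 0 < P.root' a (-v') := fun a ha => by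
      have := hpos (negIdx P a) (by rw [root'_negIdx, hv₀]; linarith)
      rwa [root'_negIdx, ← map_neg] at this
    refine Set.eq_singleton_iff_unique_mem.2 ⟨⟨⟨1, one_mem _, 1, one_mem _, one_mul 1⟩,
      one_mem _⟩, ?_⟩
    rintro _ ⟨⟨y, hy, z, hz, rfl⟩, hx⟩
    obtain ⟨t, ht, rfl⟩ := w.mem_torusBar.1 hy
    obtain ⟨p, hp, rfl⟩ := w.exists_lift_of_mem_chamberGroup h1 hz
    obtain ⟨n, hn, hnx⟩ := w.exists_lift_of_mem_chamberGroup h2 hx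
    change w.proj o Ω T n = w.proj o Ω T t * w.proj o Ω T p at hnx
    change w.proj o Ω T t * w.proj o Ω T p = 1
    rw [← hnx]
    exact w.chamberGroup_inter hd hν hΩ hv' ht hp hn (by rw [hnx, map_mul])

end Quotient

end RValuation

end LocalRootDatum

theorem mainTheorem4 {ι E V G R A : Type*}
    [Finite ι] [Nonempty ι] [AddCommGroup E] [Module ℝ E] [AddCommGroup V] [Module ℝ V]
    (P : RootPairing ι ℝ E V) [P.IsRootSystem] [P.IsCrystallographic]
    [AddCommGroup R] [LinearOrder R] [IsOrderedAddMonoid R] [Nontrivial R]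
    [Group G] (T : Subgroup G) (U : ι → Subgroup G) (M : ι → Set G)
    (hdatum : IsRootGroupDatum P T U M) (hgen : IsGeneratingDatum T U)
    (w : RValuation P U M R)
    [AddTorsor (VR P R) A] (o : A)
    (ν : groupN M →* affGroup P R A) (hν : IsCompatibleAction w o ν)
    (Ω : Set A) (hΩ : Ω.Nonempty) :
    w.localGroupStar o Ω T ≤ w.localGroup o Ω ∧
    ∃ Q : RootPairing (w.localRoots o Ω) ℝ (Submodule.span ℝ (P.root '' w.localRoots o Ω))
        (Module.Dual ℝ (Submodule.span ℝ (P.root '' w.localRoots o Ω))),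
      (∀ a, (Q.root a : E) = P.root a) ∧ Q.IsRootSystem ∧ Q.IsCrystallographic ∧
      ∃ _ : (w.localKernel o Ω T).Normal,
        IsRootGroupDatum Q (w.torusBar o Ω T) (fun a => w.rootGroupBar o Ω T a)
          (fun a => w.cosetBar o Ω T a) ∧
        IsGeneratingDatum (w.torusBar o Ω T)
          (fun a : w.localRoots o Ω => w.rootGroupBar o Ω T a) := by
  obtain ⟨Q, hroot, hsys, hcrys, hperm, hval⟩ := exists_subRootPairing P (w.localRoots o Ω)
    fun i hi j hj => w.reflectionPerm_mem_localRoots hdatum hν hΩ hi hj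
  have hN := w.normal_localKernel hdatum hν hΩ
  exact ⟨w.localGroupStar_le, Q, hroot, hsys, hcrys, hN,
    w.isRootGroupDatum_bar hdatum hν hΩ Q (Submodule.subtype _) (Submodule.subtype_injective _)
      hroot hperm hval, w.isGeneratingDatum_bar hdatum hΩ⟩
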